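/- **Setting.** A symmetric 2-group is a symmetric monoidal groupoid $(\mathcal A,+,0)$ in which every object $X$ has an object $Y$ with $Y+X\cong 0$. A 2-ring $\mathcal R$ is a symmetric 2-group with a multiplication that is biadditive (symmetric monoidal in each variable, the two additivity isomorphisms being natural and compatible with each other), associative and unital up to coherent natural isomorphisms compatible with addition; an $\mathcal R$-2-module is a symmetric 2-group with a biadditive action of $\mathcal R$ that is associative and unital up to coherent natural isomorphisms compatible with addition. In the 2-category ($\mathcal R$-2-Mod), a 1-morphism is a symmetric monoidal functor $F$ with natural isomorphisms $F(r\cdot A)\cong r\cdot F(A)$ compatible with all the structure, and a 2-morphism is a monoidal natural transformation compatible with these isomorphisms. Every 2-morphism is invertible. The symbol $0$ also denotes the zero module (one object, one morphism) and the constant 1-morphisms, and 1-morphisms are added pointwise. Canonical isomorphisms such as $F(X+Y)\cong F(X)+F(Y)$, $F(0)\cong 0$ and $F(r\cdot X)\cong r\cdot F(X)$ are left implicit. **Relative kernels and cokernels.** Let $\varphi:G\circ F\Rightarrow 0$ be a 2-morphism, with $\mathcal A\xrightarrow{F}\mathcal B\xrightarrow{G}\mathcal C$. The relative kernel $\mathrm{Ker}(F,\varphi)$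 has as objects the pairs $(A,\ a:F(A)\to 0)$ with $G(a)=\varphi_A$, and as morphisms $(A,a)\to(A',a')$ the morphisms $f:A\to A'$ with $a'\circ F(f)=a$. The relative cokernel $\mathrm{Coker}(\varphi,G)$ has the objects of $\mathcal C$; a morphism $X\to Y$ is a class of pairs $(B\in\mathcal B,\ f:X\to G(B)+Y)$, where $(B,f)$ and $(B',f')$ are identified if there are $A\in\mathcal A$ and $a:B\to F(A)+B'$ such that $f$ followed by $G(B)+Y\xrightarrow{G(a)+Y}G(F(A))+G(B')+Y\xrightarrow{\varphi_A}G(B')+Y$ is $f'$. The composite of $(B,f):X\to Y$ and $(B',g):Y\to Z$ is represented by $(B+B',\ X\to G(B)+Y\to G(B)+G(B')+Z\cong G(B+B')+Z)$. Both are $\mathcal R$-2-modules, with the structure induced from $\mathcal A$ and from $\mathcal C$ respectively. **Complexes and cohomology.** A 2-cochain complex $(\mathcal A_\cdot,L_\cdot,\alpha_\cdot)$ of $\mathcal R$-2-modules consists of 1-morphisms $L_n:\mathcal A_n\to\mathcal A_{n+1}$ and 2-morphisms $\alpha_n:L_{n+1}L_n\Rightarrow 0$ ($n\ge 0$) such that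 for all $n$ the 2-morphisms $L_{n+2}\alpha_n$ and $\alpha_{n+1}L_n$ from $L_{n+2}L_{n+1}L_n$ to $0$ agree. It is completed on the left by $\cdots\to0\to 0\to\mathcal A_0$ and canonical 2-morphisms. For $n\ge 0$, $L_{n-1}$ and $\alpha_{n-1}$ induce $L'_{n-1}:\mathcal A_{n-1}\to\mathrm{Ker}(L_n,\alpha_n)$, $A\mapsto(L_{n-1}A,(\alpha_{n-1})_A)$, and $\alpha_{n-2}$ induces $\overline{\alpha_{n-2}}:L'_{n-1}L_{n-2}\Rightarrow 0$. The $n$-th cohomology $\mathcal R$-2-module is $\mathcal H^n(\mathcal A_\cdot)=\mathrm{Coker}(\overline{\alpha_{n-2}},L'_{n-1})$. A morphism $(F_\cdot,\lambda_\cdot):(\mathcal A_\cdot,L_\cdot,\alpha_\cdot)\to(\mathcal B_\cdot,M_\cdot,\beta_\cdot)$ consists of 1-morphisms $F_n:\mathcal A_n\to\mathcal B_n$ and 2-morphisms $\lambda_n:F_{n+1}L_n\Rightarrow M_nF_n$ such that the 2-morphism $F_{n+2}L_{n+1}L_n\Rightarrow0$ given by $\alpha_n$ equals the composite $F_{n+2}L_{n+1}L_n\Rightarrow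 M_{n+1}F_{n+1}L_n\Rightarrow M_{n+1}M_nF_n\Rightarrow 0$ given by $\lambda_{n+1}$, $\lambda_n$ and $\beta_n$. It induces 1-morphisms $\mathcal H^n(F_\cdot):\mathcal H^n(\mathcal A_\cdot)\to\mathcal H^n(\mathcal B_\cdot)$, given on objects by $(A,a)\mapsto(F_nA,\ M_nF_nA\cong F_{n+1}L_nA\xrightarrow{F_{n+1}a}F_{n+1}0\cong0)$ and on morphisms by $[X,x]\mapsto[F_{n-1}X,\ F_nA\xrightarrow{F_nx}F_nL_{n-1}X+F_nA'\cong M_{n-1}F_{n-1}X+F_nA']$. **Homotopy.** Two such morphisms $(F_\cdot,\lambda_\cdot)$ and $(G_\cdot,\mu_\cdot)$ are 2-cochain homotopic if there are 1-morphisms $H_{n-1}:\mathcal A_n\to\mathcal B_{n-1}$ and 2-morphisms $\tau_n:F_n\Rightarrow M_{n-1}H_{n-1}+H_nL_n+G_n$ ($n\ge0$, with $\mathcal B_{-1}=0$) such that for all $n$ the following two 2-morphisms $F_{n+1}L_n\Rightarrow M_nH_nL_n+M_nG_n$ agree: $$F_{n+1}L_n\overset{\tau_{n+1}L_n}{\Longrightarrow}M_nH_nL_n+H_{n+1}L_{n+1}L_n+G_{n+1}L_n\overset{1+H_{n+1}\alpha_n+\mu_n}{\Longrightarrow}M_nH_nL_n+0+M_nG_n\cong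 M_nH_nL_n+M_nG_n,$$ $$F_{n+1}L_n\overset{\lambda_n}{\Longrightarrow}M_nF_n\overset{M_n\tau_n}{\Longrightarrow}M_nM_{n-1}H_{n-1}+M_nH_nL_n+M_nG_n\overset{\beta_{n-1}H_{n-1}+1+1}{\Longrightarrow}0+M_nH_nL_n+M_nG_n\cong M_nH_nL_n+M_nG_n.$$ **Proposition.** Let $(F_\cdot,\lambda_\cdot),(G_\cdot,\mu_\cdot):(\mathcal A_\cdot,L_\cdot,\alpha_\cdot)\to(\mathcal B_\cdot,M_\cdot,\beta_\cdot)$ be two morphisms of 2-cochain complexes of $\mathcal R$-2-modules. If they are 2-cochain homotopic, then for every $n\ge0$ the induced 1-morphisms $\mathcal H^n(F_\cdot),\mathcal H^n(G_\cdot):\mathcal H^n(\mathcal A_\cdot)\to\mathcal H^n(\mathcal B_\cdot)$ are equivalent, that is, there is an (invertible) 2-morphism $\mathcal H^n(F_\cdot)\Rightarrow\mathcal H^n(G_\cdot)$ in ($\mathcal R$-2-Mod). -/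

import Mathlib

open CategoryTheory MonoidalCategory BraidedCategory
open Functor.LaxMonoidal Functor.OplaxMonoidal

universe u

namespace TwoModules

/-- A symmetric 2-group (symmetric categorical group): a symmetric monoidal groupoid in which
every object is invertible up to isomorphism.  The tensor product `⊗` plays the role of the
addition `+`, and the unit `𝟙_` the role of `0`. -/
class SymTwoGroup (A : Type*) [Category* A] [MonoidalCategory A] [SymmetricCategory A] :
    Prop where
  isGroupoid : IsGroupoid A
  exists_neg (X : A) : ∃ Y : A, Nonempty (Y ⊗ X ≅ 𝟙_ A)

attribute [instance] SymTwoGroup.isGroupoid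

/-- A functor of two variables between symmetric 2-groups which is additive (a symmetric monoidal
functor) in each variable, the two additivity isomorphisms being natural in all variables and
compatible with each other. -/
structure Biadditive (A B C : Type*)
    [Category* A] [MonoidalCategory A] [SymmetricCategory A]
    [Category* B] [MonoidalCategory B] [SymmetricCategory B]
    [Category* C] [MonoidalCategory C] [SymmetricCategory C] where
  /-- the underlying bifunctor `(a, b) ↦ a · b` -/
  functor : A ⥤ B ⥤ C
  /-- `a · (b + b') ≅ a · b + a · b'` and `a · 0 ≅ 0`, making `a · -` symmetric monoidal -/
  braided (a : A) : (functor.obj a).Braided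
  /-- these isomorphisms are natural in `a` -/
  isMonoidal {a a' : A} (f : a ⟶ a') : NatTrans.IsMonoidal (functor.map f)
  /-- `(a + a') · b ≅ a · b + a' · b` -/
  dist (a a' : A) (b : B) :
    (functor.obj (a ⊗ a')).obj b ≅ (functor.obj a).obj b ⊗ (functor.obj a').obj b
  dist_naturality {a₁ a₂ a₁' a₂' : A} (f : a₁ ⟶ a₂) (f' : a₁' ⟶ a₂') (b : B) :
    (functor.map (f ⊗ₘ f')).app b ≫ (dist a₂ a₂' b).hom =
      (dist a₁ a₁' b).hom ≫ ((functor.map f).app b ⊗ₘ (functor.map f').app b)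
  dist_naturality_right (a a' : A) {b b' : B} (g : b ⟶ b') :
    (functor.obj (a ⊗ a')).map g ≫ (dist a a' b').hom =
      (dist a a' b).hom ≫ ((functor.obj a).map g ⊗ₘ (functor.obj a').map g)
  dist_assoc (a a' a'' : A) (b : B) :
    (dist (a ⊗ a') a'' b).hom ≫ (dist a a' b).hom ▷ (functor.obj a'').obj b ≫ (α_ _ _ _).hom =
      (functor.map (α_ a a' a'').hom).app b ≫ (dist a (a' ⊗ a'') b).hom ≫
        (functor.obj a).obj b ◁ (dist a' a'' b).hom
  dist_braiding (a a' : A) (b : B) :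
    (functor.map (β_ a a').hom).app b ≫ (dist a' a b).hom =
      (dist a a' b).hom ≫ (β_ _ _).hom
  /-- the two ways of expanding `(a + a') · (b + b')` agree -/
  interchange (a a' : A) (b b' : B) :
    (dist a a' (b ⊗ b')).hom ≫ (δ (functor.obj a) b b' ⊗ₘ δ (functor.obj a') b b') ≫
        tensorμ _ _ _ _ =
      δ (functor.obj (a ⊗ a')) b b' ≫ ((dist a a' b).hom ⊗ₘ (dist a a' b').hom)
  /-- the two ways of contracting `(a + a') · 0` to `0` agree -/
  interchange_zero (a a' : A) :
    (dist a a' (𝟙_ B)).hom ≫ (η (functor.obj a) ⊗ₘ η (functor.obj a')) ≫ (λ_ (𝟙_ C)).hom =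
      η (functor.obj (a ⊗ a'))

attribute [instance] Biadditive.braided Biadditive.isMonoidal

/-- A 2-ring (categorical ring): a symmetric 2-group with a biadditive multiplication, associative
and unital up to coherent additive isomorphisms. -/
class TwoRing (R : Type*) [Category* R] [MonoidalCategory R] [SymmetricCategory R]
    extends SymTwoGroup R where
  mul : Biadditive R R R
  one : R
  /-- `(r s) t ≅ r (s t)` -/
  mulAssoc (r s t : R) :
    (mul.functor.obj ((mul.functor.obj r).obj s)).obj t ≅
      (mul.functor.obj r).obj ((mul.functor.obj s).obj t)
  oneMul (r : R) : (mul.functor.obj one).obj r ≅ r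
  mulOne (r : R) : (mul.functor.obj r).obj one ≅ r
  mulAssoc_naturality_left {r r' : R} (f : r ⟶ r') (s t : R) :
    (mul.functor.map ((mul.functor.map f).app s)).app t ≫ (mulAssoc r' s t).hom =
      (mulAssoc r s t).hom ≫ (mul.functor.map f).app _
  mulAssoc_naturality_middle (r : R) {s s' : R} (f : s ⟶ s') (t : R) :
    (mul.functor.map ((mul.functor.obj r).map f)).app t ≫ (mulAssoc r s' t).hom =
      (mulAssoc r s t).hom ≫ (mul.functor.obj r).map ((mul.functor.map f).app t)
  mulAssoc_naturality_right (r s : R) {t t' : R} (f : t ⟶ t') :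
    (mul.functor.obj ((mul.functor.obj r).obj s)).map f ≫ (mulAssoc r s t').hom =
      (mulAssoc r s t).hom ≫ (mul.functor.obj r).map ((mul.functor.obj s).map f)
  oneMul_naturality {r r' : R} (f : r ⟶ r') :
    (mul.functor.obj one).map f ≫ (oneMul r').hom = (oneMul r).hom ≫ f
  mulOne_naturality {r r' : R} (f : r ⟶ r') :
    (mul.functor.map f).app one ≫ (mulOne r').hom = (mulOne r).hom ≫ f
  pentagon (r s t w : R) :
    (mul.functor.map (mulAssoc r s t).hom).app w ≫
        (mulAssoc r ((mul.functor.obj s).obj t) w).hom ≫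
        (mul.functor.obj r).map (mulAssoc s t w).hom =
      (mulAssoc ((mul.functor.obj r).obj s) t w).hom ≫
        (mulAssoc r s ((mul.functor.obj t).obj w)).hom
  triangle (r s : R) :
    (mulAssoc r one s).hom ≫ (mul.functor.obj r).map (oneMul s).hom =
      (mul.functor.map (mulOne r).hom).app s
  /-- the associativity isomorphism is additive in each of the three variables -/
  mulAssoc_add_left (r r' s t : R) :
    (mul.functor.map (mul.dist r r' s).hom).app t ≫ (mul.dist _ _ t).hom ≫
        ((mulAssoc r s t).hom ⊗ₘ (mulAssoc r' s t).hom) =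
      (mulAssoc (r ⊗ r') s t).hom ≫ (mul.dist r r' _).hom
  mulAssoc_add_middle (r s s' t : R) :
    (mul.functor.map (δ (mul.functor.obj r) s s')).app t ≫ (mul.dist _ _ t).hom ≫
        ((mulAssoc r s t).hom ⊗ₘ (mulAssoc r s' t).hom) =
      (mulAssoc r (s ⊗ s') t).hom ≫ (mul.functor.obj r).map (mul.dist s s' t).hom ≫
        δ (mul.functor.obj r) _ _
  mulAssoc_add_right (r s t t' : R) :
    δ (mul.functor.obj ((mul.functor.obj r).obj s)) t t' ≫
        ((mulAssoc r s t).hom ⊗ₘ (mulAssoc r s t').hom) =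
      (mulAssoc r s (t ⊗ t')).hom ≫ (mul.functor.obj r).map (δ (mul.functor.obj s) t t') ≫
        δ (mul.functor.obj r) _ _
  mulAssoc_zero (r s : R) :
    (mulAssoc r s (𝟙_ R)).hom ≫ (mul.functor.obj r).map (η (mul.functor.obj s)) ≫
        η (mul.functor.obj r) =
      η (mul.functor.obj ((mul.functor.obj r).obj s))
  /-- the unit isomorphisms are additive -/
  oneMul_add (r s : R) :
    δ (mul.functor.obj one) r s ≫ ((oneMul r).hom ⊗ₘ (oneMul s).hom) = (oneMul (r ⊗ s)).hom
  oneMul_zero : (oneMul (𝟙_ R)).hom = η (mul.functor.obj one)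
  mulOne_add (r s : R) :
    (mul.dist r s one).hom ≫ ((mulOne r).hom ⊗ₘ (mulOne s).hom) = (mulOne (r ⊗ s)).hom

variable {R : Type*} [Category* R] [MonoidalCategory R] [SymmetricCategory R] [TwoRing R]

/-- An `R`-2-module structure on a symmetric 2-group `M`: a biadditive action of the 2-ring `R`,
associative and unital up to coherent additive isomorphisms. -/
class TwoModule (R : Type*) [Category* R] [MonoidalCategory R] [SymmetricCategory R] [TwoRing R]
    (M : Type*) [Category* M] [MonoidalCategory M] [SymmetricCategory M]
    extends SymTwoGroup M where
  act : Biadditive R M M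
  /-- `(r s) · m ≅ r · (s · m)` -/
  actAssoc (r s : R) (m : M) :
    (act.functor.obj ((TwoRing.mul.functor.obj r).obj s)).obj m ≅
      (act.functor.obj r).obj ((act.functor.obj s).obj m)
  /-- `1 · m ≅ m` -/
  oneAct (m : M) : (act.functor.obj TwoRing.one).obj m ≅ m
  actAssoc_naturality_left {r r' : R} (f : r ⟶ r') (s : R) (m : M) :
    (act.functor.map ((TwoRing.mul.functor.map f).app s)).app m ≫ (actAssoc r' s m).hom =
      (actAssoc r s m).hom ≫ (act.functor.map f).app _
  actAssoc_naturality_middle (r : R) {s s' : R} (f : s ⟶ s') (m : M) :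
    (act.functor.map ((TwoRing.mul.functor.obj r).map f)).app m ≫ (actAssoc r s' m).hom =
      (actAssoc r s m).hom ≫ (act.functor.obj r).map ((act.functor.map f).app m)
  actAssoc_naturality_right (r s : R) {m m' : M} (f : m ⟶ m') :
    (act.functor.obj ((TwoRing.mul.functor.obj r).obj s)).map f ≫ (actAssoc r s m').hom =
      (actAssoc r s m).hom ≫ (act.functor.obj r).map ((act.functor.obj s).map f)
  oneAct_naturality {m m' : M} (f : m ⟶ m') :
    (act.functor.obj TwoRing.one).map f ≫ (oneAct m').hom = (oneAct m).hom ≫ f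
  pentagon (r s t : R) (m : M) :
    (act.functor.map (TwoRing.mulAssoc r s t).hom).app m ≫
        (actAssoc r ((TwoRing.mul.functor.obj s).obj t) m).hom ≫
        (act.functor.obj r).map (actAssoc s t m).hom =
      (actAssoc ((TwoRing.mul.functor.obj r).obj s) t m).hom ≫
        (actAssoc r s ((act.functor.obj t).obj m)).hom
  triangle (r : R) (m : M) :
    (actAssoc r TwoRing.one m).hom ≫ (act.functor.obj r).map (oneAct m).hom =
      (act.functor.map (TwoRing.mulOne r).hom).app m
  /-- the associativity isomorphism is additive in each of the three variables -/
  actAssoc_add_left (r r' s : R) (m : M) :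
    (act.functor.map (TwoRing.mul.dist r r' s).hom).app m ≫ (act.dist _ _ m).hom ≫
        ((actAssoc r s m).hom ⊗ₘ (actAssoc r' s m).hom) =
      (actAssoc (r ⊗ r') s m).hom ≫ (act.dist r r' _).hom
  actAssoc_add_middle (r s s' : R) (m : M) :
    (act.functor.map (δ (TwoRing.mul.functor.obj r) s s')).app m ≫ (act.dist _ _ m).hom ≫
        ((actAssoc r s m).hom ⊗ₘ (actAssoc r s' m).hom) =
      (actAssoc r (s ⊗ s') m).hom ≫ (act.functor.obj r).map (act.dist s s' m).hom ≫
        δ (act.functor.obj r) _ _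
  actAssoc_add_right (r s : R) (m m' : M) :
    δ (act.functor.obj ((TwoRing.mul.functor.obj r).obj s)) m m' ≫
        ((actAssoc r s m).hom ⊗ₘ (actAssoc r s m').hom) =
      (actAssoc r s (m ⊗ m')).hom ≫ (act.functor.obj r).map (δ (act.functor.obj s) m m') ≫
        δ (act.functor.obj r) _ _
  actAssoc_zero (r s : R) :
    (actAssoc r s (𝟙_ M)).hom ≫ (act.functor.obj r).map (η (act.functor.obj s)) ≫
        η (act.functor.obj r) =
      η (act.functor.obj ((TwoRing.mul.functor.obj r).obj s))
  /-- the unit isomorphism is additive -/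
  oneAct_add (m m' : M) :
    δ (act.functor.obj TwoRing.one) m m' ≫ ((oneAct m).hom ⊗ₘ (oneAct m').hom) =
      (oneAct (m ⊗ m')).hom
  oneAct_zero : (oneAct (𝟙_ M)).hom = η (act.functor.obj TwoRing.one)

/-- A (small) `R`-2-module. -/
structure TwoMod (R : Type*) [Category* R] [MonoidalCategory R] [SymmetricCategory R]
    [TwoRing R] where
  carrier : Type u
  [category : Category.{u} carrier]
  [monoidal : MonoidalCategory carrier]
  [symmetric : SymmetricCategory carrier]
  [twoModule : TwoModule R carrier]

namespace TwoMod

instance : CoeSort (TwoMod.{u} R) (Type u) := ⟨TwoMod.carrier⟩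

attribute [instance] category monoidal symmetric twoModule

/-- The symmetric monoidal functor `r · -`. -/
abbrev sm (M : TwoMod.{u} R) (r : R) : M ⥤ M :=
  (TwoModule.act (R := R) (M := M)).functor.obj r

/-- The natural transformation `r · - ⟶ s · -` given by a morphism `r ⟶ s`. -/
abbrev smMap (M : TwoMod.{u} R) {r s : R} (f : r ⟶ s) : M.sm r ⟶ M.sm s :=
  (TwoModule.act (R := R) (M := M)).functor.map f

/-- `(r + s) · m ≅ r · m + s · m` -/
abbrev dist (M : TwoMod.{u} R) (r s : R) (m : M) :
    (M.sm (r ⊗ s)).obj m ≅ (M.sm r).obj m ⊗ (M.sm s).obj m :=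
  (TwoModule.act (R := R) (M := M)).dist r s m

/-- `(r s) · m ≅ r · (s · m)` -/
abbrev assoc (M : TwoMod.{u} R) (r s : R) (m : M) :
    (M.sm ((TwoRing.mul.functor.obj r).obj s)).obj m ≅ (M.sm r).obj ((M.sm s).obj m) :=
  TwoModule.actAssoc r s m

/-- `1 · m ≅ m` -/
abbrev one (M : TwoMod.{u} R) (m : M) : (M.sm TwoRing.one).obj m ≅ m :=
  TwoModule.oneAct m

/-- A 1-morphism of `R`-2-modules (an `R`-homomorphism): a symmetric monoidal functor together with
natural isomorphisms `F (r · m) ≅ r · F m`, compatible with all the structure. -/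
structure Hom (M N : TwoMod.{u} R) where
  functor : M ⥤ N
  braided : functor.Braided
  smul (r : R) (m : M) : functor.obj ((M.sm r).obj m) ≅ (N.sm r).obj (functor.obj m)
  smul_naturality_left {r s : R} (f : r ⟶ s) (m : M) :
    functor.map ((M.smMap f).app m) ≫ (smul s m).hom =
      (smul r m).hom ≫ (N.smMap f).app (functor.obj m)
  smul_naturality_right (r : R) {m m' : M} (f : m ⟶ m') :
    functor.map ((M.sm r).map f) ≫ (smul r m').hom =
      (smul r m).hom ≫ (N.sm r).map (functor.map f)
  smul_add (r : R) (m m' : M) :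
    functor.map (δ (M.sm r) m m') ≫ δ functor _ _ ≫ ((smul r m).hom ⊗ₘ (smul r m').hom) =
      (smul r (m ⊗ m')).hom ≫ (N.sm r).map (δ functor m m') ≫ δ (N.sm r) _ _
  smul_zero (r : R) :
    functor.map (η (M.sm r)) ≫ η functor =
      (smul r (𝟙_ M)).hom ≫ (N.sm r).map (η functor) ≫ η (N.sm r)
  smul_dist (r s : R) (m : M) :
    functor.map (M.dist r s m).hom ≫ δ functor _ _ ≫ ((smul r m).hom ⊗ₘ (smul s m).hom) =
      (smul (r ⊗ s) m).hom ≫ (N.dist r s (functor.obj m)).hom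
  smul_assoc (r s : R) (m : M) :
    functor.map (M.assoc r s m).hom ≫ (smul r ((M.sm s).obj m)).hom ≫
        (N.sm r).map (smul s m).hom =
      (smul _ m).hom ≫ (N.assoc r s (functor.obj m)).hom
  smul_one (m : M) :
    functor.map (M.one m).hom = (smul TwoRing.one m).hom ≫ (N.one (functor.obj m)).hom

attribute [instance] Hom.braided

/-- A 2-morphism of `R`-2-modules: a monoidal natural transformation compatible with the action
of `R`.  (As `N` is a groupoid, all its components are isomorphisms.) -/
@[ext]
structure Hom₂ {M N : TwoMod.{u} R} (F G : Hom M N) where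
  natTrans : F.functor ⟶ G.functor
  isMonoidal : NatTrans.IsMonoidal natTrans
  smul (r : R) (m : M) :
    natTrans.app ((M.sm r).obj m) ≫ (G.smul r m).hom =
      (F.smul r m).hom ≫ (N.sm r).map (natTrans.app m)

attribute [instance] Hom₂.isMonoidal

/-- The component at `m` of a 2-morphism. -/
abbrev Hom₂.app {M N : TwoMod.{u} R} {F G : Hom M N} (τ : Hom₂ F G) (m : M) :
    F.functor.obj m ⟶ G.functor.obj m := τ.natTrans.app m

/-- 2-morphisms compose vertically. -/
instance {M N : TwoMod.{u} R} : Category (Hom M N) where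
  Hom F G := Hom₂ F G
  id F := ⟨𝟙 _, inferInstance, fun r m => by simp⟩
  comp σ τ := ⟨σ.natTrans ≫ τ.natTrans, inferInstance, fun r m => by
    simp [τ.smul, reassoc_of% σ.smul]⟩
  id_comp _ := Hom₂.ext (Category.id_comp _)
  comp_id _ := Hom₂.ext (Category.comp_id _)
  assoc _ _ _ := Hom₂.ext (Category.assoc _ _ _)

section helpers

variable {C D E : Type*} [Category* C] [MonoidalCategory C] [Category* D] [MonoidalCategory D]
  [Category* E] [MonoidalCategory E]

theorem isMonoidal_δ {F G : C ⥤ D} [F.Monoidal] [G.Monoidal] (τ : F ⟶ G) [NatTrans.IsMonoidal τ]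
    (X Y : C) : τ.app (X ⊗ Y) ≫ δ G X Y = δ F X Y ≫ (τ.app X ⊗ₘ τ.app Y) := by
  rw [← cancel_epi (μ F X Y)]
  simp [NatTrans.IsMonoidal.tensor_assoc]

theorem isMonoidal_η {F G : C ⥤ D} [F.Monoidal] [G.Monoidal] (τ : F ⟶ G)
    [NatTrans.IsMonoidal τ] : τ.app (𝟙_ C) ≫ η G = η F := by
  rw [← cancel_epi (ε F)]
  simp [NatTrans.IsMonoidal.unit_assoc]

theorem μ_map_leftUnitor_η (F : C ⥤ D) [F.Monoidal] :
    μ F (𝟙_ C) (𝟙_ C) ≫ F.map (λ_ (𝟙_ C)).hom ≫ η F = (η F ⊗ₘ η F) ≫ (λ_ (𝟙_ D)).hom := by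
  rw [Functor.Monoidal.map_leftUnitor, Category.assoc, Functor.Monoidal.μ_δ_assoc, Category.assoc,
    ← leftUnitor_naturality, MonoidalCategory.tensorHom_def, Category.assoc]

end helpers

section laws

variable (M : TwoMod.{u} R)

theorem dist_naturality {r₁ r₂ s₁ s₂ : R} (f : r₁ ⟶ r₂) (g : s₁ ⟶ s₂) (m : M) :
    (M.smMap (f ⊗ₘ g)).app m ≫ (M.dist r₂ s₂ m).hom =
      (M.dist r₁ s₁ m).hom ≫ ((M.smMap f).app m ⊗ₘ (M.smMap g).app m) :=
  Biadditive.dist_naturality _ f g m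

theorem dist_naturality_right (r s : R) {m m' : M} (g : m ⟶ m') :
    (M.sm (r ⊗ s)).map g ≫ (M.dist r s m').hom =
      (M.dist r s m).hom ≫ ((M.sm r).map g ⊗ₘ (M.sm s).map g) :=
  Biadditive.dist_naturality_right _ r s g

theorem dist_assoc (r s t : R) (m : M) :
    (M.dist (r ⊗ s) t m).hom ≫ (M.dist r s m).hom ▷ (M.sm t).obj m ≫ (α_ _ _ _).hom =
      (M.smMap (α_ r s t).hom).app m ≫ (M.dist r (s ⊗ t) m).hom ≫
        (M.sm r).obj m ◁ (M.dist s t m).hom :=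
  Biadditive.dist_assoc _ r s t m

theorem dist_braiding (r s : R) (m : M) :
    (M.smMap (β_ r s).hom).app m ≫ (M.dist s r m).hom = (M.dist r s m).hom ≫ (β_ _ _).hom :=
  Biadditive.dist_braiding _ r s m

theorem interchange (r s : R) (m n : M) :
    (M.dist r s (m ⊗ n)).hom ≫ (δ (M.sm r) m n ⊗ₘ δ (M.sm s) m n) ≫ tensorμ _ _ _ _ =
      δ (M.sm (r ⊗ s)) m n ≫ ((M.dist r s m).hom ⊗ₘ (M.dist r s n).hom) :=
  Biadditive.interchange _ r s m n

theorem interchange_zero (r s : R) :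
    (M.dist r s (𝟙_ M)).hom ≫ (η (M.sm r) ⊗ₘ η (M.sm s)) ≫ (λ_ (𝟙_ M)).hom =
      η (M.sm (r ⊗ s)) :=
  Biadditive.interchange_zero _ r s

theorem assoc_naturality_left {r r' : R} (f : r ⟶ r') (s : R) (m : M) :
    (M.smMap ((TwoRing.mul.functor.map f).app s)).app m ≫ (M.assoc r' s m).hom =
      (M.assoc r s m).hom ≫ (M.smMap f).app _ :=
  TwoModule.actAssoc_naturality_left f s m

theorem assoc_naturality_middle (r : R) {s s' : R} (f : s ⟶ s') (m : M) :
    (M.smMap ((TwoRing.mul.functor.obj r).map f)).app m ≫ (M.assoc r s' m).hom =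
      (M.assoc r s m).hom ≫ (M.sm r).map ((M.smMap f).app m) :=
  TwoModule.actAssoc_naturality_middle r f m

theorem assoc_naturality_right (r s : R) {m m' : M} (f : m ⟶ m') :
    (M.sm ((TwoRing.mul.functor.obj r).obj s)).map f ≫ (M.assoc r s m').hom =
      (M.assoc r s m).hom ≫ (M.sm r).map ((M.sm s).map f) :=
  TwoModule.actAssoc_naturality_right r s f

theorem one_naturality {m m' : M} (f : m ⟶ m') :
    (M.sm TwoRing.one).map f ≫ (M.one m').hom = (M.one m).hom ≫ f :=
  TwoModule.oneAct_naturality (R := R) f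

theorem pentagon (r s t : R) (m : M) :
    (M.smMap (TwoRing.mulAssoc r s t).hom).app m ≫
        (M.assoc r ((TwoRing.mul.functor.obj s).obj t) m).hom ≫
        (M.sm r).map (M.assoc s t m).hom =
      (M.assoc ((TwoRing.mul.functor.obj r).obj s) t m).hom ≫
        (M.assoc r s ((M.sm t).obj m)).hom :=
  TwoModule.pentagon r s t m

theorem triangle (r : R) (m : M) :
    (M.assoc r TwoRing.one m).hom ≫ (M.sm r).map (M.one m).hom =
      (M.smMap (TwoRing.mulOne r).hom).app m :=
  TwoModule.triangle r m

theorem assoc_add_left (r r' s : R) (m : M) :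
    (M.smMap (TwoRing.mul.dist r r' s).hom).app m ≫ (M.dist _ _ m).hom ≫
        ((M.assoc r s m).hom ⊗ₘ (M.assoc r' s m).hom) =
      (M.assoc (r ⊗ r') s m).hom ≫ (M.dist r r' _).hom :=
  TwoModule.actAssoc_add_left r r' s m

theorem assoc_add_middle (r s s' : R) (m : M) :
    (M.smMap (δ (TwoRing.mul.functor.obj r) s s')).app m ≫ (M.dist _ _ m).hom ≫
        ((M.assoc r s m).hom ⊗ₘ (M.assoc r s' m).hom) =
      (M.assoc r (s ⊗ s') m).hom ≫ (M.sm r).map (M.dist s s' m).hom ≫ δ (M.sm r) _ _ :=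
  TwoModule.actAssoc_add_middle r s s' m

theorem assoc_add_right (r s : R) (m m' : M) :
    δ (M.sm ((TwoRing.mul.functor.obj r).obj s)) m m' ≫
        ((M.assoc r s m).hom ⊗ₘ (M.assoc r s m').hom) =
      (M.assoc r s (m ⊗ m')).hom ≫ (M.sm r).map (δ (M.sm s) m m') ≫ δ (M.sm r) _ _ :=
  TwoModule.actAssoc_add_right r s m m'

theorem assoc_zero (r s : R) :
    (M.assoc r s (𝟙_ M)).hom ≫ (M.sm r).map (η (M.sm s)) ≫ η (M.sm r) =
      η (M.sm ((TwoRing.mul.functor.obj r).obj s)) :=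
  TwoModule.actAssoc_zero r s

theorem one_add (m m' : M) :
    δ (M.sm TwoRing.one) m m' ≫ ((M.one m).hom ⊗ₘ (M.one m').hom) = (M.one (m ⊗ m')).hom :=
  TwoModule.oneAct_add m m'

theorem one_zero : (M.one (𝟙_ M)).hom = η (M.sm TwoRing.one) :=
  TwoModule.oneAct_zero

theorem μ_assoc (r s : R) (m m' : M) :
    μ (M.sm ((TwoRing.mul.functor.obj r).obj s)) m m' ≫ (M.assoc r s (m ⊗ m')).hom =
      ((M.assoc r s m).hom ⊗ₘ (M.assoc r s m').hom) ≫ μ (M.sm r) _ _ ≫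
        (M.sm r).map (μ (M.sm s) m m') := by
  have h := M.assoc_add_right r s m m'
  rw [← cancel_epi (δ (M.sm _) m m'), reassoc_of% h, Functor.Monoidal.δ_μ_assoc]
  simp

theorem μ_one (m m' : M) :
    μ (M.sm TwoRing.one) m m' ≫ (M.one (m ⊗ m')).hom = ((M.one m).hom ⊗ₘ (M.one m').hom) := by
  rw [← one_add]
  simp

theorem μ_dist (r s : R) (m n : M) :
    μ (M.sm (r ⊗ s)) m n ≫ (M.dist r s (m ⊗ n)).hom =
      ((M.dist r s m).hom ⊗ₘ (M.dist r s n).hom) ≫ tensorδ _ _ _ _ ≫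
        (μ (M.sm r) m n ⊗ₘ μ (M.sm s) m n) := by
  have h := M.interchange r s m n
  rw [← cancel_epi (δ (M.sm _) m n), ← reassoc_of% h, Functor.Monoidal.δ_μ_assoc]
  simp

end laws

/-- Composition of 1-morphisms, in diagrammatic order. -/
def Hom.comp {M N P : TwoMod.{u} R} (F : Hom M N) (G : Hom N P) : Hom M P where
  functor := F.functor ⋙ G.functor
  braided := inferInstance
  smul r m := G.functor.mapIso (F.smul r m) ≪≫ G.smul r (F.functor.obj m)
  smul_naturality_left f m := by
    simp only [Functor.comp_obj, Functor.comp_map, Iso.trans_hom, Functor.mapIso_hom,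
      Category.assoc, ← G.smul_naturality_left]
    simp only [← Functor.map_comp_assoc, F.smul_naturality_left]
  smul_naturality_right r m m' f := by
    simp only [Functor.comp_obj, Functor.comp_map, Iso.trans_hom, Functor.mapIso_hom,
      Category.assoc, ← G.smul_naturality_right]
    simp only [← Functor.map_comp_assoc, F.smul_naturality_right]
  smul_add r m m' := by
    simp only [Functor.comp_obj, Functor.comp_map, comp_δ, Iso.trans_hom, Functor.mapIso_hom,
      Category.assoc, ← tensorHom_comp_tensorHom, δ_natural_assoc]
    simp only [← Functor.map_comp_assoc, F.smul_add]
    simp only [Functor.map_comp, Category.assoc, G.smul_add, reassoc_of% G.smul_naturality_right]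
  smul_zero r := by
    simp only [Functor.comp_obj, Functor.comp_map, comp_η, Iso.trans_hom, Functor.mapIso_hom,
      Category.assoc]
    simp only [← Functor.map_comp_assoc, F.smul_zero]
    simp only [Functor.map_comp, Category.assoc, G.smul_zero, reassoc_of% G.smul_naturality_right]
  smul_dist r s m := by
    simp only [Functor.comp_obj, Functor.comp_map, comp_δ, Iso.trans_hom, Functor.mapIso_hom,
      Category.assoc, ← tensorHom_comp_tensorHom, δ_natural_assoc]
    simp only [← Functor.map_comp_assoc, F.smul_dist]
    simp only [Functor.map_comp, Category.assoc, G.smul_dist]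
  smul_assoc r s m := by
    simp only [Functor.comp_obj, Functor.comp_map, Iso.trans_hom, Functor.mapIso_hom,
      Category.assoc, Functor.map_comp]
    rw [← reassoc_of% G.smul_naturality_right]
    simp only [← Functor.map_comp_assoc, F.smul_assoc]
    simp only [Functor.map_comp, Category.assoc, G.smul_assoc]
  smul_one m := by
    simp [F.smul_one, G.smul_one]

instance constBraided (C D : Type*) [Category* C] [MonoidalCategory C] [SymmetricCategory C]
    [Category* D] [MonoidalCategory D] [SymmetricCategory D] :
    ((Functor.const C).obj (𝟙_ D)).Braided where
  ε := 𝟙 _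
  μ _ _ := (λ_ (𝟙_ D)).hom
  η := 𝟙 _
  δ _ _ := (λ_ (𝟙_ D)).inv
  associativity _ _ _ := by dsimp; monoidal
  left_unitality _ := by dsimp; monoidal
  right_unitality _ := by dsimp; monoidal
  oplax_associativity _ _ _ := by dsimp; monoidal
  oplax_left_unitality _ := by dsimp; monoidal
  oplax_right_unitality _ := by dsimp; monoidal
  braided _ _ := by dsimp; rw [braiding_tensorUnit_left]; simp [unitors_equal]

section const

variable (C D : Type*) [Category* C] [MonoidalCategory C] [SymmetricCategory C]
    [Category* D] [MonoidalCategory D] [SymmetricCategory D]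

@[simp] theorem const_η : η ((Functor.const C).obj (𝟙_ D)) = 𝟙 (𝟙_ D) := rfl
@[simp] theorem const_ε : ε ((Functor.const C).obj (𝟙_ D)) = 𝟙 (𝟙_ D) := rfl
@[simp] theorem const_δ (X Y : C) :
    δ ((Functor.const C).obj (𝟙_ D)) X Y = (λ_ (𝟙_ D)).inv := rfl
@[simp] theorem const_μ (X Y : C) :
    μ ((Functor.const C).obj (𝟙_ D)) X Y = (λ_ (𝟙_ D)).hom := rfl

end const

/-- The zero 1-morphism, constant at the unit object. -/
def Hom.zero (M N : TwoMod.{u} R) : Hom M N where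
  functor := (Functor.const M).obj (𝟙_ N)
  braided := constBraided _ _
  smul r _ := (Functor.Monoidal.εIso (N.sm r))
  smul_naturality_left f m := by
    simp
  smul_naturality_right r m m' f := by
    simp
  smul_add r m m' := by
    simp only [Functor.const_obj_obj, Functor.const_obj_map, const_δ,
      Functor.Monoidal.map_leftUnitor_inv]
    simp [MonoidalCategory.tensorHom_def']
  smul_zero r := by
    simp
  smul_dist r s m := by
    rw [← cancel_mono ((η (N.sm r) ⊗ₘ η (N.sm s)) ≫ (λ_ (𝟙_ N)).hom)]
    simp [interchange_zero]
  smul_assoc r s m := by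
    rw [← cancel_mono ((N.sm r).map (η (N.sm s)) ≫ η (N.sm r))]
    simp [assoc_zero]
  smul_one m := by
    simp [one_zero]

section add

variable {C D : Type*} [Category* C] [MonoidalCategory C]
    [Category* D] [MonoidalCategory D] [SymmetricCategory D]

theorem tensorμ_braiding (X₁ X₂ Y₁ Y₂ : D) :
    tensorμ X₁ X₂ Y₁ Y₂ ≫ ((β_ X₁ Y₁).hom ⊗ₘ (β_ X₂ Y₂).hom) =
      (β_ (X₁ ⊗ X₂) (Y₁ ⊗ Y₂)).hom ≫ tensorμ Y₁ Y₂ X₁ X₂ := by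
  simp [tensorμ, SymmetricCategory.braiding_swap_eq_inv_braiding Y₂ X₁, MonoidalCategory.tensorHom_def]

/-- The pointwise sum `X ↦ F X + G X` of two functors. -/
abbrev sumFunctor (F G : C ⥤ D) : C ⥤ D := F.prod' G ⋙ tensor D

section

variable (F G : C ⥤ D)

theorem sumFunctor_μ [F.LaxMonoidal] [G.LaxMonoidal] (X Y : C) :
    μ (sumFunctor F G) X Y = tensorμ _ _ _ _ ≫ (μ F X Y ⊗ₘ μ G X Y) := by
  simp

theorem sumFunctor_ε [F.LaxMonoidal] [G.LaxMonoidal]  :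
    ε (sumFunctor F G) = (λ_ _).inv ≫ (ε F ⊗ₘ ε G) := by
  simp

theorem sumFunctor_δ [F.OplaxMonoidal] [G.OplaxMonoidal] (X Y : C) :
    δ (sumFunctor F G) X Y = (δ F X Y ⊗ₘ δ G X Y) ≫ tensorδ _ _ _ _ := by
  simp

theorem sumFunctor_η [F.OplaxMonoidal] [G.OplaxMonoidal]  :
    η (sumFunctor F G) = (η F ⊗ₘ η G) ≫ (λ_ _).hom := by
  simp
end

instance [SymmetricCategory C] (F G : C ⥤ D) [F.Braided] [G.Braided] : (sumFunctor F G).Braided where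
  braided X Y := by
    rw [sumFunctor_μ, sumFunctor_μ]
    simp only [Category.assoc, Functor.comp_map, tensor_map, Functor.prod'_map,
      tensorHom_comp_tensorHom, Functor.LaxBraided.braided]
    rw [← tensorHom_comp_tensorHom, reassoc_of% tensorμ_braiding]
    rfl

end add

section

variable {D : Type*} [Category* D] [MonoidalCategory D] [SymmetricCategory D]

instance (X₁ X₂ Y₁ Y₂ : D) : IsIso (tensorμ X₁ X₂ Y₁ Y₂) :=
  ⟨tensorδ X₁ X₂ Y₁ Y₂, by simp, by simp⟩

theorem tensorδ_natural {X₁ X₂ Y₁ Y₂ U₁ U₂ V₁ V₂ : D} (f₁ : X₁ ⟶ Y₁) (f₂ : X₂ ⟶ Y₂)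
    (g₁ : U₁ ⟶ V₁) (g₂ : U₂ ⟶ V₂) :
    tensorδ X₁ X₂ U₁ U₂ ≫ ((f₁ ⊗ₘ f₂) ⊗ₘ g₁ ⊗ₘ g₂) =
      ((f₁ ⊗ₘ g₁) ⊗ₘ f₂ ⊗ₘ g₂) ≫ tensorδ Y₁ Y₂ V₁ V₂ := by
  have h := tensorμ_natural f₁ f₂ g₁ g₂
  rw [← cancel_mono (tensorμ _ _ _ _), Category.assoc, h, tensorδ_tensorμ_assoc, Category.assoc,
    tensorδ_tensorμ, Category.comp_id]

end

/-- The sum of two 1-morphisms, `(F + G) m = F m + G m`. -/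
def Hom.add {M N : TwoMod.{u} R} (F G : Hom M N) : Hom M N where
  functor := sumFunctor F.functor G.functor
  braided := inferInstance
  smul r m :=
    { hom := ((F.smul r m).hom ⊗ₘ (G.smul r m).hom) ≫ μ (N.sm r) _ _
      inv := δ (N.sm r) _ _ ≫ ((F.smul r m).inv ⊗ₘ (G.smul r m).inv) }
  smul_naturality_left f m := by
    have h := NatTrans.IsMonoidal.tensor (τ := N.smMap f) (F.functor.obj m) (G.functor.obj m)
    dsimp
    rw [Category.assoc, h, tensorHom_comp_tensorHom_assoc, tensorHom_comp_tensorHom_assoc,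
      F.smul_naturality_left, G.smul_naturality_left]
  smul_naturality_right r m m' f := by
    dsimp
    rw [Category.assoc, ← μ_natural, tensorHom_comp_tensorHom_assoc,
      tensorHom_comp_tensorHom_assoc, F.smul_naturality_right, G.smul_naturality_right]
  smul_add r m m' := by
    rw [sumFunctor_δ, sumFunctor_δ, ← cancel_mono (μ (N.sm r) _ _),
      ← cancel_mono ((N.sm r).map (tensorμ _ _ _ _))]
    dsimp
    simp only [Category.assoc, ← tensorHom_comp_tensorHom,
      Functor.Monoidal.δ_μ]
    rw [← tensorμ_comp_μ_tensorHom_μ_comp_μ, tensorμ_natural_assoc, tensorδ_tensorμ_assoc,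
      Category.id_comp, ← Functor.map_comp, Category.assoc, tensorδ_tensorμ, Category.comp_id,
      ← μ_natural]
    simp only [tensorHom_comp_tensorHom_assoc, reassoc_of% F.smul_add,
      reassoc_of% G.smul_add, Functor.Monoidal.δ_μ, Category.comp_id]
  smul_zero r := by
    rw [sumFunctor_η]
    dsimp
    simp only [tensorHom_comp_tensorHom_assoc, Category.assoc, F.smul_zero, G.smul_zero]
    simp only [← tensorHom_comp_tensorHom, Category.assoc, Functor.map_comp,
      ← μ_natural_assoc, μ_map_leftUnitor_η]
  smul_dist r s m := by
    rw [sumFunctor_δ]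
    dsimp
    simp only [Category.assoc, ← tensorHom_comp_tensorHom, μ_dist]
    rw [reassoc_of% tensorδ_natural]
    simp only [tensorHom_comp_tensorHom_assoc, F.smul_dist, G.smul_dist]
  smul_assoc r s m := by
    dsimp
    simp only [Category.assoc, Functor.map_comp, μ_assoc, ← μ_natural_assoc,
      tensorHom_comp_tensorHom_assoc, F.smul_assoc, G.smul_assoc]
  smul_one m := by
    dsimp
    simp only [Category.assoc, μ_one, tensorHom_comp_tensorHom, F.smul_one, G.smul_one]

section null

variable {A B C : TwoMod.{u} R} {F : Hom A B} {G : Hom B C}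

/-- The component `G (F X) ⟶ 0` of a 2-morphism `G ∘ F ⟹ 0`. -/
def null (φ : Hom₂ (F.comp G) (Hom.zero A C)) (X : A) :
    G.functor.obj (F.functor.obj X) ⟶ 𝟙_ C := φ.app X

variable (φ : Hom₂ (F.comp G) (Hom.zero A C))

theorem null_tensor (X Y : A) :
    null φ (X ⊗ Y) = G.functor.map (δ F.functor X Y) ≫ δ G.functor _ _ ≫
      (null φ X ⊗ₘ null φ Y) ≫ (λ_ (𝟙_ C)).hom := by
  have h : null φ (X ⊗ Y) ≫ (λ_ (𝟙_ C)).inv =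
      (G.functor.map (δ F.functor X Y) ≫ δ G.functor _ _) ≫ (null φ X ⊗ₘ null φ Y) :=
    isMonoidal_δ φ.natTrans X Y
  rw [← cancel_mono (λ_ (𝟙_ C)).inv, h]
  simp

theorem null_unit : null φ (𝟙_ A) = G.functor.map (η F.functor) ≫ η G.functor := by
  have h : null φ (𝟙_ A) ≫ 𝟙 (𝟙_ C) = G.functor.map (η F.functor) ≫ η G.functor :=
    isMonoidal_η φ.natTrans
  rw [← h, Category.comp_id]

theorem null_smul (r : R) (X : A) :
    null φ ((A.sm r).obj X) = G.functor.map (F.smul r X).hom ≫ (G.smul r _).hom ≫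
      (C.sm r).map (null φ X) ≫ η (C.sm r) := by
  have h : null φ ((A.sm r).obj X) ≫ ε (C.sm r) =
      (G.functor.map (F.smul r X).hom ≫ (G.smul r _).hom) ≫ (C.sm r).map (null φ X) :=
    φ.smul r X
  rw [← cancel_mono (ε (C.sm r)), h]
  simp

theorem null_naturality {X Y : A} (f : X ⟶ Y) :
    G.functor.map (F.functor.map f) ≫ null φ Y = null φ X :=
  (φ.natTrans.naturality f).trans (Category.comp_id _)

end null

theorem map_leftUnitor_η {C D : Type*} [Category* C] [MonoidalCategory C] [Category* D]
    [MonoidalCategory D] (F : C ⥤ D) [F.Monoidal] :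
    F.map (λ_ (𝟙_ C)).hom ≫ η F = δ F _ _ ≫ (η F ⊗ₘ η F) ≫ (λ_ (𝟙_ D)).hom := by
  rw [← μ_map_leftUnitor_η, Functor.Monoidal.δ_μ_assoc]

section NullHom

variable {A B : TwoMod.{u} R} (F : Hom A B)

/-- `F (X + Y) ≅ F X + F Y ⟶ 0 + 0 ≅ 0` -/
def addNull {X Y : A} (a : F.functor.obj X ⟶ 𝟙_ B) (b : F.functor.obj Y ⟶ 𝟙_ B) :
    F.functor.obj (X ⊗ Y) ⟶ 𝟙_ B :=
  δ F.functor X Y ≫ (a ⊗ₘ b) ≫ (λ_ (𝟙_ B)).hom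

/-- `F (r · X) ≅ r · F X ⟶ r · 0 ≅ 0` -/
def smulNull (r : R) {X : A} (a : F.functor.obj X ⟶ 𝟙_ B) :
    F.functor.obj ((A.sm r).obj X) ⟶ 𝟙_ B :=
  (F.smul r X).hom ≫ (B.sm r).map a ≫ η (B.sm r)

variable {X Y Z X' Y' : A} (a : F.functor.obj X ⟶ 𝟙_ B) (b : F.functor.obj Y ⟶ 𝟙_ B)
  (c : F.functor.obj Z ⟶ 𝟙_ B)

theorem tensor_addNull (f : X' ⟶ X) (g : Y' ⟶ Y) :
    F.functor.map (f ⊗ₘ g) ≫ addNull F a b =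
      addNull F (F.functor.map f ≫ a) (F.functor.map g ≫ b) := by
  simp only [addNull, ← tensorHom_comp_tensorHom, Category.assoc, δ_natural_assoc]

theorem associator_addNull :
    F.functor.map (α_ X Y Z).hom ≫ addNull F a (addNull F b c) =
      addNull F (addNull F a b) c := by
  have h1 : (a ⊗ₘ (δ F.functor Y Z ≫ (b ⊗ₘ c) ≫ (λ_ (𝟙_ B)).hom)) =
      _ ◁ δ F.functor Y Z ≫ (a ⊗ₘ (b ⊗ₘ c)) ≫ _ ◁ (λ_ (𝟙_ B)).hom := by
    simp [← id_tensorHom]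
  have h2 : ((δ F.functor X Y ≫ (a ⊗ₘ b) ≫ (λ_ (𝟙_ B)).hom) ⊗ₘ c) =
      δ F.functor X Y ▷ _ ≫ ((a ⊗ₘ b) ⊗ₘ c) ≫ (λ_ (𝟙_ B)).hom ▷ _ := by
    rw [← tensorHom_id, ← tensorHom_id, tensorHom_comp_tensorHom, tensorHom_comp_tensorHom,
      Category.id_comp, Category.comp_id]
  have h3 := associator_naturality a b c
  simp only [addNull, h1, h2, Category.assoc]
  rw [← Functor.OplaxMonoidal.associativity_assoc, ← reassoc_of% h3]
  congr 3
  simp [unitors_equal]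

theorem leftUnitor_addNull :
    F.functor.map (λ_ X).hom ≫ a = addNull F (η F.functor) a := by
  rw [addNull, MonoidalCategory.tensorHom_def, ← left_unitality_hom]
  simp

theorem rightUnitor_addNull :
    F.functor.map (ρ_ X).hom ≫ a = addNull F a (η F.functor) := by
  rw [addNull, MonoidalCategory.tensorHom_def', ← right_unitality_hom, unitors_equal]
  simp

theorem braiding_addNull :
    F.functor.map (β_ X Y).hom ≫ addNull F b a = addNull F a b := by
  have h := braiding_naturality a b
  simp only [addNull, Functor.map_braiding, Category.assoc, Functor.Monoidal.μ_δ_assoc,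
    ← reassoc_of% h, braiding_leftUnitor]
  rw [unitors_equal]

theorem smMap_smulNull {r s : R} (f : r ⟶ s) :
    F.functor.map ((A.smMap f).app X) ≫ smulNull F s a = smulNull F r a := by
  have h := isMonoidal_η (B.smMap f)
  simp only [smulNull, reassoc_of% F.smul_naturality_left, ← NatTrans.naturality_assoc, h]

theorem map_smulNull (r : R) (f : X' ⟶ X) :
    F.functor.map ((A.sm r).map f) ≫ smulNull F r a = smulNull F r (F.functor.map f ≫ a) := by
  simp only [smulNull, reassoc_of% F.smul_naturality_right, Functor.map_comp, Category.assoc]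

theorem δ_smulNull (r : R) :
    F.functor.map (δ (A.sm r) X Y) ≫ addNull F (smulNull F r a) (smulNull F r b) =
      smulNull F r (addNull F a b) := by
  simp only [smulNull, addNull, Functor.map_comp, Category.assoc, ← tensorHom_comp_tensorHom,
    reassoc_of% F.smul_add, map_leftUnitor_η, δ_natural_assoc]

theorem η_smulNull (r : R) :
    F.functor.map (η (A.sm r)) ≫ η F.functor = smulNull F r (η F.functor) :=
  F.smul_zero r

theorem dist_smulNull (r s : R) :
    F.functor.map (A.dist r s X).hom ≫ addNull F (smulNull F r a) (smulNull F s a) =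
      smulNull F (r ⊗ s) a := by
  simp only [smulNull, addNull, Category.assoc, ← tensorHom_comp_tensorHom,
    reassoc_of% F.smul_dist, ← reassoc_of% B.dist_naturality_right, B.interchange_zero]

theorem assoc_smulNull (r s : R) :
    F.functor.map (A.assoc r s X).hom ≫ smulNull F r (smulNull F s a) = smulNull F _ a := by
  simp only [smulNull, Functor.map_comp, Category.assoc, reassoc_of% F.smul_assoc,
    ← reassoc_of% B.assoc_naturality_right, B.assoc_zero]

theorem one_smulNull : F.functor.map (A.one X).hom ≫ a = smulNull F TwoRing.one a := by
  rw [smulNull, ← one_zero, one_naturality, F.smul_one, Category.assoc]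

end NullHom

section Ker

variable {A B C : TwoMod.{u} R} {F : Hom A B} {G : Hom B C}

/-- Objects of the relative kernel of `F : A ⟶ B`, `G : B ⟶ C`, `φ : G ∘ F ⟹ 0`: pairs of an
object `X` of `A` and a morphism `a : F X ⟶ 0` such that `G a` agrees with `φ` at `X`. -/
structure Ker (φ : Hom₂ (F.comp G) (Hom.zero A C)) : Type u where
  obj : A
  hom : F.functor.obj obj ⟶ 𝟙_ B
  w : G.functor.map hom ≫ η G.functor = null φ obj

variable {φ : Hom₂ (F.comp G) (Hom.zero A C)}

namespace Ker

/-- Morphisms `(X, a) ⟶ (Y, b)` of the relative kernel: morphisms `f : X ⟶ Y` of `A` such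
that `F f` is compatible with `a` and `b`. -/
@[ext]
structure KHom (X Y : Ker φ) : Type u where
  hom : X.obj ⟶ Y.obj
  w : F.functor.map hom ≫ Y.hom = X.hom

attribute [simp] KHom.w

instance : Category (Ker φ) where
  Hom X Y := KHom X Y
  id X := ⟨𝟙 _, by simp⟩
  comp f g := ⟨f.hom ≫ g.hom, by simp⟩

@[ext] theorem hom_ext {X Y : Ker φ} {f g : X ⟶ Y} (h : KHom.hom f = KHom.hom g) : f = g :=
  KHom.ext h

@[simp] theorem id_hom (X : Ker φ) : KHom.hom (𝟙 X) = 𝟙 X.obj := rfl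
@[simp] theorem comp_hom {X Y Z : Ker φ} (f : X ⟶ Y) (g : Y ⟶ Z) :
    KHom.hom (f ≫ g) = KHom.hom f ≫ KHom.hom g := rfl

/-- Isomorphisms of the relative kernel come from isomorphisms of `A`. -/
@[simps]
def isoMk {X Y : Ker φ} (e : X.obj ≅ Y.obj) (h : F.functor.map e.hom ≫ Y.hom = X.hom) : X ≅ Y where
  hom := ⟨e.hom, h⟩
  inv := ⟨e.inv, by rw [← h]; simp⟩

/-- `(X, a) + (Y, b) = (X + Y, F (X + Y) ≅ F X + F Y ⟶ 0 + 0 ≅ 0)` -/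
def add (X Y : Ker φ) : Ker φ where
  obj := X.obj ⊗ Y.obj
  hom := addNull F X.hom Y.hom
  w := by
    rw [null_tensor, ← X.w, ← Y.w, addNull]
    simp only [Functor.map_comp, Category.assoc, map_leftUnitor_η, ← tensorHom_comp_tensorHom,
      δ_natural_assoc]

/-- the zero object `(0, F 0 ≅ 0)` -/
def unit : Ker φ where
  obj := 𝟙_ A
  hom := η F.functor
  w := by rw [null_unit]

/-- `r · (X, a) = (r · X, F (r · X) ≅ r · F X ⟶ r · 0 ≅ 0)` -/
def smul (r : R) (X : Ker φ) : Ker φ where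
  obj := (A.sm r).obj X.obj
  hom := smulNull F r X.hom
  w := by
    rw [null_smul, ← X.w, smulNull]
    simp only [Functor.map_comp, Category.assoc, G.smul_zero]
    rw [reassoc_of% G.smul_naturality_right]

theorem tensor_w {X X' Y Y' : Ker φ} (f : X ⟶ X') (g : Y ⟶ Y') :
    F.functor.map (KHom.hom f ⊗ₘ KHom.hom g) ≫ addNull F X'.hom Y'.hom =
      addNull F X.hom Y.hom := by
  rw [tensor_addNull, KHom.w, KHom.w]

instance : MonoidalCategory (Ker φ) where
  tensorObj := add
  tensorUnit := unit
  whiskerLeft X Y Y' f := ⟨X.obj ◁ f.hom, by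
    have := tensor_w (𝟙 X) f
    rwa [id_hom, id_tensorHom] at this⟩
  whiskerRight f Y := ⟨f.hom ▷ Y.obj, by
    have := tensor_w f (𝟙 Y)
    rwa [id_hom, tensorHom_id] at this⟩
  tensorHom f g := ⟨f.hom ⊗ₘ g.hom, tensor_w f g⟩
  associator X Y Z := isoMk (α_ X.obj Y.obj Z.obj) (associator_addNull F _ _ _)
  leftUnitor X := isoMk (λ_ X.obj) (leftUnitor_addNull F _)
  rightUnitor X := isoMk (ρ_ X.obj) (rightUnitor_addNull F _)
  tensorHom_def _ _ := hom_ext (MonoidalCategory.tensorHom_def _ _)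
  id_tensorHom_id _ _ := hom_ext (id_tensorHom_id _ _)
  tensorHom_comp_tensorHom _ _ _ _ := hom_ext (tensorHom_comp_tensorHom _ _ _ _)
  whiskerLeft_id _ _ := hom_ext (MonoidalCategory.whiskerLeft_id _ _)
  id_whiskerRight _ _ := hom_ext (id_whiskerRight _ _)
  associator_naturality _ _ _ := hom_ext (associator_naturality _ _ _)
  leftUnitor_naturality _ := hom_ext (leftUnitor_naturality _)
  rightUnitor_naturality _ := hom_ext (rightUnitor_naturality _)
  pentagon _ _ _ _ := hom_ext (MonoidalCategory.pentagon _ _ _ _)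
  triangle _ _ := hom_ext (MonoidalCategory.triangle _ _)

instance : SymmetricCategory (Ker φ) where
  braiding X Y := isoMk (β_ X.obj Y.obj) (braiding_addNull F _ _)
  braiding_naturality_right _ _ _ _ := hom_ext (braiding_naturality_right _ _)
  braiding_naturality_left _ _ := hom_ext (braiding_naturality_left _ _)
  hexagon_forward _ _ _ := hom_ext (hexagon_forward _ _ _)
  hexagon_reverse _ _ _ := hom_ext (hexagon_reverse _ _ _)
  symmetry _ _ := hom_ext (SymmetricCategory.symmetry _ _)

instance : SymTwoGroup (Ker φ) where
  isGroupoid := ⟨fun f =>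
    ⟨⟨⟨inv (KHom.hom f), by rw [Functor.map_inv, IsIso.inv_comp_eq, KHom.w]⟩,
      hom_ext (IsIso.hom_inv_id _), hom_ext (IsIso.inv_hom_id _)⟩⟩⟩
  exists_neg X := by
    obtain ⟨Y, ⟨e⟩⟩ := SymTwoGroup.exists_neg X.obj
    let b : F.functor.obj Y ⟶ 𝟙_ B :=
      (ρ_ _).inv ≫ _ ◁ inv X.hom ≫ μ F.functor _ _ ≫ F.functor.map e.hom ≫ η F.functor
    have hb : F.functor.map e.hom ≫ η F.functor = addNull F b X.hom := by
      simp only [addNull, b, MonoidalCategory.tensorHom_def', MonoidalCategory.whiskerRight_id]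
      simp only [Category.assoc, Iso.hom_inv_id_assoc, unitors_equal,
        Iso.inv_hom_id, Category.comp_id]
      simp
    have hw : G.functor.map b ≫ η G.functor = null φ Y := by
      have h1 : null φ (Y ⊗ X.obj) = G.functor.map (addNull F b X.hom) ≫ η G.functor := by
        rw [← hb, ← null_naturality φ e.hom, null_unit, Functor.map_comp, Category.assoc]
      rw [null_tensor, addNull, ← X.w] at h1
      simp only [Functor.map_comp, Category.assoc, map_leftUnitor_η, ← δ_natural_assoc,
        cancel_epi] at h1
      rwa [tensorHom_comp_tensorHom_assoc, cancel_mono, MonoidalCategory.tensorHom_def',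
        MonoidalCategory.tensorHom_def', cancel_epi, whiskerRight_iff, eq_comm] at h1
    exact ⟨⟨Y, b, hw⟩, ⟨isoMk (X := add ⟨Y, b, hw⟩ X) (Y := unit) e hb⟩⟩

/-- The functor `r · -` on the relative kernel. -/
def smFunctor (r : R) : Ker φ ⥤ Ker φ where
  obj := smul r
  map {X Y} f := ⟨(A.sm r).map f.hom, by
    have h := map_smulNull F Y.hom r (KHom.hom f)
    rw [KHom.w] at h
    exact h⟩
  map_id _ := hom_ext ((A.sm r).map_id _)
  map_comp _ _ := hom_ext ((A.sm r).map_comp _ _)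

/-- `r · 0 ≅ 0` in the relative kernel. -/
def smZero (r : R) : (smFunctor r).obj (𝟙_ (Ker φ)) ≅ 𝟙_ (Ker φ) :=
  isoMk (X := smul r unit) (Y := unit) (Functor.Monoidal.εIso (A.sm r)).symm (η_smulNull F r)

/-- `r · (X + Y) ≅ r · X + r · Y` in the relative kernel. -/
def smAdd (r : R) (X Y : Ker φ) :
    (smFunctor r).obj (X ⊗ Y) ≅ (smFunctor r).obj X ⊗ (smFunctor r).obj Y :=
  isoMk (X := smul r (add X Y)) (Y := add (smul r X) (smul r Y))
    (Functor.Monoidal.μIso (A.sm r) X.obj Y.obj).symm (δ_smulNull F _ _ r)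

instance (r : R) : (smFunctor (φ := φ) r).Braided where
  ε := (smZero r).inv
  η := (smZero r).hom
  μ X Y := (smAdd r X Y).inv
  δ X Y := (smAdd r X Y).hom
  μ_natural_left _ _ := hom_ext (μ_natural_left (A.sm r) _ _)
  μ_natural_right _ _ := hom_ext (μ_natural_right (A.sm r) _ _)
  associativity _ _ _ := hom_ext (Functor.LaxMonoidal.associativity (A.sm r) _ _ _)
  left_unitality _ := hom_ext (Functor.LaxMonoidal.left_unitality (A.sm r) _)
  right_unitality _ := hom_ext (Functor.LaxMonoidal.right_unitality (A.sm r) _)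
  δ_natural_left _ _ := hom_ext (δ_natural_left (A.sm r) _ _)
  δ_natural_right _ _ := hom_ext (δ_natural_right (A.sm r) _ _)
  oplax_associativity _ _ _ := hom_ext (Functor.OplaxMonoidal.associativity (A.sm r) _ _ _)
  oplax_left_unitality _ := hom_ext (Functor.OplaxMonoidal.left_unitality (A.sm r) _)
  oplax_right_unitality _ := hom_ext (Functor.OplaxMonoidal.right_unitality (A.sm r) _)
  ε_η := (smZero r).inv_hom_id
  η_ε := (smZero r).hom_inv_id
  μ_δ X Y := (smAdd r X Y).inv_hom_id
  δ_μ X Y := (smAdd r X Y).hom_inv_id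
  braided _ _ := hom_ext (Functor.LaxBraided.braided (F := A.sm r) _ _)

/-- The action of `R` on the relative kernel, as a bifunctor. -/
def actFunctor : R ⥤ Ker φ ⥤ Ker φ where
  obj := smFunctor
  map {r s} f :=
    { app X := (⟨(A.smMap f).app X.obj, smMap_smulNull F _ f⟩ : KHom (smul r X) (smul s X))
      naturality _ _ _ := hom_ext ((A.smMap f).naturality _) }
  map_id r := NatTrans.ext (funext fun X => KHom.ext (congrArg (fun t => NatTrans.app t X.obj)
    ((TwoModule.act (M := A)).functor.map_id r)))
  map_comp f g := NatTrans.ext (funext fun X => KHom.ext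
    (congrArg (fun t => NatTrans.app t X.obj) ((TwoModule.act (M := A)).functor.map_comp f g)))

instance (r : R) : ((actFunctor (φ := φ)).obj r).Braided :=
  inferInstanceAs (smFunctor (φ := φ) r).Braided

/-- The action of `R` on the relative kernel. -/
def act : Biadditive R (Ker φ) (Ker φ) where
  functor := actFunctor
  braided _ := inferInstance
  isMonoidal f :=
    { unit := hom_ext (NatTrans.IsMonoidal.unit (τ := A.smMap f))
      tensor _ _ := hom_ext (NatTrans.IsMonoidal.tensor (τ := A.smMap f) _ _) }
  dist r s X := isoMk (X := smul (r ⊗ s) X) (Y := add (smul r X) (smul s X)) (A.dist r s X.obj) (dist_smulNull F _ r s)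
  dist_naturality _ _ _ := hom_ext (A.dist_naturality _ _ _)
  dist_naturality_right _ _ _ _ _ := hom_ext (A.dist_naturality_right _ _ _)
  dist_assoc _ _ _ _ := hom_ext (A.dist_assoc _ _ _ _)
  dist_braiding _ _ _ := hom_ext (A.dist_braiding _ _ _)
  interchange _ _ _ _ := hom_ext (A.interchange _ _ _ _)
  interchange_zero _ _ := hom_ext (A.interchange_zero _ _)

instance : TwoModule R (Ker φ) where
  act := act
  actAssoc r s X := isoMk (X := smul _ X) (Y := smul r (smul s X)) (A.assoc r s X.obj) (assoc_smulNull F _ r s)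
  oneAct X := isoMk (X := smul _ X) (Y := X) (A.one X.obj) (one_smulNull F _)
  actAssoc_naturality_left _ _ _ := hom_ext (A.assoc_naturality_left _ _ _)
  actAssoc_naturality_middle _ _ _ _ _ := hom_ext (A.assoc_naturality_middle _ _ _)
  actAssoc_naturality_right _ _ _ _ _ := hom_ext (A.assoc_naturality_right _ _ _)
  oneAct_naturality _ := hom_ext (A.one_naturality _)
  pentagon _ _ _ _ := hom_ext (A.pentagon _ _ _ _)
  triangle _ _ := hom_ext (A.triangle _ _)
  actAssoc_add_left _ _ _ _ := hom_ext (A.assoc_add_left _ _ _ _)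
  actAssoc_add_middle _ _ _ _ := hom_ext (A.assoc_add_middle _ _ _ _)
  actAssoc_add_right _ _ _ _ := hom_ext (A.assoc_add_right _ _ _ _)
  actAssoc_zero _ _ := hom_ext (A.assoc_zero _ _)
  oneAct_add _ _ := hom_ext (A.one_add _ _)
  oneAct_zero := hom_ext A.one_zero

end Ker

/-- The relative kernel as an `R`-2-module. -/
def ker (φ : Hom₂ (F.comp G) (Hom.zero A C)) : TwoMod.{u} R where
  carrier := Ker φ

end Ker

section Coker

variable {A B C : TwoMod.{u} R} {F : Hom A B} {G : Hom B C}

/-- Objects of the relative cokernel of `F : A ⟶ B`, `G : B ⟶ C`, `φ : G ∘ F ⟹ 0`: those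
of `C`. -/
structure Coker (φ : Hom₂ (F.comp G) (Hom.zero A C)) : Type u where
  obj : C

namespace Coker

variable (φ : Hom₂ (F.comp G) (Hom.zero A C))

/-- For `a : b ⟶ F x + b'`, the morphism `G b ⟶ G (F x + b') ≅ G (F x) + G b' ⟶ 0 + G b' ≅ G b'`
given by `φ`. -/
def cmap {b b' : B} {x : A} (a : b ⟶ F.functor.obj x ⊗ b') :
    G.functor.obj b ⟶ G.functor.obj b' :=
  G.functor.map a ≫ δ G.functor _ _ ≫ null φ x ▷ _ ≫ (λ_ _).hom

/-- Representatives of morphisms `X ⟶ Y` of the relative cokernel: pairs of an object `b` of `B`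
and a morphism `X ⟶ G b + Y` of `C`. -/
structure PreHom (G : Hom B C) (X Y : C) : Type u where
  obj : B
  hom : X ⟶ G.functor.obj obj ⊗ Y

/-- Two representatives `(b, f)` and `(b', f')` are equivalent if there are an object `x` of `A` and
a morphism `a : b ⟶ F x + b'` such that `f` followed by `G b + Y ⟶ G b' + Y` is `f'`. -/
def Rel (X Y : C) (p q : PreHom G X Y) : Prop :=
  ∃ (x : A) (a : p.obj ⟶ F.functor.obj x ⊗ q.obj), p.hom ≫ cmap φ a ▷ Y = q.hom

variable {φ}

/-- Morphisms of the relative cokernel: equivalence classes of representatives. -/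
def CHom (X Y : Coker φ) : Type u := Quot (Rel φ X.obj Y.obj)

/-- The class of `(b, f)`. -/
def cls (φ : Hom₂ (F.comp G) (Hom.zero A C)) {X Y : C} (b : B) (f : X ⟶ G.functor.obj b ⊗ Y) :
    CHom (φ := φ) ⟨X⟩ ⟨Y⟩ :=
  Quot.mk _ ⟨b, f⟩

theorem cls_sound {X Y : C} {b b' : B} {x : A} (a : b ⟶ F.functor.obj x ⊗ b')
    (f : X ⟶ G.functor.obj b ⊗ Y) :
    cls φ b f = cls φ b' (f ≫ cmap φ a ▷ Y) :=
  Quot.sound ⟨x, a, rfl⟩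

theorem cmap_of_hom {b b' : B} (u : b ⟶ b') :
    cmap φ (u ≫ (λ_ _).inv ≫ ε F.functor ▷ b') = G.functor.map u := by
  simp only [cmap, null_unit, Functor.map_comp, Category.assoc, comp_whiskerRight]
  rw [← δ_natural_left_assoc, ← comp_whiskerRight_assoc, ← Functor.map_comp,
    Functor.Monoidal.ε_η, CategoryTheory.Functor.map_id, id_whiskerRight, Category.id_comp, left_unitality_hom,
    ← Functor.map_comp, Iso.inv_hom_id, CategoryTheory.Functor.map_id, Category.comp_id]

/-- Isomorphic representatives have the same class. -/
theorem cls_map {X Y : C} {b b' : B} (u : b ⟶ b') (f : X ⟶ G.functor.obj b ⊗ Y) :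
    cls φ b f = cls φ b' (f ≫ G.functor.map u ▷ Y) := by
  rw [← cmap_of_hom (φ := φ) u]
  exact cls_sound _ f

theorem μ_cmap_right {b b' : B} {x : A} (a : b ⟶ F.functor.obj x ⊗ b') (c : B) :
    μ G.functor b c ≫ cmap φ (a ▷ c ≫ (α_ _ _ _).hom) =
      cmap φ a ▷ _ ≫ μ G.functor b' c := by
  simp only [cmap, Functor.map_comp, Category.assoc, comp_whiskerRight, ← μ_natural_left_assoc]
  have h : μ G.functor (F.functor.obj x ⊗ b') c ≫
      G.functor.map (α_ (F.functor.obj x) b' c).hom ≫ δ G.functor _ _ =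
        δ G.functor _ _ ▷ _ ≫ (α_ _ _ _).hom ≫ _ ◁ μ G.functor _ _ := by
    rw [Functor.Monoidal.map_associator' G.functor]
    simp only [Category.assoc, ← MonoidalCategory.whiskerLeft_comp, Functor.Monoidal.δ_μ,
      MonoidalCategory.whiskerLeft_id, Category.comp_id, Functor.Monoidal.whiskerRight_δ_μ_assoc]
  rw [reassoc_of% h, whisker_exchange_assoc, leftUnitor_naturality,
    leftUnitor_tensor_hom, ← associator_naturality_left_assoc]
  simp only [Category.assoc, Iso.hom_inv_id_assoc]

theorem μ_cmap_left (c : B) {b b' : B} {x : A} (a : b ⟶ F.functor.obj x ⊗ b') :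
    μ G.functor c b ≫ cmap φ (c ◁ a ≫ (α_ _ _ _).inv ≫ (β_ _ _).hom ▷ _ ≫ (α_ _ _ _).hom) =
      _ ◁ cmap φ a ≫ μ G.functor c b' := by
  have h : c ◁ a ≫ (α_ c (F.functor.obj x) b').inv ≫ (β_ _ _).hom ▷ b' ≫ (α_ _ _ _).hom =
      (β_ c b).hom ≫ (a ▷ c ≫ (α_ _ _ _).hom) ≫ _ ◁ (β_ _ _).hom := by
    rw [Category.assoc, ← braiding_naturality_right_assoc, braiding_tensor_right_hom]
    simp only [Category.assoc, Iso.inv_hom_id_assoc, ← MonoidalCategory.whiskerLeft_comp,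
      SymmetricCategory.symmetry, MonoidalCategory.whiskerLeft_id, Category.comp_id]
  have h' : ∀ {b₁ b₂ b₃ : B} (u : b₁ ⟶ b₂) (a : b₂ ⟶ F.functor.obj x ⊗ b₃),
      cmap φ (u ≫ a) = G.functor.map u ≫ cmap φ a := fun u a => by simp [cmap]
  have h'' : ∀ {b₁ b₂ b₃ : B} (u : b₂ ⟶ b₃) (a : b₁ ⟶ F.functor.obj x ⊗ b₂),
      cmap φ (a ≫ _ ◁ u) = cmap φ a ≫ G.functor.map u := fun u a => by
    simp only [cmap, Functor.map_comp, Category.assoc, ← δ_natural_right_assoc]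
    simp [whisker_exchange_assoc]
  rw [h, h', h'', Functor.map_braiding]
  simp only [Category.assoc, Functor.Monoidal.μ_δ_assoc, reassoc_of% μ_cmap_right]
  simp

/-- `(b', g) ∘ (b, f) = (b + b', X ⟶ G b + Y ⟶ G b + (G b' + Z) ≅ G (b + b') + Z)` -/
def comp {X Y Z : Coker φ} : CHom X Y → CHom Y Z → CHom X Z :=
  Quot.map₂ (fun p q => ⟨p.obj ⊗ q.obj,
      p.hom ≫ _ ◁ q.hom ≫ (α_ _ _ _).inv ≫ μ G.functor _ _ ▷ _⟩)
    (by
      rintro ⟨b, f⟩ ⟨c, g⟩ ⟨c', g'⟩ ⟨x, a, h⟩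
      refine ⟨x, _ ◁ a ≫ (α_ _ _ _).inv ≫ (β_ _ _).hom ▷ _ ≫ (α_ _ _ _).hom, ?_⟩
      dsimp only at *
      rw [← h]
      simp only [Category.assoc, ← comp_whiskerRight, μ_cmap_left]
      simp)
    (by
      rintro ⟨b, f⟩ ⟨b', f'⟩ ⟨c, g⟩ ⟨x, a, h⟩
      refine ⟨x, a ▷ _ ≫ (α_ _ _ _).hom, ?_⟩
      dsimp only at *
      rw [← h]
      simp only [Category.assoc, ← comp_whiskerRight, μ_cmap_right]
      simp [← whisker_exchange_assoc])

/-- The morphism of the relative cokernel given by a morphism of `C`. -/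
def pm (φ : Hom₂ (F.comp G) (Hom.zero A C)) {X Y : C} (f : X ⟶ Y) : CHom (φ := φ) ⟨X⟩ ⟨Y⟩ :=
  cls φ (𝟙_ B) (f ≫ (λ_ Y).inv ≫ ε G.functor ▷ Y)

instance : Category (Coker φ) where
  Hom X Y := CHom X Y
  id X := pm φ (𝟙 X.obj)
  comp := comp
  id_comp := by
    rintro ⟨X⟩ ⟨Y⟩ ⟨b, f⟩
    refine (cls_map (λ_ b).hom _).trans (congrArg (cls φ b) ?_)
    have h := Functor.LaxMonoidal.left_unitality G.functor b
    simp only [Category.assoc, ← comp_whiskerRight, Category.id_comp]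
    rw [← whisker_exchange_assoc, associator_inv_naturality_left_assoc, ← comp_whiskerRight, ← h]
    monoidal
  comp_id := by
    rintro ⟨X⟩ ⟨Y⟩ ⟨b, f⟩
    refine (cls_map (ρ_ b).hom _).trans (congrArg (cls φ b) ?_)
    have h := Functor.LaxMonoidal.right_unitality G.functor b
    simp only [Category.assoc, Category.id_comp,
      MonoidalCategory.whiskerLeft_comp, associator_inv_naturality_middle_assoc]
    rw [← comp_whiskerRight, ← comp_whiskerRight, ← h]
    monoidal
  assoc := by
    rintro ⟨X⟩ ⟨Y⟩ ⟨Z⟩ ⟨W⟩ ⟨b, f⟩ ⟨c, g⟩ ⟨d, h⟩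
    refine (cls_map (α_ b c d).hom _).trans (congrArg (cls φ _) ?_)
    have e := Functor.LaxMonoidal.associativity G.functor b c d
    simp only [Category.assoc, ← comp_whiskerRight, MonoidalCategory.whiskerLeft_comp]
    rw [← whisker_exchange_assoc, associator_inv_naturality_left_assoc, ← comp_whiskerRight, e]
    monoidal

/-- `ev b Y : G b + Y ⟶ Y` in the relative cokernel, the class of `(b, 𝟙)`. -/
def ev (φ : Hom₂ (F.comp G) (Hom.zero A C)) (b : B) (Y : C) :
    (⟨G.functor.obj b ⊗ Y⟩ : Coker φ) ⟶ ⟨Y⟩ :=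
  cls φ b (𝟙 _)

theorem cls_comp_cls {X Y Z : C} {b c : B} (f : X ⟶ G.functor.obj b ⊗ Y)
    (g : Y ⟶ G.functor.obj c ⊗ Z) :
    (show (⟨X⟩ : Coker φ) ⟶ ⟨Y⟩ from cls φ b f) ≫ (show (⟨Y⟩ : Coker φ) ⟶ ⟨Z⟩ from cls φ c g) =
      cls φ (b ⊗ c) (f ≫ _ ◁ g ≫ (α_ _ _ _).inv ≫ μ G.functor _ _ ▷ _) := rfl

theorem pm_comp_cls {X Y Z : C} {c : B} (f : X ⟶ Y) (g : Y ⟶ G.functor.obj c ⊗ Z) :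
    (show (⟨X⟩ : Coker φ) ⟶ ⟨Y⟩ from pm φ f) ≫ (show (⟨Y⟩ : Coker φ) ⟶ ⟨Z⟩ from cls φ c g) =
      cls φ c (f ≫ g) := by
  refine (cls_map (λ_ c).hom _).trans (congrArg (cls φ c) ?_)
  have h := Functor.LaxMonoidal.left_unitality G.functor c
  simp only [Category.assoc, ← comp_whiskerRight]
  rw [← whisker_exchange_assoc, associator_inv_naturality_left_assoc, ← comp_whiskerRight, ← h]
  monoidal

theorem cls_comp_pm {X Y Z : C} {b : B} (f : X ⟶ G.functor.obj b ⊗ Y) (g : Y ⟶ Z) :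
    (show (⟨X⟩ : Coker φ) ⟶ ⟨Y⟩ from cls φ b f) ≫ (show (⟨Y⟩ : Coker φ) ⟶ ⟨Z⟩ from pm φ g) =
      cls φ b (f ≫ _ ◁ g) := by
  refine (cls_map (ρ_ b).hom _).trans (congrArg (cls φ b) ?_)
  have h := Functor.LaxMonoidal.right_unitality G.functor b
  simp only [Category.assoc, MonoidalCategory.whiskerLeft_comp,
    associator_inv_naturality_middle_assoc]
  rw [← comp_whiskerRight, ← comp_whiskerRight, ← h]
  monoidal

/-- `pm` as a morphism of the relative cokernel. -/
def p (φ : Hom₂ (F.comp G) (Hom.zero A C)) {X Y : C} (f : X ⟶ Y) : (⟨X⟩ : Coker φ) ⟶ ⟨Y⟩ :=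
  pm φ f

@[simp] theorem p_id (X : C) : p φ (𝟙 X) = 𝟙 (⟨X⟩ : Coker φ) := rfl

theorem p_comp {X Y Z : C} (f : X ⟶ Y) (g : Y ⟶ Z) : p φ (f ≫ g) = p φ f ≫ p φ g := by
  refine Eq.trans ?_ (pm_comp_cls f _).symm
  simp [p, pm]

theorem p_comp_assoc {X Y Z : C} (f : X ⟶ Y) (g : Y ⟶ Z) {W : Coker φ}
    (h : (⟨Z⟩ : Coker φ) ⟶ W) : p φ (f ≫ g) ≫ h = p φ f ≫ p φ g ≫ h := by
  rw [p_comp, Category.assoc]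

theorem cls_eq {X Y : C} {b : B} (f : X ⟶ G.functor.obj b ⊗ Y) :
    cls φ b f = p φ f ≫ ev φ b Y := by
  refine Eq.trans ?_ (pm_comp_cls f _).symm
  simp

theorem exists_rep {X Y : C} (f : (⟨X⟩ : Coker φ) ⟶ ⟨Y⟩) :
    ∃ (b : B) (f₀ : X ⟶ G.functor.obj b ⊗ Y), f = p φ f₀ ≫ ev φ b Y := by
  obtain ⟨b, f₀⟩ := f
  exact ⟨b, f₀, cls_eq f₀⟩

theorem p_map_ev {b b' : B} (u : b ⟶ b') (Y : C) :
    p φ (G.functor.map u ▷ Y) ≫ ev φ b' Y = ev φ b Y := by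
  rw [← cls_eq, ev, cls_map u]
  simp

theorem p_cmap_ev {b b' : B} {x : A} (a : b ⟶ F.functor.obj x ⊗ b') (Y : C) :
    p φ (cmap φ a ▷ Y) ≫ ev φ b' Y = ev φ b Y := by
  rw [← cls_eq, ev, cls_sound a]
  simp

theorem ev_p (b : B) {Y Z : C} (g : Y ⟶ Z) :
    ev φ b Y ≫ p φ g = p φ (_ ◁ g) ≫ ev φ b Z := by
  rw [← cls_eq]
  refine (cls_comp_pm _ _).trans ?_
  simp

theorem ev_ev (b c : B) (Y : C) :
    ev φ b _ ≫ ev φ c Y = p φ ((α_ _ _ _).inv ≫ μ G.functor b c ▷ Y) ≫ ev φ (b ⊗ c) Y := by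
  rw [← cls_eq]
  refine (cls_comp_cls _ _).trans ?_
  simp

/-- Adding `Z` on the right respects the relation generating equality of morphisms. -/
theorem wr_aux {X Y : C} (Z : C) (q q' : PreHom G X Y) (h : Rel φ X Y q q') :
    Rel φ (X ⊗ Z) (Y ⊗ Z) ⟨q.obj, q.hom ▷ Z ≫ (α_ _ _ _).hom⟩
      ⟨q'.obj, q'.hom ▷ Z ≫ (α_ _ _ _).hom⟩ := by
  obtain ⟨x, a, h⟩ := h
  exact ⟨x, a, by simp [← h]⟩

/-- `f + Z` for a morphism `f` of the relative cokernel. -/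
def wr {X Y : C} (f : (⟨X⟩ : Coker φ) ⟶ ⟨Y⟩) (Z : C) : (⟨X ⊗ Z⟩ : Coker φ) ⟶ ⟨Y ⊗ Z⟩ :=
  Quot.map (fun q => ⟨q.obj, q.hom ▷ Z ≫ (α_ _ _ _).hom⟩) (wr_aux Z) f

theorem wr_p {X Y : C} (f : X ⟶ Y) (Z : C) : wr (p φ f) Z = p φ (f ▷ Z) := by
  refine congrArg (cls φ _) ?_
  simp

theorem wr_ev (b : B) (Y Z : C) : wr (ev φ b Y) Z = p φ (α_ _ _ _).hom ≫ ev φ b (Y ⊗ Z) := by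
  rw [← cls_eq]
  refine congrArg (cls φ _) ?_
  simp

theorem wr_id (X Z : C) : wr (𝟙 (⟨X⟩ : Coker φ)) Z = 𝟙 _ := by
  rw [← p_id, wr_p]; simp

theorem wr_comp {X Y Z : C} (f : (⟨X⟩ : Coker φ) ⟶ ⟨Y⟩) (g : (⟨Y⟩ : Coker φ) ⟶ ⟨Z⟩) (W : C) :
    wr (f ≫ g) W = wr f W ≫ wr g W := by
  obtain ⟨b, f⟩ := f
  obtain ⟨c, g⟩ := g
  refine congrArg (cls φ _) ?_
  dsimp only
  monoidal

/-- `Z + f` for a morphism `f` of the relative cokernel. -/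
def wl (Z : C) {X Y : C} (f : (⟨X⟩ : Coker φ) ⟶ ⟨Y⟩) : (⟨Z ⊗ X⟩ : Coker φ) ⟶ ⟨Z ⊗ Y⟩ :=
  p φ (β_ Z X).hom ≫ wr f Z ≫ p φ (β_ Y Z).hom

/-- The isomorphism `Z + (X + Y) ≅ X + (Z + Y)`. -/
def exch (Z X Y : C) : Z ⊗ (X ⊗ Y) ⟶ X ⊗ (Z ⊗ Y) :=
  (α_ _ _ _).inv ≫ (β_ Z X).hom ▷ Y ≫ (α_ _ _ _).hom

theorem wl_p (Z : C) {X Y : C} (f : X ⟶ Y) : wl Z (p φ f) = p φ (Z ◁ f) := by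
  simp [wl, wr_p, ← p_comp]

theorem wl_ev (Z : C) (b : B) (Y : C) :
    wl Z (ev φ b Y) = p φ (exch _ _ _) ≫ ev φ b (Z ⊗ Y) := by
  rw [wl, wr_ev, Category.assoc, ev_p, ← p_comp_assoc, ← p_comp_assoc]
  congr 2
  simp [exch, braiding_tensor_right_hom, ← MonoidalCategory.whiskerLeft_comp]

theorem wl_id (Z X : C) : wl Z (𝟙 (⟨X⟩ : Coker φ)) = 𝟙 _ := by
  rw [← p_id, wl_p]; simp

theorem wl_comp (W : C) {X Y Z : C} (f : (⟨X⟩ : Coker φ) ⟶ ⟨Y⟩) (g : (⟨Y⟩ : Coker φ) ⟶ ⟨Z⟩) :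
    wl W (f ≫ g) = wl W f ≫ wl W g := by
  simp only [wl, wr_comp, Category.assoc, ← p_comp_assoc, SymmetricCategory.symmetry, p_id,
    Category.id_comp]

theorem exchange_ev_ev (b c : B) (Y W : C) :
    wl _ (ev φ c W) ≫ wr (ev φ b Y) W = wr (ev φ b Y) _ ≫ wl Y (ev φ c W) := by
  have h : exch (G.functor.obj b ⊗ Y) (G.functor.obj c) W ≫ _ ◁ (α_ _ _ _).hom ≫ (α_ _ _ _).inv =
      (α_ _ _ _).hom ≫ _ ◁ exch _ _ _ ≫ (α_ _ _ _).inv ≫ (β_ _ _).hom ▷ _ := by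
    simp only [exch, braiding_tensor_left_hom]
    monoidal
  rw [wl_ev, wr_ev, wr_ev, wl_ev, Category.assoc, Category.assoc, reassoc_of% ev_p, reassoc_of% ev_p, ev_ev, ev_ev,
    ← p_map_ev (φ := φ) (β_ b c).hom]
  simp only [← p_comp_assoc]
  congr 2
  have h' := Functor.LaxBraided.braided (F := G.functor) b c
  simp only [Category.assoc, ← comp_whiskerRight, h']
  rw [comp_whiskerRight, reassoc_of% h]

/-- The interchange law for the sum of morphisms of the relative cokernel. -/
theorem exchange {X Y Z W : C} (f : (⟨X⟩ : Coker φ) ⟶ ⟨Y⟩) (g : (⟨Z⟩ : Coker φ) ⟶ ⟨W⟩) :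
    wl X g ≫ wr f W = wr f Z ≫ wl Y g := by
  obtain ⟨b, f, rfl⟩ := exists_rep f
  obtain ⟨c, g, rfl⟩ := exists_rep g
  have h1 : ∀ {X Y : C} (f : X ⟶ Y) {Z W : C} (g : Z ⟶ W),
      wl X (p φ g) ≫ wr (p φ f) W = wr (p φ f) Z ≫ wl Y (p φ g) := fun f _ _ g => by
    simp only [wl_p, wr_p, ← p_comp, whisker_exchange]
  have h2 : ∀ {X Y : C} (f : X ⟶ Y) (c : B) (W : C),
      wl X (ev φ c W) ≫ wr (p φ f) W = wr (p φ f) _ ≫ wl Y (ev φ c W) := fun f c W => by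
    simp only [wl_ev, wr_p, Category.assoc, ev_p, ← p_comp_assoc]
    congr 2
    have h := comp_whiskerRight_assoc (f ▷ G.functor.obj c) (β_ _ _).hom W (α_ _ _ _).hom
    rw [braiding_naturality_left] at h
    simp only [exch, Category.assoc]
    rw [associator_inv_naturality_left_assoc, ← h]
    simp
  have h3 : ∀ (b : B) (Y : C) {Z W : C} (g : Z ⟶ W),
      wl _ (p φ g) ≫ wr (ev φ b Y) W = wr (ev φ b Y) _ ≫ wl Y (p φ g) := fun b Y _ _ g => by
    simp only [wr_ev, wl_p, Category.assoc, ev_p, ← p_comp_assoc]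
    congr 2
    simp
  simp only [wl_comp, wr_comp, Category.assoc]
  rw [reassoc_of% h2, exchange_ev_ev, reassoc_of% h1, reassoc_of% h3]

theorem associator_left {X X' : C} (f : (⟨X⟩ : Coker φ) ⟶ ⟨X'⟩) (Y Z : C) :
    wr (wr f Y) Z ≫ p φ (α_ _ _ _).hom = p φ (α_ _ _ _).hom ≫ wr f (Y ⊗ Z) := by
  obtain ⟨b, f, rfl⟩ := exists_rep f
  simp only [wr_comp, wr_p, wr_ev, Category.assoc, ev_p, ← p_comp_assoc]
  congr 2
  monoidal

theorem associator_middle (X : C) {Y Y' : C} (f : (⟨Y⟩ : Coker φ) ⟶ ⟨Y'⟩) (Z : C) :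
    wr (wl X f) Z ≫ p φ (α_ _ _ _).hom = p φ (α_ _ _ _).hom ≫ wl X (wr f Z) := by
  obtain ⟨b, f, rfl⟩ := exists_rep f
  simp only [wr_comp, wl_comp, wr_p, wl_p, wr_ev, wl_ev, Category.assoc, ev_p, ← p_comp_assoc]
  congr 2
  simp only [exch]
  monoidal

theorem associator_right (X Y : C) {Z Z' : C} (f : (⟨Z⟩ : Coker φ) ⟶ ⟨Z'⟩) :
    wl (X ⊗ Y) f ≫ p φ (α_ _ _ _).hom = p φ (α_ _ _ _).hom ≫ wl X (wl Y f) := by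
  obtain ⟨b, f, rfl⟩ := exists_rep f
  simp only [wl_comp, wl_p, wl_ev, Category.assoc, ev_p, ← p_comp_assoc]
  congr 2
  simp only [exch, braiding_tensor_left_hom]
  monoidal

theorem unitor_left {X Y : C} (f : (⟨X⟩ : Coker φ) ⟶ ⟨Y⟩) :
    wl (𝟙_ C) f ≫ p φ (λ_ _).hom = p φ (λ_ _).hom ≫ f := by
  obtain ⟨b, f, rfl⟩ := exists_rep f
  simp only [wl_comp, wl_p, wl_ev, Category.assoc, ev_p, ← p_comp_assoc]
  congr 2
  simp only [exch, braiding_tensorUnit_left]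
  monoidal

theorem unitor_right {X Y : C} (f : (⟨X⟩ : Coker φ) ⟶ ⟨Y⟩) :
    wr f (𝟙_ C) ≫ p φ (ρ_ _).hom = p φ (ρ_ _).hom ≫ f := by
  obtain ⟨b, f, rfl⟩ := exists_rep f
  simp only [wr_comp, wr_p, wr_ev, Category.assoc, ev_p, ← p_comp_assoc]
  congr 2
  monoidal

theorem braiding_wr {X X' : C} (f : (⟨X⟩ : Coker φ) ⟶ ⟨X'⟩) (Y : C) :
    wr f Y ≫ p φ (β_ _ _).hom = p φ (β_ _ _).hom ≫ wl Y f := by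
  rw [wl, ← p_comp_assoc, SymmetricCategory.symmetry, p_id, Category.id_comp]

theorem braiding_wl (X : C) {Y Y' : C} (f : (⟨Y⟩ : Coker φ) ⟶ ⟨Y'⟩) :
    wl X f ≫ p φ (β_ _ _).hom = p φ (β_ _ _).hom ≫ wr f X := by
  rw [wl, Category.assoc, Category.assoc, ← p_comp, SymmetricCategory.symmetry, p_id,
    Category.comp_id]

/-- The isomorphism of the relative cokernel given by an isomorphism of `C`. -/
def pIso (φ : Hom₂ (F.comp G) (Hom.zero A C)) {X Y : C} (e : X ≅ Y) :
    (⟨X⟩ : Coker φ) ≅ ⟨Y⟩ where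
  hom := p φ e.hom
  inv := p φ e.inv
  hom_inv_id := by rw [← p_comp, e.hom_inv_id, p_id]
  inv_hom_id := by rw [← p_comp, e.inv_hom_id, p_id]

/-- `f + g`, as a composite of `f + Y` and `X' + g`. -/
def ten {X Y X' Y' : C} (f : (⟨X⟩ : Coker φ) ⟶ ⟨X'⟩) (g : (⟨Y⟩ : Coker φ) ⟶ ⟨Y'⟩) :
    (⟨X ⊗ Y⟩ : Coker φ) ⟶ ⟨X' ⊗ Y'⟩ :=
  wr f Y ≫ wl X' g

theorem ten_id (X Y : C) : ten (𝟙 (⟨X⟩ : Coker φ)) (𝟙 (⟨Y⟩ : Coker φ)) = 𝟙 _ := by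
  rw [ten, wr_id, wl_id, Category.comp_id]

theorem ten_comp {X₁ X₂ X₃ Y₁ Y₂ Y₃ : C} (f : (⟨X₁⟩ : Coker φ) ⟶ ⟨X₂⟩) (g : (⟨Y₁⟩ : Coker φ) ⟶ ⟨Y₂⟩)
    (f' : (⟨X₂⟩ : Coker φ) ⟶ ⟨X₃⟩) (g' : (⟨Y₂⟩ : Coker φ) ⟶ ⟨Y₃⟩) :
    ten f g ≫ ten f' g' = ten (f ≫ f') (g ≫ g') := by
  simp only [ten, wr_comp, wl_comp, Category.assoc]
  rw [reassoc_of% (exchange f' g)]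

theorem ten_associator {X₁ X₂ Y₁ Y₂ Z₁ Z₂ : C} (f : (⟨X₁⟩ : Coker φ) ⟶ ⟨X₂⟩)
    (g : (⟨Y₁⟩ : Coker φ) ⟶ ⟨Y₂⟩) (h : (⟨Z₁⟩ : Coker φ) ⟶ ⟨Z₂⟩) :
    ten (ten f g) h ≫ p φ (α_ _ _ _).hom = p φ (α_ _ _ _).hom ≫ ten f (ten g h) := by
  simp only [ten, wr_comp, wl_comp, Category.assoc]
  rw [associator_right, ← reassoc_of% (associator_left f), ← reassoc_of% associator_middle]

theorem ten_braiding {X₁ X₂ Y₁ Y₂ : C} (f : (⟨X₁⟩ : Coker φ) ⟶ ⟨X₂⟩)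
    (g : (⟨Y₁⟩ : Coker φ) ⟶ ⟨Y₂⟩) :
    ten f g ≫ p φ (β_ _ _).hom = p φ (β_ _ _).hom ≫ ten g f := by
  rw [ten, ten, Category.assoc, braiding_wl, reassoc_of% (braiding_wr f), exchange]

theorem ten_p {X Y X' Y' : C} (f : X ⟶ X') (g : Y ⟶ Y') :
    ten (p φ f) (p φ g) = p φ (f ⊗ₘ g) := by
  rw [ten, wr_p, wl_p, ← p_comp, MonoidalCategory.tensorHom_def]

instance : MonoidalCategory (Coker φ) where
  tensorObj X Y := ⟨X.obj ⊗ Y.obj⟩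
  tensorUnit := ⟨𝟙_ C⟩
  whiskerLeft X _ _ f := wl X.obj f
  whiskerRight f Y := wr f Y.obj
  tensorHom f g := ten f g
  associator X Y Z := pIso φ (α_ X.obj Y.obj Z.obj)
  leftUnitor X := pIso φ (λ_ X.obj)
  rightUnitor X := pIso φ (ρ_ X.obj)
  tensorHom_def _ _ := rfl
  id_tensorHom_id _ _ := ten_id _ _
  tensorHom_comp_tensorHom _ _ _ _ := ten_comp _ _ _ _
  whiskerLeft_id _ _ := wl_id _ _
  id_whiskerRight _ _ := wr_id _ _
  associator_naturality _ _ _ := ten_associator _ _ _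
  leftUnitor_naturality _ := unitor_left _
  rightUnitor_naturality _ := unitor_right _
  pentagon X Y Z W := by
    have h := congrArg (p φ) (MonoidalCategory.pentagon X.obj Y.obj Z.obj W.obj)
    rwa [p_comp, p_comp, p_comp, ← wr_p, ← wl_p] at h
  triangle X Y := by
    have h := congrArg (p φ) (MonoidalCategory.triangle X.obj Y.obj)
    rwa [p_comp, ← wr_p, ← wl_p] at h

instance : SymmetricCategory (Coker φ) where
  braiding X Y := pIso φ (β_ X.obj Y.obj)
  braiding_naturality_right X _ _ f := braiding_wl X.obj f
  braiding_naturality_left f Z := braiding_wr f Z.obj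
  hexagon_forward X Y Z := by
    have h := congrArg (p φ) (BraidedCategory.hexagon_forward X.obj Y.obj Z.obj)
    rwa [p_comp, p_comp, p_comp, p_comp, ← wr_p, ← wl_p] at h
  hexagon_reverse X Y Z := by
    have h := congrArg (p φ) (BraidedCategory.hexagon_reverse X.obj Y.obj Z.obj)
    rwa [p_comp, p_comp, p_comp, p_comp, ← wr_p, ← wl_p] at h
  symmetry X Y := by
    have h := congrArg (p φ) (SymmetricCategory.symmetry X.obj Y.obj)
    rwa [p_comp] at h

/-- Every morphism of the relative cokernel has a section. -/
theorem exists_section {X Y : C} (f : (⟨X⟩ : Coker φ) ⟶ ⟨Y⟩) :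
    ∃ g : (⟨Y⟩ : Coker φ) ⟶ ⟨X⟩, g ≫ f = 𝟙 _ := by
  obtain ⟨b, f, rfl⟩ := exists_rep f
  obtain ⟨c, ⟨e⟩⟩ := SymTwoGroup.exists_neg b
  refine ⟨cls φ c ((λ_ Y).inv ≫ ε G.functor ▷ _ ≫ G.functor.map e.inv ▷ _ ≫
    δ G.functor _ _ ▷ _ ≫ (α_ _ _ _).hom ≫ _ ◁ inv f), ?_⟩
  rw [← cls_eq]
  refine (cls_comp_cls _ _).trans ((cls_map e.hom _).trans (congrArg (cls φ (𝟙_ B)) ?_))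
  simp only [Category.assoc, Category.id_comp, ← MonoidalCategory.whiskerLeft_comp_assoc, IsIso.inv_hom_id,
    MonoidalCategory.whiskerLeft_id, Iso.hom_inv_id_assoc, ← comp_whiskerRight,
    Functor.Monoidal.δ_μ_assoc, ← Functor.map_comp, Iso.inv_hom_id, CategoryTheory.Functor.map_id,
    Category.comp_id]

instance : SymTwoGroup (Coker φ) where
  isGroupoid := ⟨fun {X Y} f => by
    obtain ⟨g, hg⟩ := exists_section f
    obtain ⟨h, hh⟩ := exists_section g
    have : h = f := by
      rw [← Category.comp_id h]
      erw [← hg]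
      rw [reassoc_of% hh]
    subst this
    exact ⟨g, hh, hg⟩⟩
  exists_neg X := by
    obtain ⟨Y, ⟨e⟩⟩ := SymTwoGroup.exists_neg X.obj
    exact ⟨⟨Y⟩, ⟨pIso φ e⟩⟩

/-- The data inducing a symmetric monoidal functor between relative cokernels: functors `S` and `Q`
on the third and second terms, a comparison `κ : S G ⟹ G' Q`, and morphisms `Q F x ⟶ F' P x`
which are compatible with the structural 2-morphisms. -/
structure MapData {A' B' C' : TwoMod.{u} R} {F' : Hom A' B'} {G' : Hom B' C'}
    (φ : Hom₂ (F.comp G) (Hom.zero A C)) (φ' : Hom₂ (F'.comp G') (Hom.zero A' C')) where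
  S : C ⥤ C'
  [braidedS : S.Braided]
  Q : B ⥤ B'
  [braidedQ : Q.Braided]
  κ : G.functor ⋙ S ⟶ Q ⋙ G'.functor
  [isMonoidal : NatTrans.IsMonoidal κ]
  P : A → A'
  l (x : A) : Q.obj (F.functor.obj x) ⟶ F'.functor.obj (P x)
  w (x : A) : S.map (null φ x) ≫ η S =
    κ.app (F.functor.obj x) ≫ G'.functor.map (l x) ≫ null φ' (P x)

attribute [instance] MapData.braidedS MapData.braidedQ MapData.isMonoidal

namespace MapData

variable {A' B' C' : TwoMod.{u} R} {F' : Hom A' B'} {G' : Hom B' C'}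
  {φ' : Hom₂ (F'.comp G') (Hom.zero A' C')} (d : MapData φ φ')

/-- The comparison `S G b ⟶ G' Q b`. -/
def k (b : B) : d.S.obj (G.functor.obj b) ⟶ G'.functor.obj (d.Q.obj b) := d.κ.app b

theorem k_natural {b c : B} (f : b ⟶ c) :
    d.S.map (G.functor.map f) ≫ d.k c = d.k b ≫ G'.functor.map (d.Q.map f) :=
  d.κ.naturality f

theorem k_μ (b c : B) :
    μ d.S _ _ ≫ d.S.map (μ G.functor b c) ≫ d.k (b ⊗ c) =
      (d.k b ⊗ₘ d.k c) ≫ μ G'.functor _ _ ≫ G'.functor.map (μ d.Q b c) := by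
  have h := NatTrans.IsMonoidal.tensor (τ := d.κ) b c
  rwa [comp_μ, comp_μ, Category.assoc] at h

theorem k_δ (b c : B) :
    d.k (b ⊗ c) ≫ G'.functor.map (δ d.Q b c) ≫ δ G'.functor _ _ =
      d.S.map (δ G.functor b c) ≫ δ d.S _ _ ≫ (d.k b ⊗ₘ d.k c) := by
  have h := isMonoidal_δ d.κ b c
  rwa [comp_δ, comp_δ, Category.assoc] at h

theorem k_η :
    d.k (𝟙_ B) ≫ G'.functor.map (η d.Q) ≫ η G'.functor =
      d.S.map (η G.functor) ≫ η d.S := by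
  have h := isMonoidal_η d.κ
  rwa [comp_η, comp_η] at h

theorem cmap_k {b b' : B} {x : A} (a : b ⟶ F.functor.obj x ⊗ b') :
    d.S.map (cmap φ a) ≫ d.k b' =
      d.k b ≫ cmap φ' (d.Q.map a ≫ δ d.Q _ _ ≫ d.l x ▷ _) := by
  have h := d.w x
  have h' : d.k (F.functor.obj x) ≫ G'.functor.map (d.l x) ≫ null φ' (d.P x) =
    d.S.map (null φ x) ≫ η d.S := h.symm
  simp only [cmap, Functor.map_comp, Category.assoc, ← reassoc_of% k_natural]
  rw [← δ_natural_left_assoc, reassoc_of% k_δ]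
  simp only [MonoidalCategory.tensorHom_def', Category.assoc, ← comp_whiskerRight_assoc]
  rw [h', whisker_exchange_assoc, leftUnitor_naturality, comp_whiskerRight, Category.assoc,
    δ_natural_left_assoc, left_unitality_hom_assoc]

/-- The functor on relative cokernels, on morphisms: `(b, f)` is sent to `(Q b, f')` where `f'` is
`S X ⟶ S (G b + Y) ≅ S G b + S Y ⟶ G' Q b + S Y`. -/
def mapC {X Y : C} (f : (⟨X⟩ : Coker φ) ⟶ ⟨Y⟩) :
    (⟨d.S.obj X⟩ : Coker φ') ⟶ ⟨d.S.obj Y⟩ :=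
  Quot.map (fun q => ⟨d.Q.obj q.obj, d.S.map q.hom ≫ δ d.S _ _ ≫ d.k q.obj ▷ _⟩) (by
    rintro ⟨b, f⟩ ⟨b', f'⟩ ⟨x, a, h⟩
    refine ⟨d.P x, d.Q.map a ≫ δ d.Q _ _ ≫ d.l x ▷ _, ?_⟩
    dsimp only at *
    rw [← h]
    simp only [Category.assoc, ← comp_whiskerRight, ← cmap_k, Functor.map_comp]
    rw [comp_whiskerRight, δ_natural_left_assoc]) f

theorem mapC_p {X Y : C} (f : X ⟶ Y) : d.mapC (p φ f) = p φ' (d.S.map f) := by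
  refine (cls_map (η d.Q) _).trans (congrArg (cls φ' _) ?_)
  rw [← cancel_mono (η G'.functor ▷ _)]
  simp only [Category.assoc, ← comp_whiskerRight, k_η, Functor.Monoidal.ε_η, id_whiskerRight,
    Category.comp_id]
  simp only [comp_whiskerRight, Functor.map_comp, Category.assoc, ← δ_natural_left_assoc]
  rw [← cancel_mono (λ_ _).hom]
  simp only [← Functor.map_comp_assoc, ← comp_whiskerRight_assoc, Category.assoc]
  simp only [comp_whiskerRight, Category.assoc]
  simp

theorem mapC_ev (b : B) (Y : C) :
    d.mapC (ev φ b Y) = p φ' (δ d.S _ _ ≫ d.k b ▷ _) ≫ ev φ' (d.Q.obj b) (d.S.obj Y) := by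
  rw [← cls_eq]
  refine congrArg (cls φ' _) ?_
  simp

theorem mapC_id (X : C) : d.mapC (𝟙 (⟨X⟩ : Coker φ)) = 𝟙 _ := by
  rw [← p_id, mapC_p, CategoryTheory.Functor.map_id, p_id]

theorem mapC_comp {X Y Z : C} (f : (⟨X⟩ : Coker φ) ⟶ ⟨Y⟩) (g : (⟨Y⟩ : Coker φ) ⟶ ⟨Z⟩) :
    d.mapC (f ≫ g) = d.mapC f ≫ d.mapC g := by
  obtain ⟨b, f⟩ := f
  obtain ⟨c, g⟩ := g
  refine (cls_map (δ d.Q b c) _).trans (congrArg (cls φ' _) ?_)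
  have h : G'.functor.map (δ d.Q b c) = G'.functor.map (δ d.Q b c) ≫ δ G'.functor _ _ ≫
      μ G'.functor _ _ := by simp
  have h2 := Functor.OplaxMonoidal.associativity_inv d.S (G.functor.obj b) (G.functor.obj c) Z
  dsimp only
  simp only [Category.assoc]
  rw [h]
  simp only [← comp_whiskerRight, reassoc_of% k_δ]
  simp only [comp_whiskerRight, Functor.map_comp, Category.assoc]
  rw [← δ_natural_left_assoc, ← comp_whiskerRight_assoc (d.S.map _), ← Functor.map_comp,
    Functor.Monoidal.μ_δ, CategoryTheory.Functor.map_id, id_whiskerRight, Category.id_comp]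
  rw [← reassoc_of% h2, ← δ_natural_right_assoc]
  simp only [MonoidalCategory.whiskerLeft_comp, MonoidalCategory.tensorHom_def', comp_whiskerRight,
    Category.assoc]
  simp only [← whisker_exchange_assoc]
  monoidal

/-- The functor induced on relative cokernels. -/
def functor : Coker φ ⥤ Coker φ' where
  obj X := ⟨d.S.obj X.obj⟩
  map f := d.mapC f
  map_id _ := d.mapC_id _
  map_comp _ _ := d.mapC_comp _ _

theorem mapC_wr {X Y : C} (f : (⟨X⟩ : Coker φ) ⟶ ⟨Y⟩) (Z : C) :
    wr (d.mapC f) (d.S.obj Z) ≫ p φ' (μ d.S Y Z) = p φ' (μ d.S X Z) ≫ d.mapC (wr f Z) := by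
  obtain ⟨b, f, rfl⟩ := exists_rep f
  simp only [mapC_comp, mapC_p, mapC_ev, wr_comp, wr_p, wr_ev, Category.assoc, ev_p,
    ← p_comp_assoc]
  congr 2
  have h := Functor.LaxMonoidal.associativity d.S (G.functor.obj b) Y Z
  rw [Functor.map_comp, Category.assoc, comp_whiskerRight, Category.assoc, ← μ_natural_left_assoc,
    cancel_epi (d.S.map f ▷ _),
    ← cancel_epi (μ d.S (G.functor.obj b) Y ▷ _)]
  simp only [comp_whiskerRight, Category.assoc, reassoc_of% h, Functor.Monoidal.μ_δ_assoc,
    Functor.Monoidal.whiskerRight_μ_δ_assoc, associator_naturality_left_assoc, whisker_exchange]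

theorem mapC_wl (Z : C) {X Y : C} (f : (⟨X⟩ : Coker φ) ⟶ ⟨Y⟩) :
    wl (d.S.obj Z) (d.mapC f) ≫ p φ' (μ d.S Z Y) = p φ' (μ d.S Z X) ≫ d.mapC (wl Z f) := by
  have h := Functor.LaxBraided.braided (F := d.S) Y Z
  have h' := Functor.LaxBraided.braided (F := d.S) Z X
  rw [wl, wl, Category.assoc, Category.assoc, ← p_comp, ← h, mapC_comp, mapC_comp, mapC_p, mapC_p,
    ← p_comp_assoc, h', p_comp, p_comp_assoc, reassoc_of% (d.mapC_wr f Z)]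

theorem mapC_ten {X Y X' Y' : C} (f : (⟨X⟩ : Coker φ) ⟶ ⟨X'⟩) (g : (⟨Y⟩ : Coker φ) ⟶ ⟨Y'⟩) :
    ten (d.mapC f) (d.mapC g) ≫ p φ' (μ d.S _ _) = p φ' (μ d.S _ _) ≫ d.mapC (ten f g) := by
  rw [ten, ten, Category.assoc, mapC_wl, reassoc_of% (d.mapC_wr f), mapC_comp]

/-- The functor induced on relative cokernels is monoidal. -/
def core : d.functor.CoreMonoidal where
  εIso := pIso φ' (Functor.Monoidal.εIso d.S)
  μIso X Y := pIso φ' (Functor.Monoidal.μIso d.S X.obj Y.obj)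
  μIso_hom_natural_left f Z := d.mapC_wr f Z.obj
  μIso_hom_natural_right Z f := d.mapC_wl Z.obj f
  associativity X Y Z := by
    have h := congrArg (p φ') (Functor.LaxMonoidal.associativity d.S X.obj Y.obj Z.obj)
    rwa [p_comp, p_comp, p_comp, p_comp, ← wr_p, ← wl_p, ← mapC_p] at h
  left_unitality X := by
    have h := congrArg (p φ') (Functor.LaxMonoidal.left_unitality d.S X.obj)
    rwa [p_comp, p_comp, ← wr_p, ← mapC_p] at h
  right_unitality X := by
    have h := congrArg (p φ') (Functor.LaxMonoidal.right_unitality d.S X.obj)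
    rwa [p_comp, p_comp, ← wl_p, ← mapC_p] at h

instance : d.functor.Braided where
  toMonoidal := d.core.toMonoidal
  braided X Y := by
    have h := congrArg (p φ') (Functor.LaxBraided.braided (F := d.S) X.obj Y.obj)
    rwa [p_comp, p_comp, ← mapC_p] at h

theorem functor_δ (X Y : Coker φ) : δ d.functor X Y = p φ' (δ d.S X.obj Y.obj) := rfl

theorem functor_μ (X Y : Coker φ) : μ d.functor X Y = p φ' (μ d.S X.obj Y.obj) := rfl

theorem functor_ε : ε d.functor = p φ' (ε d.S) := rfl

theorem functor_η : η d.functor = p φ' (η d.S) := rfl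

end MapData

theorem smul_inv_left {r s : R} (f : r ⟶ s) (b : B) :
    (G.smul r b).inv ≫ G.functor.map ((B.smMap f).app b) =
      (C.smMap f).app (G.functor.obj b) ≫ (G.smul s b).inv := by
  rw [Iso.inv_comp_eq, ← Category.assoc, ← G.smul_naturality_left, Category.assoc,
    Iso.hom_inv_id, Category.comp_id]

theorem smul_inv_right (r : R) {b c : B} (f : b ⟶ c) :
    (G.smul r b).inv ≫ G.functor.map ((B.sm r).map f) =
      (C.sm r).map (G.functor.map f) ≫ (G.smul r c).inv := by
  rw [Iso.inv_comp_eq, ← Category.assoc, ← G.smul_naturality_right, Category.assoc,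
    Iso.hom_inv_id, Category.comp_id]

theorem smul_inv_dist (r s : R) (b : B) :
    (G.smul (r ⊗ s) b).inv ≫ G.functor.map (B.dist r s b).hom =
      (C.dist r s (G.functor.obj b)).hom ≫ ((G.smul r b).inv ⊗ₘ (G.smul s b).inv) ≫
        μ G.functor _ _ := by
  rw [Iso.inv_comp_eq, ← reassoc_of% G.smul_dist, tensorHom_comp_tensorHom_assoc]
  simp

theorem smul_inv_assoc (r s : R) (b : B) :
    (G.smul _ b).inv ≫ G.functor.map (B.assoc r s b).hom =
      (C.assoc r s (G.functor.obj b)).hom ≫ (C.sm r).map (G.smul s b).inv ≫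
        (G.smul r ((B.sm s).obj b)).inv := by
  rw [Iso.inv_comp_eq, ← reassoc_of% G.smul_assoc, ← Functor.map_comp_assoc]
  simp

theorem smul_inv_one (b : B) :
    (G.smul TwoRing.one b).inv ≫ G.functor.map (B.one b).hom = (C.one (G.functor.obj b)).hom := by
  rw [Iso.inv_comp_eq, G.smul_one]

/-- The data inducing the functor `r · -` on the relative cokernel. -/
def smulData (φ : Hom₂ (F.comp G) (Hom.zero A C)) (r : R) : MapData φ φ where
  S := C.sm r
  Q := B.sm r
  κ :=
    { app b := (G.smul r b).inv
      naturality _ _ f := (smul_inv_right r f).symm }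
  isMonoidal :=
    { unit := by
        have h := G.smul_zero r
        rw [comp_ε, comp_ε]
        dsimp only
        rw [Iso.comp_inv_eq, ← cancel_mono ((C.sm r).map (η G.functor) ≫ η (C.sm r)),
          Category.assoc (_ ≫ _), ← h]
        simp
      tensor b c := by
        have h := G.smul_add r b c
        rw [comp_μ, comp_μ]
        dsimp only
        rw [Iso.comp_inv_eq, ← cancel_mono ((C.sm r).map (δ G.functor b c) ≫ δ (C.sm r) _ _),
          Category.assoc (_ ≫ _), ← h]
        simp }
  P := (A.sm r).obj
  l x := (F.smul r x).inv
  w x := by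
    dsimp only
    rw [null_smul, ← Functor.map_comp_assoc, Iso.inv_hom_id, CategoryTheory.Functor.map_id,
      Category.id_comp, Iso.inv_hom_id_assoc]

/-- The action of `r` on morphisms of the relative cokernel. -/
def smC (r : R) {X Y : C} (f : (⟨X⟩ : Coker φ) ⟶ ⟨Y⟩) :
    (⟨(C.sm r).obj X⟩ : Coker φ) ⟶ ⟨(C.sm r).obj Y⟩ :=
  (smulData φ r).mapC f

theorem smC_comp (r : R) {X Y Z : C} (f : (⟨X⟩ : Coker φ) ⟶ ⟨Y⟩) (g : (⟨Y⟩ : Coker φ) ⟶ ⟨Z⟩) :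
    smC r (f ≫ g) = smC r f ≫ smC r g :=
  MapData.mapC_comp _ _ _

theorem smC_ev (r : R) (b : B) (Y : C) :
    smC r (ev φ b Y) = p φ (δ (C.sm r) _ _ ≫ (G.smul r b).inv ▷ _) ≫
      ev φ ((B.sm r).obj b) ((C.sm r).obj Y) :=
  MapData.mapC_ev _ _ _

theorem smC_p (r : R) {X Y : C} (f : X ⟶ Y) : smC r (p φ f) = p φ ((C.sm r).map f) :=
  MapData.mapC_p _ _

theorem ten_ev_ev (b c : B) (Y W : C) :
    ten (ev φ b Y) (ev φ c W) =
      p φ (tensorμ _ _ _ _ ≫ μ G.functor b c ▷ _) ≫ ev φ (b ⊗ c) (Y ⊗ W) := by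
  rw [ten, wr_ev, wl_ev, Category.assoc, reassoc_of% ev_p, ev_ev, ← p_comp_assoc, ← p_comp_assoc]
  congr 2
  simp only [exch, tensorμ, MonoidalCategory.whiskerLeft_comp, Category.assoc]

theorem tensorμ_eq (X₁ X₂ Y₁ Y₂ : C) :
    tensorμ (⟨X₁⟩ : Coker φ) ⟨X₂⟩ ⟨Y₁⟩ ⟨Y₂⟩ = p φ (tensorμ X₁ X₂ Y₁ Y₂) := by
  rw [tensorμ, tensorμ, p_comp, p_comp, p_comp, p_comp, ← wl_p, ← wl_p, ← wl_p, ← wr_p]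
  rfl

theorem smMap_naturality {r s : R} (f : r ⟶ s) {X Y : C} (g : (⟨X⟩ : Coker φ) ⟶ ⟨Y⟩) :
    smC r g ≫ p φ ((C.smMap f).app Y) =
      p φ ((C.smMap f).app X) ≫ smC s g := by
  obtain ⟨b, g, rfl⟩ := exists_rep g
  rw [smC_comp, smC_comp, smC_p, smC_p, smC_ev, smC_ev]
  simp only [Category.assoc, ev_p, ← p_comp_assoc]
  rw [← p_map_ev ((B.smMap f).app b), ← p_comp_assoc]
  congr 2
  have h := isMonoidal_δ (C.smMap f) (G.functor.obj b) Y
  rw [← (C.smMap f).naturality_assoc, reassoc_of% h]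
  simp only [Category.assoc]
  rw [whisker_exchange, ← comp_whiskerRight_assoc, smul_inv_left]
  simp only [MonoidalCategory.tensorHom_def, Category.assoc, comp_whiskerRight, whisker_exchange]

theorem dist_natural (r s : R) {X Y : C} (g : (⟨X⟩ : Coker φ) ⟶ ⟨Y⟩) :
    smC (r ⊗ s) g ≫ p φ (C.dist r s Y).hom =
      p φ (C.dist r s X).hom ≫ ten (smC r g) (smC s g) := by
  obtain ⟨b, g, rfl⟩ := exists_rep g
  simp only [smC_comp, smC_p, smC_ev]
  rw [← ten_comp, ← ten_comp, ten_ev_ev, ten_p, ten_p]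
  simp only [Category.assoc, ev_p, ← p_comp_assoc]
  rw [← p_map_ev (B.dist r s b).hom, ← p_comp_assoc]
  congr 2
  rw [← reassoc_of% C.dist_naturality_right]
  simp only [Category.assoc]
  rw [← tensorHom_comp_tensorHom_assoc, ← tensorHom_id (G.smul r b).inv,
    ← tensorHom_id (G.smul s b).inv, tensorμ_natural_assoc,
    reassoc_of% C.interchange, whisker_exchange, ← comp_whiskerRight_assoc, smul_inv_dist]
  rw [id_tensorHom_id, tensorHom_id, MonoidalCategory.tensorHom_def (C.dist r s _).hom]
  simp only [Category.assoc, comp_whiskerRight, whisker_exchange, whisker_exchange_assoc]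

theorem assoc_natural (r s : R) {X Y : C} (g : (⟨X⟩ : Coker φ) ⟶ ⟨Y⟩) :
    smC _ g ≫ p φ (C.assoc r s Y).hom =
      p φ (C.assoc r s X).hom ≫ smC r (smC s g) := by
  obtain ⟨b, g, rfl⟩ := exists_rep g
  simp only [smC_comp, smC_p, smC_ev]
  simp only [Category.assoc, ev_p, ← p_comp_assoc]
  rw [← p_map_ev (B.assoc r s b).hom, ← p_comp_assoc]
  congr 2
  rw [← reassoc_of% C.assoc_naturality_right]
  simp only [Category.assoc, Functor.map_comp]
  rw [← δ_natural_left_assoc, ← reassoc_of% C.assoc_add_right, whisker_exchange,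
    ← comp_whiskerRight_assoc, smul_inv_assoc]
  simp only [MonoidalCategory.tensorHom_def, Category.assoc, comp_whiskerRight, whisker_exchange,
    whisker_exchange_assoc]

theorem one_natural {X Y : C} (g : (⟨X⟩ : Coker φ) ⟶ ⟨Y⟩) :
    smC TwoRing.one g ≫ p φ (C.one Y).hom = p φ (C.one X).hom ≫ g := by
  obtain ⟨b, g, rfl⟩ := exists_rep g
  simp only [smC_comp, smC_p, smC_ev]
  simp only [Category.assoc, ev_p, ← p_comp_assoc]
  rw [← p_map_ev (B.one b).hom, ← p_comp_assoc]
  congr 2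
  rw [← C.one_naturality]
  simp only [Category.assoc]
  rw [← C.one_add, whisker_exchange, ← comp_whiskerRight_assoc, smul_inv_one]
  simp [MonoidalCategory.tensorHom_def]

/-- The action of `R` on the relative cokernel, as a bifunctor. -/
def actFunctor (φ : Hom₂ (F.comp G) (Hom.zero A C)) : R ⥤ Coker φ ⥤ Coker φ where
  obj r := (smulData φ r).functor
  map {r s} f :=
    { app X := (p φ ((C.smMap f).app X.obj) : (⟨(C.sm r).obj X.obj⟩ : Coker φ) ⟶ _)
      naturality _ _ g := smMap_naturality f g }
  map_id r := by
    ext X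
    have h := congrArg (fun t => p φ (NatTrans.app t X.obj))
      ((TwoModule.act (M := C)).functor.map_id r)
    exact h
  map_comp f g := by
    ext X
    have h := congrArg (fun t => p φ (NatTrans.app t X.obj))
      ((TwoModule.act (M := C)).functor.map_comp f g)
    dsimp only [NatTrans.comp_app] at h
    rw [p_comp] at h
    exact h

instance (r : R) : ((actFunctor φ).obj r).Braided :=
  inferInstanceAs (smulData φ r).functor.Braided

/-- The action of `R` on the relative cokernel. -/
def act (φ : Hom₂ (F.comp G) (Hom.zero A C)) : Biadditive R (Coker φ) (Coker φ) where
  functor := actFunctor φ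
  braided _ := inferInstance
  isMonoidal f :=
    { unit := by
        have h := congrArg (p φ) (NatTrans.IsMonoidal.unit (τ := C.smMap f))
        rw [p_comp] at h
        exact h
      tensor X Y := by
        have h := congrArg (p φ) (NatTrans.IsMonoidal.tensor (τ := C.smMap f) X.obj Y.obj)
        rw [p_comp, p_comp, ← ten_p] at h
        exact h }
  dist r s X := pIso φ (C.dist r s X.obj)
  dist_naturality f f' X := by
    have h := congrArg (p φ) (C.dist_naturality f f' X.obj)
    rw [p_comp, p_comp, ← ten_p] at h
    exact h
  dist_naturality_right r s _ _ g := dist_natural r s g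
  dist_assoc r s t X := by
    have h := congrArg (p φ) (C.dist_assoc r s t X.obj)
    rw [p_comp, p_comp, p_comp, p_comp, ← wr_p, ← wl_p] at h
    exact h
  dist_braiding r s X := by
    have h := congrArg (p φ) (C.dist_braiding r s X.obj)
    rw [p_comp, p_comp] at h
    exact h
  interchange r s X Y := by
    have h := congrArg (p φ) (C.interchange r s X.obj Y.obj)
    rw [p_comp, p_comp, p_comp, ← ten_p, ← ten_p, ← tensorμ_eq] at h
    exact h
  interchange_zero r s := by
    have h := congrArg (p φ) (C.interchange_zero r s)
    rw [p_comp, p_comp, ← ten_p] at h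
    exact h

instance : TwoModule R (Coker φ) where
  act := act φ
  actAssoc r s X := pIso φ (C.assoc r s X.obj)
  oneAct X := pIso φ (C.one X.obj)
  actAssoc_naturality_left f s X := by
    have h := congrArg (p φ) (C.assoc_naturality_left f s X.obj)
    rw [p_comp, p_comp] at h
    exact h
  actAssoc_naturality_middle r _ _ f X := by
    have h := congrArg (p φ) (C.assoc_naturality_middle r f X.obj)
    rw [p_comp, p_comp, ← smC_p] at h
    exact h
  actAssoc_naturality_right r s _ _ f := assoc_natural r s f
  oneAct_naturality f := one_natural f
  pentagon r s t X := by
    have h := congrArg (p φ) (C.pentagon r s t X.obj)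
    rw [p_comp, p_comp, p_comp, ← smC_p] at h
    exact h
  triangle r X := by
    have h := congrArg (p φ) (C.triangle r X.obj)
    rw [p_comp, ← smC_p] at h
    exact h
  actAssoc_add_left r r' s X := by
    have h := congrArg (p φ) (C.assoc_add_left r r' s X.obj)
    rw [p_comp, p_comp, p_comp, ← ten_p] at h
    exact h
  actAssoc_add_middle r s s' X := by
    have h := congrArg (p φ) (C.assoc_add_middle r s s' X.obj)
    rw [p_comp, p_comp, p_comp, p_comp, ← ten_p, ← smC_p] at h
    exact h
  actAssoc_add_right r s X Y := by
    have h := congrArg (p φ) (C.assoc_add_right r s X.obj Y.obj)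
    rw [p_comp, p_comp, p_comp, ← ten_p, ← smC_p] at h
    exact h
  actAssoc_zero r s := by
    have h := congrArg (p φ) (C.assoc_zero r s)
    rw [p_comp, p_comp, ← smC_p] at h
    exact h
  oneAct_add X Y := by
    have h := congrArg (p φ) (C.one_add X.obj Y.obj)
    rw [p_comp, ← ten_p] at h
    exact h
  oneAct_zero := congrArg (p φ) C.one_zero

end Coker

/-- The relative cokernel as an `R`-2-module. -/
def coker (φ : Hom₂ (F.comp G) (Hom.zero A C)) : TwoMod.{u} R where
  carrier := Coker φ

end Coker

section KerMaps

variable {A B C : TwoMod.{u} R} {F : Hom A B} {G : Hom B C}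
  (φ : Hom₂ (F.comp G) (Hom.zero A C))

open Ker in
/-- The 1-morphism `E' : Z ⟶ Ker (F, φ)`, `z ↦ (E z, ψ z)`, induced by a 1-morphism `E : Z ⟶ A` and a
2-morphism `ψ : F E ⟹ 0` which is compatible with `φ`. -/
def kerLift {Z : TwoMod.{u} R} (E : Hom Z A) (ψ : Hom₂ (E.comp F) (Hom.zero Z B))
    (hψ : ∀ z, G.functor.map (null ψ z) ≫ η G.functor = null φ (E.functor.obj z)) :
    Hom Z (ker φ) where
  functor :=
    { obj z := (⟨E.functor.obj z, null ψ z, hψ z⟩ : Ker φ)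
      map f := (⟨E.functor.map f, null_naturality ψ f⟩ : KHom (φ := φ) _ _)
      map_id _ := hom_ext (E.functor.map_id _)
      map_comp _ _ := hom_ext (E.functor.map_comp _ _) }
  braided :=
    { toMonoidal := Functor.CoreMonoidal.toMonoidal
        { εIso := isoMk (X := unit) (Y := ⟨_, _, hψ _⟩) (Functor.Monoidal.εIso E.functor) (by
            simp [null_unit, unit, ← Functor.map_comp_assoc])
          μIso X Y := isoMk (X := add ⟨_, _, hψ X⟩ ⟨_, _, hψ Y⟩) (Y := ⟨_, _, hψ _⟩)
            (Functor.Monoidal.μIso E.functor X Y) (by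
              simp [null_tensor, add, addNull, ← Functor.map_comp_assoc])
          μIso_hom_natural_left _ _ := hom_ext (μ_natural_left E.functor _ _)
          μIso_hom_natural_right _ _ := hom_ext (μ_natural_right E.functor _ _)
          associativity _ _ _ := hom_ext (Functor.LaxMonoidal.associativity E.functor _ _ _)
          left_unitality _ := hom_ext (Functor.LaxMonoidal.left_unitality E.functor _)
          right_unitality _ := hom_ext (Functor.LaxMonoidal.right_unitality E.functor _) }
      braided _ _ := hom_ext (Functor.LaxBraided.braided (F := E.functor) _ _) }
  smul r z := isoMk (X := ⟨_, _, hψ _⟩) (Y := smul r ⟨_, _, hψ z⟩) (E.smul r z)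
    (null_smul ψ r z).symm
  smul_naturality_left f z := hom_ext (E.smul_naturality_left f z)
  smul_naturality_right r _ _ f := hom_ext (E.smul_naturality_right r f)
  smul_add r z z' := hom_ext (E.smul_add r z z')
  smul_zero r := hom_ext (E.smul_zero r)
  smul_dist r s z := hom_ext (E.smul_dist r s z)
  smul_assoc r s z := hom_ext (E.smul_assoc r s z)
  smul_one z := hom_ext (E.smul_one z)

variable {Z W : TwoMod.{u} R} (E : Hom Z A) (ψ : Hom₂ (E.comp F) (Hom.zero Z B))
    (hψ : ∀ z, G.functor.map (null ψ z) ≫ η G.functor = null φ (E.functor.obj z))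
    (D : Hom W Z) (χ : Hom₂ (D.comp E) (Hom.zero W A))
    (hχ : ∀ w, F.functor.map (null χ w) ≫ η F.functor = null ψ (D.functor.obj w))

open Ker in
/-- The 2-morphism `E' D ⟹ 0` with the same components as a 2-morphism `χ : E D ⟹ 0` which is
compatible with `ψ`, where `E' : Z ⟶ Ker (F, φ)` is induced by `E` and `ψ`. -/
def kerLiftNull : Hom₂ (D.comp (kerLift φ E ψ hψ)) (Hom.zero W (ker φ)) where
  natTrans :=
    { app w := (⟨null χ w, hχ w⟩ :
        KHom (φ := φ) ⟨_, _, hψ (D.functor.obj w)⟩ unit)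
      naturality _ _ f := hom_ext (χ.natTrans.naturality f) }
  isMonoidal :=
    { unit := hom_ext (NatTrans.IsMonoidal.unit (τ := χ.natTrans))
      tensor _ _ := hom_ext (NatTrans.IsMonoidal.tensor (τ := χ.natTrans) _ _) }
  smul r w := hom_ext (χ.smul r w)

end KerMaps

section Trans

variable {A B A' B' : TwoMod.{u} R} {F : Hom A B} {F' : Hom A' B'} {P : Hom A A'} {Q : Hom B B'}
  (l : Hom₂ (F.comp Q) (P.comp F'))

/-- The component `Q (F X) ⟶ F' (P X)` of a 2-morphism `Q F ⟹ F' P`. -/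
def sq (X : A) : Q.functor.obj (F.functor.obj X) ⟶ F'.functor.obj (P.functor.obj X) := l.app X

theorem sq_naturality {X Y : A} (f : X ⟶ Y) :
    Q.functor.map (F.functor.map f) ≫ sq l Y = sq l X ≫ F'.functor.map (P.functor.map f) :=
  l.natTrans.naturality f

theorem sq_unit : sq l (𝟙_ A) ≫ F'.functor.map (η P.functor) ≫ η F'.functor =
    Q.functor.map (η F.functor) ≫ η Q.functor := by
  have h := isMonoidal_η l.natTrans
  exact h

theorem sq_tensor (X Y : A) :
    sq l (X ⊗ Y) ≫ F'.functor.map (δ P.functor X Y) ≫ δ F'.functor _ _ =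
      Q.functor.map (δ F.functor X Y) ≫ δ Q.functor _ _ ≫ (sq l X ⊗ₘ sq l Y) := by
  have h := isMonoidal_δ l.natTrans X Y
  exact h.trans (Category.assoc _ _ _)

theorem sq_smul (r : R) (X : A) :
    sq l ((A.sm r).obj X) ≫ F'.functor.map (P.smul r X).hom ≫ (F'.smul r _).hom =
      Q.functor.map (F.smul r X).hom ≫ (Q.smul r _).hom ≫ (B'.sm r).map (sq l X) :=
  (l.smul r X).trans (Category.assoc _ _ _)

/-- For `a : F X ⟶ 0`, the morphism `F' (P X) ≅ Q (F X) ⟶ Q 0 ≅ 0`. -/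
noncomputable def transNull {X : A} (a : F.functor.obj X ⟶ 𝟙_ B) :
    F'.functor.obj (P.functor.obj X) ⟶ 𝟙_ B' :=
  inv (sq l X) ≫ Q.functor.map a ≫ η Q.functor

theorem map_transNull {X Y : A} (f : X ⟶ Y) (b : F.functor.obj Y ⟶ 𝟙_ B) :
    F'.functor.map (P.functor.map f) ≫ transNull l b = transNull l (F.functor.map f ≫ b) := by
  rw [transNull, transNull, ← cancel_epi (sq l X), ← reassoc_of% (sq_naturality l f)]
  simp

theorem η_transNull :
    F'.functor.map (η P.functor) ≫ η F'.functor = transNull l (η F.functor) := by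
  rw [transNull, ← cancel_epi (sq l _), sq_unit]
  simp

theorem δ_transNull {X Y : A} (a : F.functor.obj X ⟶ 𝟙_ B) (b : F.functor.obj Y ⟶ 𝟙_ B) :
    F'.functor.map (δ P.functor X Y) ≫ addNull F' (transNull l a) (transNull l b) =
      transNull l (addNull F a b) := by
  have h := sq_tensor l X Y
  rw [← cancel_epi (sq l _), addNull, reassoc_of% h]
  simp only [transNull, addNull, tensorHom_comp_tensorHom_assoc, IsIso.hom_inv_id_assoc,
    Functor.map_comp, Category.assoc, map_leftUnitor_η]
  rw [← δ_natural_assoc, tensorHom_comp_tensorHom_assoc]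

theorem smul_transNull (r : R) {X : A} (a : F.functor.obj X ⟶ 𝟙_ B) :
    F'.functor.map (P.smul r X).hom ≫ smulNull F' r (transNull l a) =
      transNull l (smulNull F r a) := by
  have h := sq_smul l r X
  rw [← cancel_epi (sq l _), smulNull, reassoc_of% h]
  simp only [transNull, smulNull, IsIso.hom_inv_id_assoc, Functor.map_comp, Category.assoc,
    Q.smul_zero]
  rw [← Functor.map_comp_assoc, IsIso.hom_inv_id, CategoryTheory.Functor.map_id, Category.id_comp,
    ← reassoc_of% Q.smul_naturality_right]

end Trans

section Maps

variable {A B C A' B' C' : TwoMod.{u} R} {F : Hom A B} {G : Hom B C} {F' : Hom A' B'}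
  {G' : Hom B' C'} {P : Hom A A'} {Q : Hom B B'} {S : Hom C C'}
  (φ : Hom₂ (F.comp G) (Hom.zero A C)) (φ' : Hom₂ (F'.comp G') (Hom.zero A' C'))
  (l : Hom₂ (F.comp Q) (P.comp F')) (m : Hom₂ (G.comp S) (Q.comp G'))

/-- The condition that 2-morphisms `l : Q F ⟹ F' P` and `m : S G ⟹ G' Q` are compatible with
`φ : G F ⟹ 0` and `φ' : G' F' ⟹ 0`: the two 2-morphisms `S G F ⟹ 0` agree. -/
def SqCompat : Prop :=
  ∀ x : A, S.functor.map (null φ x) ≫ η S.functor =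
    sq m (F.functor.obj x) ≫ G'.functor.map (sq l x) ≫ null φ' (P.functor.obj x)

variable {φ φ' l m}

theorem transNull_w (h : SqCompat φ φ' l m) (X : Ker φ) :
    G'.functor.map (transNull l X.hom) ≫ η G'.functor = null φ' (P.functor.obj X.obj) := by
  have h := h X.obj
  rw [← cancel_epi (G'.functor.map (sq l X.obj)), ← cancel_epi (sq m _), ← h, ← X.w, transNull]
  simp only [← Functor.map_comp_assoc, IsIso.hom_inv_id_assoc]
  simp only [Functor.map_comp, Category.assoc, ← sq_unit m]
  rw [← reassoc_of% (sq_naturality m X.hom)]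

variable (φ φ' l m)

open Ker in
/-- The 1-morphism `Ker (F, φ) ⟶ Ker (F', φ')` induced by a morphism of sequences,
`(X, a) ↦ (P X, F' (P X) ≅ Q (F X) ⟶ Q 0 ≅ 0)`. -/
noncomputable def kerMap (h : SqCompat φ φ' l m) : Hom (ker φ) (ker φ') where
  functor :=
    { obj X := (⟨P.functor.obj X.obj, transNull l X.hom, transNull_w h X⟩ : Ker φ')
      map f := (⟨P.functor.map (KHom.hom f),
        (map_transNull l _ _).trans (congrArg (transNull l) (KHom.w f))⟩ : KHom (φ := φ') _ _)
      map_id _ := hom_ext (P.functor.map_id _)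
      map_comp _ _ := hom_ext (P.functor.map_comp _ _) }
  braided :=
    { toMonoidal := Functor.CoreMonoidal.toMonoidal
        { εIso := (isoMk (X := ⟨_, _, transNull_w h unit⟩) (Y := unit)
            (Functor.Monoidal.εIso P.functor).symm (η_transNull l)).symm
          μIso X Y := (isoMk (X := ⟨_, _, transNull_w h (add X Y)⟩)
            (Y := add ⟨_, _, transNull_w h X⟩ ⟨_, _, transNull_w h Y⟩)
            (Functor.Monoidal.μIso P.functor X.obj Y.obj).symm (δ_transNull l _ _)).symm
          μIso_hom_natural_left _ _ := hom_ext (μ_natural_left P.functor _ _)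
          μIso_hom_natural_right _ _ := hom_ext (μ_natural_right P.functor _ _)
          associativity _ _ _ := hom_ext (Functor.LaxMonoidal.associativity P.functor _ _ _)
          left_unitality _ := hom_ext (Functor.LaxMonoidal.left_unitality P.functor _)
          right_unitality _ := hom_ext (Functor.LaxMonoidal.right_unitality P.functor _) }
      braided _ _ := hom_ext (Functor.LaxBraided.braided (F := P.functor) _ _) }
  smul r X := isoMk (X := ⟨_, _, transNull_w h (smul r X)⟩)
    (Y := smul r ⟨_, _, transNull_w h X⟩) (P.smul r X.obj) (smul_transNull l r _)
  smul_naturality_left f X := hom_ext (P.smul_naturality_left f X.obj)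
  smul_naturality_right r _ _ f := hom_ext (P.smul_naturality_right r (KHom.hom f))
  smul_add r X Y := hom_ext (P.smul_add r X.obj Y.obj)
  smul_zero r := hom_ext (P.smul_zero r)
  smul_dist r s X := hom_ext (P.smul_dist r s X.obj)
  smul_assoc r s X := hom_ext (P.smul_assoc r s X.obj)
  smul_one X := hom_ext (P.smul_one X.obj)

/-- The data inducing the 1-morphism on relative cokernels. -/
def cokerData (h : SqCompat φ φ' l m) : Coker.MapData φ φ' where
  S := S.functor
  Q := Q.functor
  κ := m.natTrans
  isMonoidal := m.isMonoidal
  P := P.functor.obj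
  l := sq l
  w := h

variable {φ φ' l m} (h : SqCompat φ φ' l m)

section

open Coker

/-- The action on morphisms of the functor induced on relative cokernels. -/
def cokC {X Y : C} (f : (⟨X⟩ : Coker φ) ⟶ ⟨Y⟩) :
    (⟨S.functor.obj X⟩ : Coker φ') ⟶ ⟨S.functor.obj Y⟩ :=
  (cokerData φ φ' l m h).mapC f

theorem cokC_comp {X Y Z : C} (f : (⟨X⟩ : Coker φ) ⟶ ⟨Y⟩) (g : (⟨Y⟩ : Coker φ) ⟶ ⟨Z⟩) :
    cokC h (f ≫ g) = cokC h f ≫ cokC h g :=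
  MapData.mapC_comp _ _ _

theorem cokC_p {X Y : C} (f : X ⟶ Y) : cokC h (p φ f) = p φ' (S.functor.map f) :=
  MapData.mapC_p _ _

theorem cokC_ev (b : B) (Y : C) :
    cokC h (ev φ b Y) = p φ' (δ S.functor _ _ ≫ sq m b ▷ _) ≫
      ev φ' (Q.functor.obj b) (S.functor.obj Y) :=
  MapData.mapC_ev _ _ _

theorem sq_smul_inv (r : R) (b : B) :
    S.functor.map (G.smul r b).inv ≫ sq m _ ≫ G'.functor.map (Q.smul r b).hom =
      (S.smul r _).hom ≫ (C'.sm r).map (sq m b) ≫ (G'.smul r _).inv := by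
  have h := sq_smul m r b
  rw [← cancel_mono (G'.smul r _).hom, ← cancel_epi (S.functor.map (G.smul r b).hom)]
  simp only [Category.assoc, h, Iso.inv_hom_id, Category.comp_id, ← Functor.map_comp_assoc]

theorem cokC_smC (r : R) {X Y : C} (f : (⟨X⟩ : Coker φ) ⟶ ⟨Y⟩) :
    cokC h (smC r f) ≫ p φ' (S.smul r Y).hom = p φ' (S.smul r X).hom ≫ smC r (cokC h f) := by
  obtain ⟨b, f, rfl⟩ := exists_rep f
  simp only [smC_comp, smC_p, smC_ev, cokC_comp, cokC_p, cokC_ev]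
  simp only [Category.assoc, ev_p, ← p_comp_assoc]
  rw [← p_map_ev (Q.smul r b).hom, ← p_comp_assoc]
  congr 2
  have h1 := S.smul_add r (G.functor.obj b) Y
  have h2 := sq_smul_inv (m := m) r b
  rw [← reassoc_of% S.smul_naturality_right]
  simp only [Functor.map_comp, Category.assoc]
  rw [← δ_natural_left_assoc, ← δ_natural_left_assoc, ← reassoc_of% h1]
  simp only [whisker_exchange, ← comp_whiskerRight_assoc, h2]
  simp only [MonoidalCategory.tensorHom_def, Category.assoc, comp_whiskerRight, whisker_exchange,
    whisker_exchange_assoc]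

end

variable (φ φ' l m)

open Coker in
/-- The 1-morphism `Coker (G, φ) ⟶ Coker (G', φ')` induced by a morphism of sequences,
`X ↦ S X` on objects and `(b, f) ↦ (Q b, S X ⟶ S (G b + Y) ≅ S (G b) + S Y ≅ G' (Q b) + S Y)` on
morphisms. -/
def cokerMap (h : SqCompat φ φ' l m) : Hom (coker φ) (coker φ') where
  functor := (cokerData φ φ' l m h).functor
  braided := (inferInstance : (cokerData φ φ' l m h).functor.Braided)
  smul r X := pIso φ' (S.smul r X.obj)
  smul_naturality_left f X := by
    have e := congrArg (p φ') (S.smul_naturality_left f X.obj)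
    rw [p_comp, p_comp, ← cokC_p h] at e
    exact e
  smul_naturality_right r _ _ f := cokC_smC h r f
  smul_add r X Y := by
    have e := congrArg (p φ') (S.smul_add r X.obj Y.obj)
    rw [p_comp, p_comp, p_comp, p_comp, ← cokC_p h, ← ten_p, ← smC_p] at e
    exact e
  smul_zero r := by
    have e := congrArg (p φ') (S.smul_zero r)
    rw [p_comp, p_comp, p_comp, ← cokC_p h, ← smC_p] at e
    exact e
  smul_dist r s X := by
    have e := congrArg (p φ') (S.smul_dist r s X.obj)
    rw [p_comp, p_comp, p_comp, ← cokC_p h, ← ten_p] at e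
    exact e
  smul_assoc r s X := by
    have e := congrArg (p φ') (S.smul_assoc r s X.obj)
    rw [p_comp, p_comp, p_comp, ← cokC_p h, ← smC_p] at e
    exact e
  smul_one X := by
    have e := congrArg (p φ') (S.smul_one X.obj)
    rw [p_comp, ← cokC_p h] at e
    exact e

end Maps

section KerLiftSq

variable {Z A B C Z' A' B' C' : TwoMod.{u} R} {F : Hom A B} {G : Hom B C} {F' : Hom A' B'}
  {G' : Hom B' C'} {P : Hom A A'} {Q : Hom B B'} {S : Hom C C'} {E : Hom Z A} {E' : Hom Z' A'}
  {T : Hom Z Z'} (φ : Hom₂ (F.comp G) (Hom.zero A C)) (φ' : Hom₂ (F'.comp G') (Hom.zero A' C'))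
  (l : Hom₂ (F.comp Q) (P.comp F')) (m : Hom₂ (G.comp S) (Q.comp G'))
  (ψ : Hom₂ (E.comp F) (Hom.zero Z B)) (ψ' : Hom₂ (E'.comp F') (Hom.zero Z' B'))
  (t : Hom₂ (E.comp P) (T.comp E')) (h : SqCompat φ φ' l m) (ht : SqCompat ψ ψ' t l)
  (hψ : ∀ z, G.functor.map (null ψ z) ≫ η G.functor = null φ (E.functor.obj z))
  (hψ' : ∀ z, G'.functor.map (null ψ' z) ≫ η G'.functor = null φ' (E'.functor.obj z))

theorem kerLiftSq_w {E : Hom Z A} {E' : Hom Z' A'} {T : Hom Z Z'} {l : Hom₂ (F.comp Q) (P.comp F')}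
    {ψ : Hom₂ (E.comp F) (Hom.zero Z B)} {ψ' : Hom₂ (E'.comp F') (Hom.zero Z' B')}
    {t : Hom₂ (E.comp P) (T.comp E')} (ht : SqCompat ψ ψ' t l) (z : Z) :
    F'.functor.map (sq t z) ≫ null ψ' (T.functor.obj z) = transNull l (null ψ z) := by
  rw [transNull, ht z, IsIso.inv_hom_id_assoc]

open Ker in
/-- The 2-morphism with the same components as `t`, from `Z ⟶ Ker (F, φ) ⟶ Ker (F', φ')` to
`Z ⟶ Z' ⟶ Ker (F', φ')`. -/
def kerLiftSq : Hom₂ ((kerLift φ E ψ hψ).comp (kerMap φ φ' l m h))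
    (T.comp (kerLift φ' E' ψ' hψ')) where
  natTrans :=
    { app z := (⟨sq t z, kerLiftSq_w ht z⟩ :
        KHom (φ := φ') ⟨_, _, transNull_w h ⟨_, _, hψ z⟩⟩ ⟨_, _, hψ' (T.functor.obj z)⟩)
      naturality _ _ f := hom_ext (t.natTrans.naturality f) }
  isMonoidal :=
    { unit := hom_ext (NatTrans.IsMonoidal.unit (τ := t.natTrans))
      tensor _ _ := hom_ext (NatTrans.IsMonoidal.tensor (τ := t.natTrans) _ _) }
  smul r z := hom_ext (t.smul r z)

end KerLiftSq

section Zero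

instance : SymmetricCategory (Discrete PUnit.{u + 1}) where

instance : TwoModule R (Discrete PUnit.{u + 1}) where
  isGroupoid := inferInstance
  exists_neg X := ⟨X, ⟨eqToIso (Subsingleton.elim _ _)⟩⟩
  act :=
    { functor := (Functor.const R).obj (𝟭 _)
      braided _ := inferInstanceAs (𝟭 (Discrete PUnit.{u + 1})).Braided
      isMonoidal _ := inferInstanceAs (NatTrans.IsMonoidal (𝟙 (𝟭 (Discrete PUnit.{u + 1}))))
      dist _ _ _ := eqToIso (Subsingleton.elim _ _)
      dist_naturality _ _ _ := Subsingleton.elim _ _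
      dist_naturality_right _ _ _ _ _ := Subsingleton.elim _ _
      dist_assoc _ _ _ _ := Subsingleton.elim _ _
      dist_braiding _ _ _ := Subsingleton.elim _ _
      interchange _ _ _ _ := Subsingleton.elim _ _
      interchange_zero _ _ := Subsingleton.elim _ _ }
  actAssoc _ _ _ := Iso.refl _
  oneAct _ := Iso.refl _
  actAssoc_naturality_left _ _ _ := Subsingleton.elim _ _
  actAssoc_naturality_middle _ _ _ _ _ := Subsingleton.elim _ _
  actAssoc_naturality_right _ _ _ _ _ := Subsingleton.elim _ _
  oneAct_naturality _ := Subsingleton.elim _ _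
  pentagon _ _ _ _ := Subsingleton.elim _ _
  triangle _ _ := Subsingleton.elim _ _
  actAssoc_add_left _ _ _ _ := Subsingleton.elim _ _
  actAssoc_add_middle _ _ _ _ := Subsingleton.elim _ _
  actAssoc_add_right _ _ _ _ := Subsingleton.elim _ _
  actAssoc_zero _ _ := Subsingleton.elim _ _
  oneAct_add _ _ := Subsingleton.elim _ _
  oneAct_zero := Subsingleton.elim _ _

variable (R) in
/-- The zero `R`-2-module, with one object and one morphism. -/
def zeroMod : TwoMod.{u} R where
  carrier := Discrete PUnit.{u + 1}

/-- The canonical 2-morphism `Q 0 ⟹ 0 P` for 1-morphisms `P : A ⟶ A'` and `Q : B ⟶ B'`; its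
components are `Q 0 ≅ 0`. -/
def zeroSq {A A' B B' : TwoMod.{u} R} (P : Hom A A') (Q : Hom B B') :
    Hom₂ ((Hom.zero A B).comp Q) (P.comp (Hom.zero A' B')) where
  natTrans :=
    { app _ := η Q.functor
      naturality _ _ _ := by simp [Hom.comp, Hom.zero] }
  isMonoidal :=
    { unit := by
        change (ε Q.functor ≫ Q.functor.map (𝟙 _)) ≫ η Q.functor = 𝟙 _ ≫ 𝟙 _
        simp
      tensor X Y := by
        change (μ Q.functor _ _ ≫ Q.functor.map (λ_ _).hom) ≫ η Q.functor =
          (η Q.functor ⊗ₘ η Q.functor) ≫ (λ_ _).hom ≫ 𝟙 _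
        rw [Category.assoc, μ_map_leftUnitor_η, Category.comp_id] }
  smul r x := by
    change η Q.functor ≫ 𝟙 _ ≫ ε (B'.sm r) = (Q.functor.map (ε (B.sm r)) ≫ (Q.smul r _).hom) ≫
      (B'.sm r).map (η Q.functor)
    have h := Q.smul_zero r
    rw [← cancel_mono (η (B'.sm r)), ← cancel_epi (Q.functor.map (η (B.sm r)))]
    simp only [Category.assoc, ← h, Functor.Monoidal.ε_η, Category.comp_id, Category.id_comp]
    simp [← Functor.map_comp_assoc]

/-- The canonical 2-morphism `G 0 ⟹ 0`; its components are `G 0 ≅ 0`. -/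
def zeroComp (A : TwoMod.{u} R) {B C : TwoMod.{u} R} (G : Hom B C) :
    Hom₂ ((Hom.zero A B).comp G) (Hom.zero A C) where
  natTrans :=
    { app _ := η G.functor
      naturality _ _ _ := by simp [Hom.comp, Hom.zero] }
  isMonoidal :=
    { unit := by
        change (ε G.functor ≫ G.functor.map (𝟙 _)) ≫ η G.functor = 𝟙 _
        simp
      tensor X Y := by
        change (μ G.functor _ _ ≫ G.functor.map (λ_ _).hom) ≫ η G.functor =
          (η G.functor ⊗ₘ η G.functor) ≫ (λ_ _).hom
        rw [Category.assoc, μ_map_leftUnitor_η] }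
  smul r x := by
    change η G.functor ≫ ε (C.sm r) = (G.functor.map (ε (B.sm r)) ≫ (G.smul r _).hom) ≫
      (C.sm r).map (η G.functor)
    have h := G.smul_zero r
    rw [← cancel_mono (η (C.sm r)), ← cancel_epi (G.functor.map (η (B.sm r)))]
    simp only [Category.assoc, ← h, Functor.Monoidal.ε_η, Category.comp_id]
    simp [← Functor.map_comp_assoc]

end Zero

end TwoMod

open TwoMod

variable (R) in
/-- A 2-cochain complex of `R`-2-modules: a sequence `X 0 ⟶ X 1 ⟶ X 2 ⟶ ⋯` of 1-morphisms `d n`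
with 2-morphisms `α n : d (n + 1) ∘ d n ⟹ 0` such that the two 2-morphisms
`d (n + 2) ∘ d (n + 1) ∘ d n ⟹ 0` given by `α n` and by `α (n + 1)` agree. -/
structure Cochain where
  X (n : ℕ) : TwoMod.{u} R
  d (n : ℕ) : Hom (X n) (X (n + 1))
  α (n : ℕ) : Hom₂ ((d n).comp (d (n + 1))) (Hom.zero (X n) (X (n + 2)))
  w (n : ℕ) (x : X n) : (d (n + 2)).functor.map (null (α n) x) ≫ η (d (n + 2)).functor =
    null (α (n + 1)) ((d n).functor.obj x)

namespace Cochain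

/-- A morphism of 2-cochain complexes: 1-morphisms `f n : A n ⟶ B n` and 2-morphisms
`l n : f (n + 1) ∘ d n ⟹ d n ∘ f n`, compatible with the 2-morphisms `α n`. -/
structure Mor (A B : Cochain.{u} R) where
  f (n : ℕ) : Hom (A.X n) (B.X n)
  l (n : ℕ) : Hom₂ ((A.d n).comp (f (n + 1))) ((f n).comp (B.d n))
  w (n : ℕ) : SqCompat (A.α n) (B.α n) (l n) (l (n + 1))

/-- The complex `0 ⟶ A 0 ⟶ A 1 ⟶ ⋯`, with the canonical 2-morphism `d 0 ∘ 0 ⟹ 0`. -/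
def pad (A : Cochain.{u} R) : Cochain.{u} R where
  X
    | 0 => zeroMod R
    | n + 1 => A.X n
  d
    | 0 => Hom.zero (zeroMod R) (A.X 0)
    | n + 1 => A.d n
  α
    | 0 => zeroComp (zeroMod R) (A.d 0)
    | n + 1 => A.α n
  w
    | 0 => fun _ => (null_unit (A.α 0)).symm
    | n + 1 => A.w n

/-- The morphism of complexes extended by zero. -/
def Mor.pad {A B : Cochain.{u} R} (F : Mor A B) : Mor A.pad B.pad where
  f
    | 0 => Hom.zero (zeroMod R) (zeroMod R)
    | n + 1 => F.f n
  l
    | 0 => zeroSq (Hom.zero (zeroMod R) (zeroMod R)) (F.f 0)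
    | n + 1 => F.l n
  w
    | 0 => fun _ => by
      change (F.f 1).functor.map (η (A.d 0).functor) ≫ η (F.f 1).functor =
        sq (F.l 0) (𝟙_ _) ≫ (B.d 0).functor.map (η (F.f 0).functor) ≫ η (B.d 0).functor
      exact (sq_unit (F.l 0)).symm
    | n + 1 => F.w n

section

variable (A : Cochain.{u} R) (n : ℕ)

/-- The 1-morphism `A (n + 1) ⟶ Ker (d (n + 2), α (n + 2))` induced by `d (n + 1)` and
`α (n + 1)`. -/
def toKer : Hom (A.X (n + 1)) (ker (A.α (n + 2))) :=
  kerLift (A.α (n + 2)) (A.d (n + 1)) (A.α (n + 1)) (A.w (n + 1))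

/-- The 2-morphism from `A n ⟶ A (n + 1) ⟶ Ker (d (n + 2), α (n + 2))` to zero induced
by `α n`. -/
def toKerNull : Hom₂ ((A.d n).comp (A.toKer n)) (Hom.zero (A.X n) (ker (A.α (n + 2)))) :=
  kerLiftNull (A.α (n + 2)) (A.d (n + 1)) (A.α (n + 1)) (A.w (n + 1)) (A.d n) (A.α n) (A.w n)

/-- The cohomology of `A n ⟶ A (n + 1) ⟶ A (n + 2) ⟶ A (n + 3) ⟶ A (n + 4)` at `A (n + 2)`:
the relative cokernel of `A n ⟶ A (n + 1) ⟶ Ker (d (n + 2), α (n + 2))`. -/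
def cohomologyAt : TwoMod.{u} R :=
  coker (A.toKerNull n)

/-- The `n`-th cohomology `R`-2-module of a 2-cochain complex `A`, defined through the complex
`0 ⟶ 0 ⟶ A 0 ⟶ A 1 ⟶ ⋯`. -/
def cohomology : TwoMod.{u} R :=
  A.pad.pad.cohomologyAt n

end

namespace Mor

variable {A B : Cochain.{u} R} (F : Mor A B) (n : ℕ)

/-- The 1-morphism induced on relative kernels. -/
noncomputable def onKer : Hom (ker (A.α (n + 2))) (ker (B.α (n + 2))) :=
  kerMap (A.α (n + 2)) (B.α (n + 2)) (F.l (n + 2)) (F.l (n + 3)) (F.w (n + 2))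

/-- The 2-morphism expressing the compatibility of `onKer` with `toKer`. -/
noncomputable def onKerSq :
    Hom₂ ((A.toKer n).comp (F.onKer n)) ((F.f (n + 1)).comp (B.toKer n)) :=
  kerLiftSq (A.α (n + 2)) (B.α (n + 2)) (F.l (n + 2)) (F.l (n + 3)) (A.α (n + 1)) (B.α (n + 1))
    (F.l (n + 1)) (F.w (n + 2)) (F.w (n + 1)) (A.w (n + 1)) (B.w (n + 1))

/-- The 1-morphism induced on `cohomologyAt`. -/
noncomputable def mapAt : Hom (A.cohomologyAt n) (B.cohomologyAt n) :=
  cokerMap (A.toKerNull n) (B.toKerNull n) (F.l n) (F.onKerSq n)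
    (fun x => Ker.hom_ext (F.w n x))

/-- The 1-morphism induced by a morphism of complexes on the `n`-th cohomology `R`-2-modules. -/
noncomputable def map : Hom (A.cohomology n) (B.cohomology n) :=
  F.pad.pad.mapAt n

end Mor

end Cochain

namespace TwoMod

/-- The component `F x ⟶ (a x + b x) + c x` of a 2-morphism `F ⟹ a + b + c`. -/
def app₃ {M N : TwoMod.{u} R} {F a b c : Hom M N} (τ : Hom₂ F ((a.add b).add c)) (x : M) :
    F.functor.obj x ⟶ (a.functor.obj x ⊗ b.functor.obj x) ⊗ c.functor.obj x :=
  τ.app x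

/-- The compatibility of two consecutive 2-morphisms `τ : f ⟹ e' h + h' d + g` and
`τ' : f' ⟹ e h' + h'' d' + g'` of a homotopy, for 1-morphisms `d : A ⟶ A'`, `d' : A' ⟶ A''`,
`e' : B' ⟶ B`, `e : B ⟶ B''`, `h : A ⟶ B'`, `h' : A' ⟶ B`, `h'' : A'' ⟶ B''`,
`f, g : A ⟶ B`, `f', g' : A' ⟶ B''` and 2-morphisms `α : d' d ⟹ 0`, `β : e e' ⟹ 0`,
`l : f' d ⟹ e f`, `m : g' d ⟹ e g`.  The two 2-morphisms from `f' d` to `e h' d + e g` agree: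
`f' d ⟹ e h' d + h'' d' d + g' d ⟹ e h' d + 0 + e g` given by `τ'`, `α` and `m`, and
`f' d ⟹ e f ⟹ e e' h + e h' d + e g ⟹ 0 + e h' d + e g` given by `l`, `τ` and `β`. -/
def HomotopyCompat {A A' A'' B' B B'' : TwoMod.{u} R} {d : Hom A A'} {d' : Hom A' A''}
    {e' : Hom B' B} {e : Hom B B''} {h : Hom A B'} {h' : Hom A' B} {h'' : Hom A'' B''}
    {f g : Hom A B} {f' g' : Hom A' B''}
    (α : Hom₂ (d.comp d') (Hom.zero A A'')) (β : Hom₂ (e'.comp e) (Hom.zero B' B''))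
    (l : Hom₂ (d.comp f') (f.comp e)) (m : Hom₂ (d.comp g') (g.comp e))
    (τ : Hom₂ f (((h.comp e').add (d.comp h')).add g))
    (τ' : Hom₂ f' (((h'.comp e).add (d'.comp h'')).add g')) : Prop :=
  ∀ x : A,
    app₃ τ' (d.functor.obj x) ≫
        (_ ◁ (h''.functor.map (null α x) ≫ η h''.functor) ⊗ₘ sq m x) ≫ (ρ_ _).hom ▷ _ =
      sq l x ≫ e.functor.map (app₃ τ x) ≫ δ e.functor _ _ ≫ δ e.functor _ _ ▷ _ ≫
        (null β (h.functor.obj x) ▷ _) ▷ _ ≫ (λ_ _).hom ▷ _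

end TwoMod

namespace Cochain

/-- A homotopy between two morphisms `F` and `G` of 2-cochain complexes: 1-morphisms
`h n : A n ⟶ B (n - 1)`, where `B (-1) = 0`, and 2-morphisms
`τ n : F n ⟹ d (n - 1) ∘ h n + h (n + 1) ∘ d n + G n`, compatible with all the structure.
As `B.pad` is `B` extended by zero on the left, `B.pad.X n` is `B (n - 1)`. -/
structure Homotopy {A B : Cochain.{u} R} (F G : Mor A B) where
  h (n : ℕ) : Hom (A.X n) (B.pad.X n)
  τ (n : ℕ) : Hom₂ (F.f n)
    ((((h n).comp (B.pad.d n)).add ((A.d n).comp (h (n + 1)))).add (G.f n))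
  w (n : ℕ) : HomotopyCompat (A.α n) (B.pad.α n) (F.l n) (G.l n) (τ n) (τ (n + 1))

/-- Two morphisms of 2-cochain complexes are homotopic if there is a homotopy between them. -/
def Homotopic {A B : Cochain.{u} R} (F G : Mor A B) : Prop :=
  Nonempty (Homotopy F G)

end Cochain

end TwoModules

/-! An object of the `n`-th cohomology is a pair `(X, a : L_n X ⟶ 0)`, and a morphism of a relative
cokernel is represented by an arrow `X ⟶ M_{n-1} B + Y`. A homotopy therefore almost supplies the
required morphism `F_n X ⟶ G_n X`: the arrow `τ_n : F_n X ⟶ M_{n-1} H_{n-1} X + H_n L_n X + G_n X`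
has one summand too many, and `a` removes it through `H_n L_n X ⟶ H_n 0 ≅ 0`. What is left
represents a morphism over the object `H_{n-1} X`.

Two consecutive compatibility conditions of the homotopy make this work.

The contracted arrow must lie in the relative kernel, that is, respect the given arrows to `0` after
`M_n` is applied. This is the condition linking `τ_n` with `τ_{n+1}`, combined with naturality of
`τ_{n+1}` along `a` and its compatibility with units (`cancelNull_compNull_transNull`). The equation
`L_{n+1} a = α_n` of the kernel object is what lets the term `H_{n+1} α_n` be recognised.

The class must be natural for the morphisms of the cokernel, not only for those of the kernel. Every
morphism is an arrow of the kernel followed by some `ev b Y`, so `ev` is the one new case. There the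
two composites are represented over `F_{n-1} b` and over `H_{n-1} L_{n-1} b + G_{n-1} b`, and the
relation defining the cokernel asks for an arrow from the first to the second plus something of the
form `M_{n-2} x`. The arrow is `τ_{n-1}` with `x = H_{n-2} b`; that it is a valid identification is
the condition linking `τ_{n-1}` with `τ_n` (`map_cancel_left`, `homotopyApp_naturality`).

Additivity and `R`-linearity are inherited from `τ_n`, and invertibility is automatic because all
modules are groupoids. The low degrees need no separate argument: cohomology is defined on the
complex padded twice by zero, and homotopies can be padded too. -/

namespace TwoModules

variable {R : Type*} [Category* R] [MonoidalCategory R] [SymmetricCategory R] [TwoRing R]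

namespace TwoMod

/-! ### Invertibility of 2-morphisms. -/

section Iso

variable {M N : TwoMod.{u} R} {F G : Hom M N}

/-- The components are arrows of the groupoid `N`, hence invertible. -/
instance (τ : Hom₂ F G) : IsIso τ.natTrans := NatIso.isIso_of_isIso_app _

/-- The inverse of a 2-morphism. -/
noncomputable def Hom₂.inv (τ : Hom₂ F G) : Hom₂ G F where
  natTrans := CategoryTheory.inv τ.natTrans
  isMonoidal :=
    { unit := by
        rw [NatIso.isIso_inv_app, IsIso.comp_inv_eq]
        exact (NatTrans.IsMonoidal.unit (τ := τ.natTrans)).symm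
      tensor X Y := by
        rw [NatIso.isIso_inv_app, IsIso.comp_inv_eq, Category.assoc,
          NatTrans.IsMonoidal.tensor (τ := τ.natTrans), tensorHom_comp_tensorHom_assoc]
        simp }
  smul r m := by
    rw [NatIso.isIso_inv_app, NatIso.isIso_inv_app, IsIso.inv_comp_eq, ← cancel_mono
      ((N.sm r).map (τ.natTrans.app m))]
    have h := τ.smul r m
    simp only [Category.assoc, ← Functor.map_comp, IsIso.inv_hom_id]
    rw [← h, CategoryTheory.Functor.map_id, Category.comp_id]

/-- Every 2-morphism is invertible. -/
noncomputable def Hom₂.toIso (τ : Hom₂ F G) : F ≅ G where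
  hom := τ
  inv := τ.inv
  hom_inv_id := Hom₂.ext (IsIso.hom_inv_id τ.natTrans)
  inv_hom_id := Hom₂.ext (IsIso.inv_hom_id τ.natTrans)

end Iso

/-! ### 2-morphisms between 1-morphisms of relative cokernels. -/

namespace Coker

variable {A B C : TwoMod.{u} R} {F : Hom A B} {G : Hom B C}
  {φ : Hom₂ (F.comp G) (Hom.zero A C)}

/-- The morphisms `ev b X : G b + X ⟶ X` are natural in `X`. -/
theorem wl_ev_naturality (b : B) {X Y : C} (f : (⟨X⟩ : Coker φ) ⟶ ⟨Y⟩) :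
    wl (G.functor.obj b) f ≫ ev φ b Y = ev φ b X ≫ f := by
  obtain ⟨c, f, rfl⟩ := exists_rep f
  -- The two composites are represented over `c + b` and over `b + c`; the braiding of `B`
  -- identifies these representatives.
  rw [wl_comp, wl_p, wl_ev, Category.assoc, Category.assoc, ev_ev, reassoc_of% ev_p, ev_ev,
    ← p_map_ev (φ := φ) (β_ b c).hom]
  simp only [← p_comp_assoc]
  congr 2
  have h := Functor.LaxBraided.braided (F := G.functor) b c
  simp only [Category.assoc, ← comp_whiskerRight, h, exch]
  simp

/-- Changing the representing object along `u` does not change the class, so only `f` survives. This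
is how the comparison arrows of `K` disappear from the class below. -/
theorem p_tensor_map_ev {X Y : C} {b b' : B} (f : X ⟶ Y) (u : b ⟶ b') :
    p φ (G.functor.map u ⊗ₘ f) ≫ ev φ b' Y = ev φ b X ≫ p φ f := by
  rw [MonoidalCategory.tensorHom_def', p_comp_assoc, p_map_ev, ev_p]

section Homotopy

variable {A' B' C' : TwoMod.{u} R} {F' : Hom A' B'} {G' : Hom B' C'}
  {φ' : Hom₂ (F'.comp G') (Hom.zero A' C')}
  {P P₂ : Hom A A'} {Q Q₂ : Hom B B'} {S S₂ : Hom C C'}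
  {l : Hom₂ (F.comp Q) (P.comp F')} {m : Hom₂ (G.comp S) (Q.comp G')}
  {l₂ : Hom₂ (F.comp Q₂) (P₂.comp F')} {m₂ : Hom₂ (G.comp S₂) (Q₂.comp G')}
  (h : SqCompat φ φ' l m) (h₂ : SqCompat φ φ' l₂ m₂)
  {K : Hom C B'} (σ : Hom₂ S ((K.comp G').add S₂))

/-- The component `S X ⟶ G' (K X) + S₂ X` of a 2-morphism `S ⟹ G' K + S₂`. -/
def app₂ (X : C) : S.functor.obj X ⟶ G'.functor.obj (K.functor.obj X) ⊗ S₂.functor.obj X :=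
  σ.app X

theorem app₂_naturality {X Y : C} (f : X ⟶ Y) :
    S.functor.map f ≫ app₂ σ Y =
      app₂ σ X ≫ (G'.functor.map (K.functor.map f) ⊗ₘ S₂.functor.map f) :=
  σ.natTrans.naturality f

theorem app₂_unit :
    ε S.functor ≫ app₂ σ (𝟙_ C) =
      (λ_ _).inv ≫ ((ε G'.functor ≫ G'.functor.map (ε K.functor)) ⊗ₘ ε S₂.functor) := by
  have e := NatTrans.IsMonoidal.unit (τ := σ.natTrans)
  exact e.trans (sumFunctor_ε _ _)

theorem app₂_tensor (X Y : C) :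
    μ S.functor X Y ≫ app₂ σ (X ⊗ Y) = (app₂ σ X ⊗ₘ app₂ σ Y) ≫ tensorμ _ _ _ _ ≫
      ((μ G'.functor _ _ ≫ G'.functor.map (μ K.functor X Y)) ⊗ₘ μ S₂.functor X Y) := by
  have e := NatTrans.IsMonoidal.tensor (τ := σ.natTrans) X Y
  exact e.trans (congrArg _ (sumFunctor_μ _ _ X Y))

/-- Solved for `δ` and the inverse of `G'.smul`, so that the right side is literally the arrow
occurring in `smC_ev`. -/
theorem app₂_smul (r : R) (X : C) :
    app₂ σ ((C.sm r).obj X) ≫ (G'.functor.map (K.smul r X).hom ⊗ₘ (S₂.smul r X).hom) =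
      (S.smul r X).hom ≫ (C'.sm r).map (app₂ σ X) ≫ δ (C'.sm r) _ _ ≫
        (G'.smul r _).inv ▷ _ := by
  have e : app₂ σ ((C.sm r).obj X) ≫ ((G'.functor.map (K.smul r X).hom ≫ (G'.smul r _).hom) ⊗ₘ
      (S₂.smul r X).hom) ≫ μ (C'.sm r) _ _ =
      (S.smul r X).hom ≫ (C'.sm r).map (app₂ σ X) := σ.smul r X
  rw [← reassoc_of% e, Functor.Monoidal.μ_δ_assoc, ← tensorHom_id, tensorHom_comp_tensorHom]
  simp

/-- The morphism `S X ⟶ S₂ X` of the relative cokernel of `G'` given by a 2-morphism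
`S ⟹ G' K + S₂`. -/
def homotopyApp (X : C) : (⟨S.functor.obj X⟩ : Coker φ') ⟶ ⟨S₂.functor.obj X⟩ :=
  p φ' (app₂ σ X) ≫ ev φ' (K.functor.obj X) (S₂.functor.obj X)

/-- Naturality for the morphisms coming from `C` needs nothing beyond naturality of `σ`; the
condition `hσ` enters only for `ev`. -/
theorem homotopyApp_p {X Y : C} (f : X ⟶ Y) :
    p φ' (S.functor.map f) ≫ homotopyApp σ Y = homotopyApp σ X ≫ p φ' (S₂.functor.map f) := by
  rw [homotopyApp, homotopyApp, ← p_comp_assoc, app₂_naturality, p_comp_assoc, p_tensor_map_ev,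
    Category.assoc]

theorem homotopyApp_tensor (X Y : C) :
    p φ' (μ S.functor X Y) ≫ homotopyApp σ (X ⊗ Y) =
      ten (homotopyApp σ X) (homotopyApp σ Y) ≫ p φ' (μ S₂.functor X Y) := by
  simp only [homotopyApp]
  rw [← ten_comp, ten_p, ten_ev_ev, ← p_comp_assoc, app₂_tensor]
  simp only [Category.assoc, ev_p, ← p_comp_assoc]
  -- The left side is represented over `K (X + Y)`, the right side over `K X + K Y`; additivity of
  -- `K` relates the two.
  rw [← p_map_ev (μ K.functor X Y)]
  simp only [← p_comp_assoc, Category.assoc]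
  congr 2
  rw [MonoidalCategory.tensorHom_def' (_ ≫ _)]
  simp only [comp_whiskerRight, whisker_exchange, whisker_exchange_assoc]

theorem homotopyApp_unit :
    p φ' (ε S.functor) ≫ homotopyApp σ (𝟙_ C) = p φ' (ε S₂.functor) := by
  -- By definition `p` is represented over the unit object of `B'`, and `ε K.functor` carries that
  -- object to `K 0`, over which `homotopyApp` lives.
  have e : p φ' (ε S₂.functor) = p φ' (ε S₂.functor ≫ (λ_ _).inv ≫ ε G'.functor ▷ _) ≫
      ev φ' (𝟙_ B') _ := cls_eq _
  rw [e, homotopyApp, ← p_comp_assoc, app₂_unit, ← p_map_ev (ε K.functor), ← p_comp_assoc]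
  congr 2
  simp [MonoidalCategory.tensorHom_def']

theorem homotopyApp_smul (r : R) (X : C) :
    homotopyApp (φ' := φ') σ ((C.sm r).obj X) ≫ p φ' (S₂.smul r X).hom =
      p φ' (S.smul r X).hom ≫ smC r (homotopyApp σ X) := by
  -- Acting by `r` on the class gives a representative over `r · K X`, whereas the left side lives
  -- over `K (r · X)`; linearity of `K` is the change of representing object.
  rw [homotopyApp, homotopyApp, smC_comp, smC_p, smC_ev, Category.assoc,
    ← p_tensor_map_ev (S₂.smul r X).hom (K.smul r X).hom]
  simp only [← p_comp_assoc]
  congr 2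
  rw [app₂_smul]

-- The extra input for naturality along `ev`. The arrow `a` is a witness for the relation of the
-- relative cokernel: it identifies the class over `Q b` with the class over `K (G b) + Q₂ b`, up to
-- a summand `F' x` that `φ'` kills.
variable (hσ : ∀ b : B, ∃ (x : A')
  (a : Q.functor.obj b ⟶ F'.functor.obj x ⊗ K.functor.obj (G.functor.obj b) ⊗ Q₂.functor.obj b),
  sq m b ≫ cmap φ' a = app₂ σ (G.functor.obj b) ≫ _ ◁ sq m₂ b ≫ μ G'.functor _ _)

include hσ in
-- The relation with witness `a` moves `ev` from `Q b` to the sum `K (G b) + Q₂ b`, and `ev` at a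
-- sum is a composite of two `ev`s. The one at `K (G b)` is the one inside `homotopyApp`.
theorem p_sq_ev (b : B) (Y : C') :
    p φ' (sq m b ▷ Y) ≫ ev φ' (Q.functor.obj b) Y =
      wr (homotopyApp σ (G.functor.obj b) ≫ p φ' (sq m₂ b)) Y ≫ ev φ' (Q₂.functor.obj b) Y := by
  obtain ⟨x, a, e⟩ := hσ b
  rw [← p_cmap_ev a, ← p_comp_assoc, ← comp_whiskerRight, e, homotopyApp]
  simp only [wr_comp, wr_p, wr_ev, Category.assoc, reassoc_of% ev_p, ev_ev, ← p_comp_assoc]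
  congr 2
  simp

include hσ in
-- A morphism is an arrow of `C` followed by `ev b Y`. The first factor is `homotopyApp_p`. For
-- `ev`, additivity splits the component at `G b + Y`: its `G b` part is absorbed by `p_sq_ev`, and
-- its `Y` part slides past `ev`.
theorem homotopyApp_naturality {X Y : C} (f : (⟨X⟩ : Coker φ) ⟶ ⟨Y⟩) :
    cokC h f ≫ homotopyApp σ Y = homotopyApp σ X ≫ cokC h₂ f := by
  obtain ⟨b, f, rfl⟩ := exists_rep f
  have e : homotopyApp (φ' := φ') σ (G.functor.obj b ⊗ Y) =
      p φ' (δ S.functor _ _) ≫ ten (homotopyApp σ _) (homotopyApp σ Y) ≫ p φ' (μ S₂.functor _ _) := by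
    rw [← homotopyApp_tensor, ← p_comp_assoc, Functor.Monoidal.δ_μ, p_id, Category.id_comp]
  rw [cokC_comp, cokC_comp, cokC_p, cokC_p, ← reassoc_of% homotopyApp_p, Category.assoc, cokC_ev,
    cokC_ev, e]
  congr 1
  simp only [p_comp, Category.assoc]
  congr 1
  -- `exchange` lets the `Y` part pass the comparison `sq m₂ b`, which acts on the other summand;
  -- `wl_ev_naturality` then takes it past `ev`.
  rw [← p_comp_assoc (μ _ _ _), Functor.Monoidal.μ_δ, p_id, Category.id_comp,
    reassoc_of% p_sq_ev σ hσ b, ten, Category.assoc, ← wr_p, reassoc_of% exchange, wr_comp,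
    Category.assoc, wl_ev_naturality]

/-- The 2-morphism between the 1-morphisms induced on relative cokernels given by
`σ : S ⟹ G' K + S₂`. -/
def homotopy : Hom₂ (cokerMap φ φ' l m h) (cokerMap φ φ' l₂ m₂ h₂) where
  natTrans :=
    -- The structure arrows of `cokerMap` are the images under `p` of those of `S` and `S₂`, so the
    -- lemmas above are the required axioms up to unfolding.
    { app X := homotopyApp σ X.obj
      naturality _ _ f := homotopyApp_naturality h h₂ σ hσ f }
  isMonoidal :=
    { unit := homotopyApp_unit σ
      tensor X Y := homotopyApp_tensor σ X.obj Y.obj }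
  smul r X := homotopyApp_smul σ r X.obj

end Homotopy

end Coker

/-! ### Contracting the middle summand of a threefold sum. -/

section CancelNull

variable {M N : TwoMod.{u} R} {Φ U V Ψ : Hom M N} (τ : Hom₂ Φ ((U.add V).add Ψ))

theorem app₃_naturality {x y : M} (f : x ⟶ y) :
    Φ.functor.map f ≫ app₃ τ y =
      app₃ τ x ≫ ((U.functor.map f ⊗ₘ V.functor.map f) ⊗ₘ Ψ.functor.map f) :=
  τ.natTrans.naturality f

theorem app₃_unit :
    ε Φ.functor ≫ app₃ τ (𝟙_ M) =
      (λ_ _).inv ≫ (((λ_ _).inv ≫ (ε U.functor ⊗ₘ ε V.functor)) ⊗ₘ ε Ψ.functor) := by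
  have e := NatTrans.IsMonoidal.unit (τ := τ.natTrans)
  refine e.trans ((sumFunctor_ε (sumFunctor U.functor V.functor) Ψ.functor).trans ?_)
  rw [sumFunctor_ε]

/-- Compatibility with units, with every summand collapsed to `0`. It serves in the kernel
condition, where an arrow to `0` has been pushed through `τ'`, and in the lowest degree of a padded
homotopy. -/
theorem app₃_η :
    app₃ τ (𝟙_ M) ≫ ((η U.functor ⊗ₘ η V.functor) ⊗ₘ η Ψ.functor) ≫ (λ_ _).hom ▷ _ ≫
      (λ_ _).hom = η Φ.functor := by
  have e := app₃_unit τ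
  rw [← cancel_epi (ε Φ.functor), reassoc_of% e]
  simp only [tensorHom_comp_tensorHom_assoc, Category.assoc, Functor.Monoidal.ε_η,
    tensorHom_id, ← comp_whiskerRight_assoc, Iso.inv_hom_id, id_whiskerRight,
    Category.id_comp]

theorem app₃_tensor (x y : M) :
    μ Φ.functor x y ≫ app₃ τ (x ⊗ y) = (app₃ τ x ⊗ₘ app₃ τ y) ≫ tensorμ _ _ _ _ ≫
      ((tensorμ _ _ _ _ ≫ (μ U.functor x y ⊗ₘ μ V.functor x y)) ⊗ₘ μ Ψ.functor x y) := by
  have e := NatTrans.IsMonoidal.tensor (τ := τ.natTrans) x y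
  refine e.trans (congrArg _ ((sumFunctor_μ (sumFunctor U.functor V.functor) Ψ.functor x y).trans ?_))
  rw [sumFunctor_μ]
  rfl

theorem app₃_smul (r : R) (x : M) :
    app₃ τ ((M.sm r).obj x) ≫
        ((((U.smul r x).hom ⊗ₘ (V.smul r x).hom) ≫ μ (N.sm r) _ _) ⊗ₘ (Ψ.smul r x).hom) ≫
          μ (N.sm r) _ _ =
      (Φ.smul r x).hom ≫ (N.sm r).map (app₃ τ x) :=
  τ.smul r x

/-- For `n : V x ⟶ 0`, the morphism `Φ x ⟶ (U x + V x) + Ψ x ⟶ U x + Ψ x`. -/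
def cancelNull {x : M} (n : V.functor.obj x ⟶ 𝟙_ N) :
    Φ.functor.obj x ⟶ U.functor.obj x ⊗ Ψ.functor.obj x :=
  app₃ τ x ≫ (_ ◁ n ≫ (ρ_ _).hom) ▷ _

/-- The contracting arrow is not fixed: it is pulled back along `f`, just as a morphism of the
relative kernel pulls back the arrow to `0` of its target. -/
theorem cancelNull_naturality {x y : M} (f : x ⟶ y) (n : V.functor.obj y ⟶ 𝟙_ N) :
    Φ.functor.map f ≫ cancelNull τ n =
      cancelNull τ (V.functor.map f ≫ n) ≫ (U.functor.map f ⊗ₘ Ψ.functor.map f) := by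
  have e : (U.functor.map f ⊗ₘ V.functor.map f) ≫ _ ◁ n ≫ (ρ_ _).hom =
      (_ ◁ (V.functor.map f ≫ n) ≫ (ρ_ _).hom) ≫ U.functor.map f := by
    rw [MonoidalCategory.tensorHom_def', Category.assoc, ← whisker_exchange_assoc,
      rightUnitor_naturality, MonoidalCategory.whiskerLeft_comp, Category.assoc, Category.assoc]
  rw [cancelNull, cancelNull, reassoc_of% app₃_naturality, Category.assoc, ← tensorHom_id,
    ← tensorHom_id, tensorHom_comp_tensorHom, tensorHom_comp_tensorHom, Category.comp_id,
    Category.id_comp, e]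

/-- The choice `η V.functor` is the one provided by the zero object of the relative kernel. -/
theorem cancelNull_unit :
    ε Φ.functor ≫ cancelNull τ (η V.functor) =
      (λ_ _).inv ≫ (ε U.functor ⊗ₘ ε Ψ.functor) := by
  rw [cancelNull, reassoc_of% app₃_unit, ← tensorHom_id, tensorHom_comp_tensorHom,
    Category.comp_id, MonoidalCategory.tensorHom_def (ε U.functor)]
  simp only [Category.assoc, ← MonoidalCategory.whiskerLeft_comp_assoc, Functor.Monoidal.ε_η]
  simp [unitors_inv_equal]

/-- `addNull` is how sums in the relative kernel combine arrows to `0`. Contracting after adding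
agrees with adding after contracting because the right unitor is itself additive. -/
theorem cancelNull_tensor {x y : M} (n : V.functor.obj x ⟶ 𝟙_ N) (n' : V.functor.obj y ⟶ 𝟙_ N) :
    μ Φ.functor x y ≫ cancelNull τ (addNull V n n') =
      (cancelNull τ n ⊗ₘ cancelNull τ n') ≫ tensorμ _ _ _ _ ≫
        (μ U.functor x y ⊗ₘ μ Ψ.functor x y) := by
  -- The statement for `U + V` alone, leaving out the summand `Ψ`. The left unitor on `0 + 0` inside
  -- `addNull` is the one that `rightUnitor_monoidal` produces.
  have e : (tensorμ _ _ _ _ ≫ (μ U.functor x y ⊗ₘ μ V.functor x y)) ≫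
      _ ◁ addNull V n n' ≫ (ρ_ _).hom =
      ((_ ◁ n ≫ (ρ_ _).hom) ⊗ₘ (_ ◁ n' ≫ (ρ_ _).hom)) ≫ μ U.functor x y := by
    have e' := tensorμ_natural (𝟙 (U.functor.obj x)) n (𝟙 (U.functor.obj y)) n'
    rw [id_tensorHom, id_tensorHom, id_tensorHom_id, id_tensorHom] at e'
    rw [← tensorHom_comp_tensorHom, rightUnitor_monoidal, addNull,
      MonoidalCategory.tensorHom_def (μ U.functor x y)]
    simp only [Category.assoc, reassoc_of% e']
    rw [← MonoidalCategory.whiskerLeft_comp_assoc, Functor.Monoidal.μ_δ_assoc,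
      ← whisker_exchange_assoc, rightUnitor_naturality, MonoidalCategory.whiskerLeft_comp,
      Category.assoc]
  rw [cancelNull, reassoc_of% app₃_tensor, ← tensorHom_id, tensorHom_comp_tensorHom, e,
    Category.comp_id, cancelNull, cancelNull, ← tensorHom_comp_tensorHom (app₃ τ x), Category.assoc,
    ← tensorHom_id, ← tensorHom_id, tensorμ_natural_assoc, tensorHom_comp_tensorHom,
    id_tensorHom_id, Category.id_comp]

/-- The arrow `r · 0 ≅ 0` hidden in `smulNull` is the unit constraint of `r · -`, so the contraction
commutes with the action because `r · -` preserves right unitors. -/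
theorem cancelNull_smul (r : R) {x : M} (n : V.functor.obj x ⟶ 𝟙_ N) :
    cancelNull τ (smulNull V r n) ≫ ((U.smul r x).hom ⊗ₘ (Ψ.smul r x).hom) ≫ μ (N.sm r) _ _ =
      (Φ.smul r x).hom ≫ (N.sm r).map (cancelNull τ n) := by
  have e : _ ◁ smulNull V r n ≫ (ρ_ _).hom ≫ (U.smul r x).hom =
      (((U.smul r x).hom ⊗ₘ (V.smul r x).hom) ≫ μ (N.sm r) _ _) ≫
        (N.sm r).map (_ ◁ n ≫ (ρ_ _).hom) := by
    rw [Functor.map_comp, Category.assoc, ← μ_natural_right_assoc,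
      Functor.Monoidal.map_rightUnitor, Functor.Monoidal.μ_δ_assoc,
      MonoidalCategory.tensorHom_def, smulNull, ← rightUnitor_naturality, whisker_exchange_assoc]
    simp only [MonoidalCategory.whiskerLeft_comp, Category.assoc]
  rw [cancelNull, cancelNull, Functor.map_comp, ← reassoc_of% app₃_smul, ← μ_natural_left,
    Category.assoc, ← tensorHom_id, ← tensorHom_id, tensorHom_comp_tensorHom_assoc,
    tensorHom_comp_tensorHom_assoc, Category.assoc, e, Category.id_comp, Category.comp_id]

end CancelNull

/-! ### Arrows to zero under composition with a 1-morphism. -/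

section CompNull

variable {A B C : TwoMod.{u} R} {F : Hom A B} (H : Hom B C)

/-- For `a : F X ⟶ 0`, the morphism `H (F X) ⟶ H 0 ≅ 0`. -/
def compNull {X : A} (a : F.functor.obj X ⟶ 𝟙_ B) :
    (F.comp H).functor.obj X ⟶ 𝟙_ C :=
  H.functor.map a ≫ η H.functor

/-- This lemma and the next two turn the pullbacks, sums and multiples of contracting arrows arising
in the `cancelNull` lemmas back into arrows induced by kernel objects. The `change`s unfold the
structure of a composite 1-morphism. -/
theorem map_compNull {X Y : A} (f : X ⟶ Y) (a : F.functor.obj Y ⟶ 𝟙_ B) :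
    (F.comp H).functor.map f ≫ compNull H a = compNull H (F.functor.map f ≫ a) := by
  change H.functor.map (F.functor.map f) ≫ H.functor.map a ≫ η H.functor =
    H.functor.map (F.functor.map f ≫ a) ≫ η H.functor
  rw [Functor.map_comp, Category.assoc]

theorem addNull_compNull {X Y : A} (a : F.functor.obj X ⟶ 𝟙_ B) (b : F.functor.obj Y ⟶ 𝟙_ B) :
    addNull (F.comp H) (compNull H a) (compNull H b) = compNull H (addNull F a b) := by
  change (H.functor.map (δ F.functor X Y) ≫ δ H.functor _ _) ≫
      ((H.functor.map a ≫ η H.functor) ⊗ₘ (H.functor.map b ≫ η H.functor)) ≫ (λ_ (𝟙_ C)).hom =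
    H.functor.map (δ F.functor X Y ≫ (a ⊗ₘ b) ≫ (λ_ (𝟙_ B)).hom) ≫ η H.functor
  simp only [Functor.map_comp, Category.assoc, map_leftUnitor_η, ← tensorHom_comp_tensorHom,
    δ_natural_assoc]

theorem smulNull_compNull (r : R) {X : A} (a : F.functor.obj X ⟶ 𝟙_ B) :
    smulNull (F.comp H) r (compNull H a) = compNull H (smulNull F r a) := by
  change (H.functor.map (F.smul r X).hom ≫ (H.smul r _).hom) ≫
      (C.sm r).map (H.functor.map a ≫ η H.functor) ≫ η (C.sm r) =
    H.functor.map ((F.smul r X).hom ≫ (B.sm r).map a ≫ η (B.sm r)) ≫ η H.functor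
  simp only [Functor.map_comp, Category.assoc, H.smul_zero]
  rw [reassoc_of% H.smul_naturality_right]

end CompNull

/-! ### Restriction of 1-morphisms to the relative kernel. -/

namespace Ker

variable {A B C N : TwoMod.{u} R} {F : Hom A B} {G : Hom B C}
  (φ : Hom₂ (F.comp G) (Hom.zero A C))

/-- The 1-morphism `(X, a) ↦ H X` on the relative kernel. -/
def restrict (H : Hom A N) : Hom (ker φ) N where
  functor :=
    { obj X := H.functor.obj (Ker.obj (φ := φ) X)
      map f := H.functor.map (KHom.hom (φ := φ) f)
      map_id _ := H.functor.map_id _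
      map_comp _ _ := H.functor.map_comp _ _ }
  braided :=
    -- Sums, the zero object and the action in the kernel are those of `A` on underlying objects,
    -- and so are the structure isomorphisms; hence each axiom is the one for `H` at underlying
    -- objects.
    { ε := ε H.functor
      η := η H.functor
      μ X Y := μ H.functor (Ker.obj (φ := φ) X) (Ker.obj (φ := φ) Y)
      δ X Y := δ H.functor (Ker.obj (φ := φ) X) (Ker.obj (φ := φ) Y)
      μ_natural_left _ _ := μ_natural_left H.functor _ _
      μ_natural_right _ _ := μ_natural_right H.functor _ _
      associativity _ _ _ := Functor.LaxMonoidal.associativity H.functor _ _ _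
      left_unitality _ := Functor.LaxMonoidal.left_unitality H.functor _
      right_unitality _ := Functor.LaxMonoidal.right_unitality H.functor _
      δ_natural_left _ _ := δ_natural_left H.functor _ _
      δ_natural_right _ _ := δ_natural_right H.functor _ _
      oplax_associativity _ _ _ := Functor.OplaxMonoidal.associativity H.functor _ _ _
      oplax_left_unitality _ := Functor.OplaxMonoidal.left_unitality H.functor _
      oplax_right_unitality _ := Functor.OplaxMonoidal.right_unitality H.functor _
      ε_η := Functor.Monoidal.ε_η H.functor
      η_ε := Functor.Monoidal.η_ε H.functor
      μ_δ _ _ := Functor.Monoidal.μ_δ H.functor _ _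
      δ_μ _ _ := Functor.Monoidal.δ_μ H.functor _ _
      braided _ _ := Functor.LaxBraided.braided (F := H.functor) _ _ }
  smul r X := H.smul r (Ker.obj (φ := φ) X)
  smul_naturality_left f X := H.smul_naturality_left f (Ker.obj (φ := φ) X)
  smul_naturality_right r _ _ f := H.smul_naturality_right r (KHom.hom (φ := φ) f)
  smul_add r X Y := H.smul_add r (Ker.obj (φ := φ) X) (Ker.obj (φ := φ) Y)
  smul_zero r := H.smul_zero r
  smul_dist r s X := H.smul_dist r s (Ker.obj (φ := φ) X)
  smul_assoc r s X := H.smul_assoc r s (Ker.obj (φ := φ) X)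
  smul_one X := H.smul_one (Ker.obj (φ := φ) X)

end Ker

/-! ### Two consequences of the homotopy condition at one object. -/

section Expand

-- The hypothesis `h` is `HomotopyCompat` at an object `x`, with `F` standing for `e`: `t` and `t'`
-- are the components of `τ` and `τ'`, `s` and `s₂` those of `l` and `m`, `u` is that of `β`, and
-- `n` is `h''` applied to `α`. Isolating this shape keeps the calculations free of 1-morphisms.
variable {C D : Type*} [Category* C] [MonoidalCategory C] [Category* D] [MonoidalCategory D]
  (F : C ⥤ D) [F.Monoidal] {P U V W : C} {Y Y₂ N : D} {s : Y ⟶ F.obj P} {s₂ : Y₂ ⟶ F.obj W}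
  {t : P ⟶ (U ⊗ V) ⊗ W} {t' : Y ⟶ (F.obj V ⊗ N) ⊗ Y₂} {u : F.obj U ⟶ 𝟙_ D} {n : N ⟶ 𝟙_ D}
  (h : t' ≫ (_ ◁ n ⊗ₘ s₂) ≫ (ρ_ _).hom ▷ _ =
    s ≫ F.map t ≫ δ F _ _ ≫ δ F _ _ ▷ _ ≫ (u ▷ _) ▷ _ ≫ (λ_ _).hom ▷ _)

include h

/-- Postcomposing `h` with arrows that send the two remaining summands to `0` gives both sides. This
form is for the kernel condition, where `v` and `w` come from an object of the relative kernel. -/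
theorem map_cancel_right (v : V ⟶ 𝟙_ C) (w : F.obj W ⟶ 𝟙_ D) :
    s ≫ F.map (t ≫ (_ ◁ v ≫ (ρ_ _).hom) ▷ _) ≫ δ F _ _ ≫ (u ⊗ₘ w) ≫ (λ_ _).hom =
      t' ≫ (((F.map v ≫ η F) ⊗ₘ n) ⊗ₘ (s₂ ≫ w)) ≫ (λ_ _).hom ▷ _ ≫ (λ_ _).hom := by
  have k := congrArg (fun f => f ≫ ((F.map v ≫ η F) ⊗ₘ w) ≫ (λ_ _).hom) h
  have e₁ : (((F.map v ≫ η F) ⊗ₘ n) ⊗ₘ (s₂ ≫ w)) ≫ (λ_ _).hom ▷ _ =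
      (_ ◁ n ⊗ₘ s₂) ≫ (ρ_ _).hom ▷ _ ≫ ((F.map v ≫ η F) ⊗ₘ w) := by
    rw [← tensorHom_id, ← tensorHom_id, tensorHom_comp_tensorHom, tensorHom_comp_tensorHom,
      tensorHom_comp_tensorHom, MonoidalCategory.tensorHom_def' (_ ≫ _) n, Category.assoc,
      ← rightUnitor_naturality, unitors_equal, Category.comp_id, Category.id_comp]
  -- Contracting `F U` by `u` and `V` by `v` may be done in either order, as they act on different
  -- summands; on the unit object the left and right unitors coincide.
  have e₂ : δ F U V ≫ (u ⊗ₘ 𝟙 _) ≫ (λ_ _).hom ≫ F.map v ≫ η F =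
      F.map (U ◁ v ≫ (ρ_ _).hom) ≫ u := by
    rw [Functor.map_comp, Functor.Monoidal.map_rightUnitor, Category.assoc, Category.assoc,
      Category.assoc, ← rightUnitor_naturality, ← δ_natural_right_assoc,
      whisker_exchange_assoc, whisker_exchange_assoc, ← unitors_equal, tensorHom_id,
      leftUnitor_naturality, leftUnitor_naturality_assoc]
  simp only [Category.assoc] at k
  rw [reassoc_of% e₁, k, Functor.map_comp, Category.assoc, ← δ_natural_left_assoc]
  simp only [← tensorHom_id, tensorHom_comp_tensorHom_assoc, Category.id_comp]
  rw [e₂]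

/-- Here only `U` is contracted and the other two summands are kept. The left side is the form taken
by `cmap` at the reassociated `t`, so this is the source of the hypothesis `hσ` of `Coker.homotopy`.
-/
theorem map_cancel_left :
    s ≫ F.map (t ≫ (α_ _ _ _).hom) ≫ δ F _ _ ≫ u ▷ _ ≫ (λ_ _).hom =
      (t' ≫ (_ ◁ n ≫ (ρ_ _).hom) ▷ _) ≫ _ ◁ s₂ ≫ μ F _ _ := by
  have k := congrArg (fun f => f ≫ μ F _ _) h
  have e : (_ ◁ n ⊗ₘ s₂) ≫ (ρ_ (F.obj V)).hom ▷ _ = (_ ◁ n ≫ (ρ_ _).hom) ▷ _ ≫ _ ◁ s₂ := by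
    rw [MonoidalCategory.tensorHom_def, comp_whiskerRight, Category.assoc, Category.assoc,
      whisker_exchange]
  simp only [Category.assoc] at k
  rw [reassoc_of% e] at k
  simp only [Category.assoc]
  -- Preservation of the associator by `F` turns contraction inside `(U + V) + W` into contraction
  -- of the isolated first summand of `U + (V + W)`.
  rw [k, Functor.map_comp, Functor.Monoidal.map_associator]
  simp only [Category.assoc, Functor.Monoidal.μ_δ_assoc]
  rw [whisker_exchange_assoc, leftUnitor_naturality, ← associator_naturality_left_assoc,
    leftUnitor_tensor_hom, Category.assoc, Iso.hom_inv_id_assoc]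

end Expand

/-! ### The homotopy on relative kernels. -/

section KerHomotopy

variable {A B C Z' A' B' C' : TwoMod.{u} R} {F : Hom A B} {G : Hom B C} {F' : Hom A' B'}
  {G' : Hom B' C'} {E' : Hom Z' A'}
  {P P₂ : Hom A A'} {Q Q₂ : Hom B B'} {S S₂ : Hom C C'}
  {φ : Hom₂ (F.comp G) (Hom.zero A C)} {φ' : Hom₂ (F'.comp G') (Hom.zero A' C')}
  {ψ' : Hom₂ (E'.comp F') (Hom.zero Z' B')}
  {l : Hom₂ (F.comp Q) (P.comp F')} {m : Hom₂ (G.comp S) (Q.comp G')}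
  {l₂ : Hom₂ (F.comp Q₂) (P₂.comp F')} {m₂ : Hom₂ (G.comp S₂) (Q₂.comp G')}
  (h : SqCompat φ φ' l m) (h₂ : SqCompat φ φ' l₂ m₂)
  (hψ' : ∀ z, G'.functor.map (null ψ' z) ≫ η G'.functor = null φ' (E'.functor.obj z))
  {H : Hom A Z'} {H' : Hom B A'} {H'' : Hom C B'}
  {τ : Hom₂ P (((H.comp E').add (F.comp H')).add P₂)}
  {τ' : Hom₂ Q (((H'.comp F').add (G.comp H'')).add Q₂)}
  (hτ : HomotopyCompat φ ψ' l l₂ τ τ')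

include hτ in
-- Precomposed with `sq l X`, both sides become total contractions of `τ'` at `F X`: the left one by
-- `map_cancel_right`, the right one by naturality of `τ'` along `a` and `app₃_η`. This is the
-- condition for the contracted arrow to be a morphism of the relative kernel.
theorem cancelNull_compNull_transNull {X : A} (a : F.functor.obj X ⟶ 𝟙_ B)
    (ha : G.functor.map a ≫ η G.functor = null φ X) :
    F'.functor.map (cancelNull τ (compNull H' a)) ≫
        addNull F' (null ψ' (H.functor.obj X)) (transNull l₂ a) =
      transNull l a := by
  have e₁ := app₃_naturality τ' a
  have e₂ := app₃_η τ'
  -- The two contractions agree summand by summand. The middle one is where `ha` is needed: it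
  -- trades the 2-morphism `φ` for the arrow `a`.
  have e₃ : (((F'.functor.map (compNull H' a) ≫ η F'.functor) ⊗ₘ
      (H''.functor.map (null φ X) ≫ η H''.functor)) ⊗ₘ (sq l₂ X ≫ transNull l₂ a)) =
      ((F'.functor.map (H'.functor.map a) ⊗ₘ H''.functor.map (G.functor.map a)) ⊗ₘ
        Q₂.functor.map a) ≫
      (((F'.functor.map (η H'.functor) ≫ η F'.functor) ⊗ₘ
        (H''.functor.map (η G.functor) ≫ η H''.functor)) ⊗ₘ η Q₂.functor) := by
    rw [transNull, IsIso.hom_inv_id_assoc, tensorHom_comp_tensorHom, tensorHom_comp_tensorHom,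
      ← ha, Functor.map_comp, Category.assoc, ← Category.assoc (F'.functor.map _),
      ← Functor.map_comp]
    rfl
  have e₄ : sq l X ≫ transNull l a = Q.functor.map a ≫ η Q.functor := by
    rw [transNull, IsIso.hom_inv_id_assoc]
  rw [← cancel_epi (sq l X), e₄, ← e₂, reassoc_of% e₁]
  refine (map_cancel_right F'.functor (hτ X) (compNull H' a) (transNull l₂ a)).trans ?_
  exact (congrArg (fun f => app₃ τ' (F.functor.obj X) ≫ f ≫ (λ_ _).hom ▷ _ ≫ (λ_ _).hom) e₃).trans
    (congrArg _ (Category.assoc _ _ _))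

open Ker in
/-- The 2-morphism between the 1-morphisms induced on relative kernels. -/
def kerHomotopy : Hom₂ (kerMap φ φ' l m h)
    (((restrict φ H).comp (kerLift φ' E' ψ' hψ')).add (kerMap φ φ' l₂ m₂ h₂)) where
  natTrans :=
    { app X := (⟨cancelNull τ (compNull H' (Ker.hom (φ := φ) X)),
        cancelNull_compNull_transNull hτ _ (Ker.w (φ := φ) X)⟩ :
        KHom (φ := φ') ⟨_, _, transNull_w h X⟩ (add ⟨_, _, hψ' _⟩ ⟨_, _, transNull_w h₂ X⟩))
      naturality X Y f := hom_ext (by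
        -- Since `f` carries the arrow to `0` of `Y` back to that of `X`, the pulled-back
        -- contraction is the one belonging to `X`.
        have e := cancelNull_naturality τ (KHom.hom (φ := φ) f) (compNull H' (Ker.hom (φ := φ) Y))
        rw [map_compNull, KHom.w (φ := φ) f] at e
        exact e) }
  isMonoidal :=
    -- The zero object of the kernel carries `η F.functor`, and `compNull H'` of it is by definition
    -- the counit of the composite of `F` and `H'`.
    { unit := (hom_ext (cancelNull_unit τ)).trans (sumFunctor_ε
        ((restrict φ H).comp (kerLift φ' E' ψ' hψ')).functor (kerMap φ φ' l₂ m₂ h₂).functor).symm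
      tensor X Y := by
        have e := cancelNull_tensor τ (compNull H' (Ker.hom (φ := φ) X))
          (compNull H' (Ker.hom (φ := φ) Y))
        rw [addNull_compNull] at e
        exact (hom_ext e).trans (congrArg _ (sumFunctor_μ
          ((restrict φ H).comp (kerLift φ' E' ψ' hψ')).functor (kerMap φ φ' l₂ m₂ h₂).functor
          X Y).symm) }
  smul r X := hom_ext (by
    have e := cancelNull_smul τ r (compNull H' (Ker.hom (φ := φ) X))
    rw [smulNull_compNull] at e
    exact e)

end KerHomotopy

/-! ### From kernels to cohomology. -/

section CohomologyHomotopy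

variable {W Z A B C W' Z' A' B' C' : TwoMod.{u} R}
  {D : Hom W Z} {E : Hom Z A} {F : Hom A B} {G : Hom B C}
  {D' : Hom W' Z'} {E' : Hom Z' A'} {F' : Hom A' B'} {G' : Hom B' C'}
  {φ : Hom₂ (F.comp G) (Hom.zero A C)} {φ' : Hom₂ (F'.comp G') (Hom.zero A' C')}
  {ψ : Hom₂ (E.comp F) (Hom.zero Z B)} {ψ' : Hom₂ (E'.comp F') (Hom.zero Z' B')}
  {χ : Hom₂ (D.comp E) (Hom.zero W A)} {χ' : Hom₂ (D'.comp E') (Hom.zero W' A')}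
  (hψ : ∀ z, G.functor.map (null ψ z) ≫ η G.functor = null φ (E.functor.obj z))
  (hψ' : ∀ z, G'.functor.map (null ψ' z) ≫ η G'.functor = null φ' (E'.functor.obj z))
  (hχ : ∀ w, F.functor.map (null χ w) ≫ η F.functor = null ψ (D.functor.obj w))
  (hχ' : ∀ w, F'.functor.map (null χ' w) ≫ η F'.functor = null ψ' (D'.functor.obj w))
  {V V₂ : Hom W W'} {T T₂ : Hom Z Z'} {P P₂ : Hom A A'} {Q Q₂ : Hom B B'} {S S₂ : Hom C C'}
  {v : Hom₂ (D.comp T) (V.comp D')} {v₂ : Hom₂ (D.comp T₂) (V₂.comp D')}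
  {t : Hom₂ (E.comp P) (T.comp E')} {t₂ : Hom₂ (E.comp P₂) (T₂.comp E')}
  {l : Hom₂ (F.comp Q) (P.comp F')} {l₂ : Hom₂ (F.comp Q₂) (P₂.comp F')}
  {m : Hom₂ (G.comp S) (Q.comp G')} {m₂ : Hom₂ (G.comp S₂) (Q₂.comp G')}
  (h : SqCompat φ φ' l m) (h₂ : SqCompat φ φ' l₂ m₂)
  (ht : SqCompat ψ ψ' t l) (ht₂ : SqCompat ψ ψ' t₂ l₂)
  (hc : SqCompat (kerLiftNull φ E ψ hψ D χ hχ) (kerLiftNull φ' E' ψ' hψ' D' χ' hχ') v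
    (kerLiftSq φ φ' l m ψ ψ' t h ht hψ hψ'))
  (hc₂ : SqCompat (kerLiftNull φ E ψ hψ D χ hχ) (kerLiftNull φ' E' ψ' hψ' D' χ' hχ') v₂
    (kerLiftSq φ φ' l₂ m₂ ψ ψ' t₂ h₂ ht₂ hψ hψ'))
  {H₀ : Hom Z W'} {H : Hom A Z'} {H' : Hom B A'} {H'' : Hom C B'}
  {τ₀ : Hom₂ T (((H₀.comp D').add (E.comp H)).add T₂)}
  {τ : Hom₂ P (((H.comp E').add (F.comp H')).add P₂)}
  {τ' : Hom₂ Q (((H'.comp F').add (G.comp H'')).add Q₂)}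
  (hτ₀ : HomotopyCompat ψ χ' t t₂ τ₀ τ) (hτ : HomotopyCompat φ ψ' l l₂ τ τ')

/-- The 2-morphism between the 1-morphisms induced on cohomology by two homotopic morphisms. -/
noncomputable def cokerKerHomotopy :
    Hom₂ (cokerMap _ _ v (kerLiftSq φ φ' l m ψ ψ' t h ht hψ hψ') hc)
      (cokerMap _ _ v₂ (kerLiftSq φ φ' l₂ m₂ ψ ψ' t₂ h₂ ht₂ hψ hψ') hc₂) :=
  Coker.homotopy hc hc₂ (kerHomotopy h h₂ hψ' hτ) fun z =>
    -- The witness for the relation is the homotopy one degree lower: bracketed to the right, `τ₀`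
    -- is an arrow from `T z` to `D' (H₀ z)` plus the required sum. Its validity is `hτ₀`, because
    -- the kernel object attached to `z` carries `null ψ z`.
    ⟨H₀.functor.obj z, app₃ τ₀ z ≫ (α_ _ _ _).hom,
      Ker.hom_ext (map_cancel_left E'.functor (hτ₀ z))⟩

end CohomologyHomotopy

/-! ### Extension of homotopies by zero. -/

/-- The 2-morphism between two 1-morphisms to the zero module. -/
def toZero {M : TwoMod.{u} R} (F G : Hom M (zeroMod R)) : Hom₂ F G where
  natTrans :=
    { app _ := eqToHom (Subsingleton.elim (α := Discrete PUnit.{u + 1}) _ _)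
      naturality _ _ _ := Subsingleton.elim (α := _ ⟶ (_ : Discrete PUnit.{u + 1})) _ _ }
  isMonoidal :=
    { unit := Subsingleton.elim (α := _ ⟶ (_ : Discrete PUnit.{u + 1})) _ _
      tensor _ _ := Subsingleton.elim (α := _ ⟶ (_ : Discrete PUnit.{u + 1})) _ _ }
  smul _ _ := Subsingleton.elim (α := _ ⟶ (_ : Discrete PUnit.{u + 1})) _ _

/-- A homotopy extended by zero to the left is compatible with the structure in degree zero. -/
theorem homotopyCompat_zero {M M' N : TwoMod.{u} R} {d : Hom M M'} {h : Hom M (zeroMod R)}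
    {h' : Hom M' N} {f g : Hom M N}
    (τ : Hom₂ f (((h.comp (Hom.zero (zeroMod R) N)).add (d.comp h')).add g)) :
    HomotopyCompat (h := Hom.zero (zeroMod R) (zeroMod R)) (zeroComp (zeroMod R) d)
      (zeroComp (zeroMod R) (Hom.zero (zeroMod R) N)) (zeroSq (Hom.zero _ (zeroMod R)) f)
      (zeroSq (Hom.zero _ (zeroMod R)) g) (toZero (Hom.zero _ (zeroMod R)) _) τ := fun _ => by
  -- Everything happens at the zero object, so the condition is compatibility of `τ` with units,
  -- rearranged by unitors. The factor `𝟙 ≫ 𝟙` is the counit of `h` followed by the zero 1-morphism,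
  -- and the other identities and unitors are the structure of zero 1-morphisms.
  have key : ∀ {X V W : N} (x : X ⟶ (𝟙_ N ⊗ V) ⊗ W) (y : X ⟶ 𝟙_ N) (v : V ⟶ 𝟙_ N) (w : W ⟶ 𝟙_ N),
      x ≫ (((𝟙 (𝟙_ N) ≫ 𝟙 (𝟙_ N)) ⊗ₘ v) ⊗ₘ w) ≫ (λ_ (𝟙_ N)).hom ▷ _ ≫ (λ_ (𝟙_ N)).hom = y →
      x ≫ (_ ◁ v ⊗ₘ w) ≫ (ρ_ (𝟙_ N)).hom ▷ _ = y ≫ 𝟙 _ ≫ (λ_ (𝟙_ N)).inv ≫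
        (λ_ (𝟙_ N)).inv ▷ _ ≫ (𝟙 (𝟙_ N) ▷ _) ▷ _ ≫ (λ_ (𝟙_ N)).hom ▷ _ := by
    intro X V W x y v w e
    rw [← cancel_mono (λ_ (𝟙_ N)).hom, ← e]
    simp [unitors_equal, unitors_inv_equal]
  exact key _ _ _ _ (app₃_η τ)

end TwoMod

open TwoMod

namespace Cochain

namespace Homotopy

variable {A B : Cochain.{u} R} {F G : Mor A B}

/-- The homotopy extended by zero. -/
def pad (H : Homotopy F G) : Homotopy F.pad G.pad where
  h
    -- `B.pad.pad.X (n + 1)` is `B.pad.X n`, so in positive degrees the given data fit unchanged;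
    -- the new degree `0` maps between zero modules.
    | 0 => Hom.zero (zeroMod R) (zeroMod R)
    | n + 1 => H.h n
  τ
    | 0 => toZero _ _
    | n + 1 => H.τ n
  w
    | 0 => homotopyCompat_zero (H.τ 0)
    | n + 1 => H.w n

/-- The 2-morphism induced on `cohomologyAt` by a homotopy. -/
noncomputable def mapAt (H : Homotopy F G) (n : ℕ) : Hom₂ (F.mapAt n) (G.mapAt n) :=
  -- `cohomologyAt n` sits in degree `n + 2`: `H.w (n + 2)` gives the kernel condition and `H.w (n +
  -- 1)` naturality along `ev`.
  cokerKerHomotopy (A.w (n + 1)) (B.w (n + 1)) (A.w n) (B.w n) (F.w (n + 2)) (G.w (n + 2))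
    (F.w (n + 1)) (G.w (n + 1)) _ _ (H.w (n + 1)) (H.w (n + 2))

end Homotopy

end Cochain

end TwoModules

theorem proposition1 {R : Type*} [Category* R] [MonoidalCategory R] [SymmetricCategory R]
    [TwoModules.TwoRing R] {A B : TwoModules.Cochain.{u} R}
    (F G : TwoModules.Cochain.Mor A B) (h : TwoModules.Cochain.Homotopic F G) (n : ℕ) :
    Nonempty (TwoModules.Cochain.Mor.map F n ≅ TwoModules.Cochain.Mor.map G n) := by
  obtain ⟨H⟩ := h
  -- Two paddings, matching those in `cohomology`, move degree `n` to degree `n + 2`.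
  exact ⟨(H.pad.pad.mapAt n).toIso⟩
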